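/- Let $I=(0,1)$, let $1<\beta<\infty$, and let $p,q,w\in L^\infty(\mathbb R)$ satisfy $0\le q\le\beta$, $1/\beta\le p\le\beta$ and $1/\beta\le w\le\beta$ a.e. Put $s=\sqrt{w/p}$. Let $\varphi:[0,+\infty)\to[0,+\infty]$ be lower semicontinuous and strictly convex, i.e. $\varphi(ax+by)<a\varphi(x)+b\varphi(y)$ for all $x\ne y$ and $a,b>0$ with $a+b=1$ (so $\varphi$ is finite on $(0,+\infty)$, while $\varphi(0)=+\infty$ is allowed), and assume that $\lim_{t\to+\infty}\varphi(t)/t$ exists and equals $0$ or $+\infty$. For a bounded open set $A\subset\mathbb R$ let $$\lambda(A)=\min_{u\in H^1_0(A),\,u\ne0}\frac{\int_A p\,u'^2\,dx+\int_A q\,u^2\,dx}{\int_A w\,u^2\,dx}\quad(A\neq\emptyset),\qquad \lambda(\emptyset)=+\infty .$$ For $n\ge1$ let $\mathcal C_n$ be the set of families $\{I_j\}_{j=1}^n$ with $I_j=(x_{j-1},x_j)$ and $0=x_0\le x_1\le\dots\le x_n=1$. For $\{I_j\}\in\mathcal C_n$ let $$F_n(\{I_j\})=\frac1n\sum_{j=1}^n\varphi\Big(\frac{n}{\lambda(I_j)^{1/2}}\Big),$$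 where $n/(+\infty)^{1/2}=0$, and let $\mu_{\{I_j\}}$ be the probability measure on $\overline I=[0,1]$ given by $$\mu_{\{I_j\}}=\frac1n\sum_{j:\,x_{j-1}<x_j}\frac{1}{\mathcal L(I_j)}\chi_{I_j}\mathcal L+\frac1n\sum_{j:\,x_{j-1}=x_j}\delta_{x_j},$$ with $\mathcal L$ the Lebesgue measure. Let $\{I^n_j\}\in\mathcal C_n$, $I^n_j=(x^n_{j-1},x^n_j)$, $n\ge1$, be a minimizing sequence, i.e. $F_n(\{I^n_j\})\le\inf_{\mathcal C_n}F_n+\varepsilon_n$ for all $n$, where $\varepsilon_n\to0$ (in particular, $\{I_j^n\}$ may be an optimal partition for every $n$). Then, as $n\to\infty$: 1. The measures $\mu_{\{I^n_j\}}$ converge weak* in the space of probability measures on $\overline I$ to the probability measure which is absolutely continuous with respect to the Lebesgue measure, with density $f_\infty=s/\int_I s\,dt$. In particular, the limit depends neither on $q$ nor on $\varphi$. 2. For every open set $A\subset I$, $$\sum_{j:\,x^n_{j-1}<x^n_j}\frac{\mathcal L(I^n_j\cap A)}{n\,\mathcal L(I^n_j)}+\frac{\sharp\{j:\ x^n_j\in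 A,\ x^n_{j-1}=x^n_j\}}{n}\ \longrightarrow\ \int_A f_\infty\,dx .$$ 3. $\displaystyle F_n(\{I^n_j\})\to\varphi\Big(\frac1\pi\int_I s\,dx\Big)$ and $\displaystyle\inf_{\mathcal C_n}F_n\to\varphi\Big(\frac1\pi\int_I s\,dx\Big)$. -/

import Mathlib

open MeasureTheory Set Filter Topology
open scoped ENNReal NNReal ContDiff

/-- `u ∈ H¹₀(A)` with weak derivative `v`: the pair `(u, v)` lies in the closure of
`{(ψ, ψ') : ψ ∈ C_c^∞(A)}` in `L²(A) × L²(A)`, i.e. `u` belongs to the closure of `C_c^∞(A)` in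
`H¹(A)`. The function `v` is then automatically the weak derivative of `u` on `A`. -/
def MemH10 (A : Set ℝ) (u v : ℝ → ℝ) : Prop :=
  MemLp u 2 (volume.restrict A) ∧ MemLp v 2 (volume.restrict A) ∧
    ∃ ψ : ℕ → ℝ → ℝ,
      (∀ k, ContDiff ℝ ∞ (ψ k) ∧ HasCompactSupport (ψ k) ∧ tsupport (ψ k) ⊆ A) ∧
      Tendsto (fun k => eLpNorm (fun x => ψ k x - u x) 2 (volume.restrict A)) atTop (𝓝 0) ∧
      Tendsto (fun k => eLpNorm (fun x => deriv (ψ k) x - v x) 2 (volume.restrict A)) atTop (𝓝 0)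

/-- The Rayleigh quotient of `u` (with weak derivative `v`) on `A`. -/
noncomputable def rayleigh (p q w : ℝ → ℝ) (A : Set ℝ) (u v : ℝ → ℝ) : ℝ :=
  ((∫ x in A, p x * v x ^ 2) + ∫ x in A, q x * u x ^ 2) / ∫ x in A, w x * u x ^ 2

/-- First Dirichlet eigenvalue of `u ↦ (-(p u')' + q u) / w` on the open set `A`, as the least
Rayleigh quotient over the nonzero functions of `H¹₀(A)`. It is `∞` for `A = ∅`, where there is
no nonzero competitor. -/
noncomputable def firstEigenvalue (p q w : ℝ → ℝ) (A : Set ℝ) : ℝ≥0∞ :=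
  ⨅ (u : ℝ → ℝ) (v : ℝ → ℝ) (_ : MemH10 A u v) (_ : ¬ u =ᵐ[volume.restrict A] 0),
    ENNReal.ofReal (rayleigh p q w A u v)

/-- Partitions of `(0,1)` into `n` open, possibly empty, intervals `(x_{j-1}, x_j)`, given by
points `0 = x_0 ≤ x_1 ≤ ... ≤ x_n = 1`. There are none for `n = 0`. -/
structure IntervalPartition (n : ℕ) where
  pt : Fin (n + 1) → ℝ
  mono : Monotone pt
  pt_zero : pt 0 = 0
  pt_last : pt (Fin.last n) = 1

namespace IntervalPartition

variable {n : ℕ}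

/-- Left end point of the interval with index `j` (indices start from `0`). -/
def left (P : IntervalPartition n) (j : Fin n) : ℝ := P.pt j.castSucc

/-- Right end point of the interval with index `j`. -/
def right (P : IntervalPartition n) (j : Fin n) : ℝ := P.pt j.succ

/-- The open interval with index `j`. -/
def interval (P : IntervalPartition n) (j : Fin n) : Set ℝ := Ioo (P.left j) (P.right j)

theorem pt_mem (P : IntervalPartition n) (i : Fin (n + 1)) : P.pt i ∈ unitInterval :=
  ⟨P.pt_zero ▸ P.mono (Fin.zero_le i), P.pt_last ▸ P.mono (Fin.le_last i)⟩

open Classical in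
/-- The measure on `[0,1]` which gives mass `1/n` to each interval of the partition, uniformly
spread if the interval is non-empty, and as a Dirac delta at its end point if it is empty. -/
noncomputable def measure (P : IntervalPartition n) : Measure unitInterval :=
  (n : ℝ≥0∞)⁻¹ • ∑ j : Fin n,
    if P.left j < P.right j then
      (volume (P.interval j))⁻¹ •
        (volume : Measure unitInterval).restrict (Subtype.val ⁻¹' P.interval j)
    else Measure.dirac ⟨P.right j, P.pt_mem j.succ⟩

theorem n_ne_zero (P : IntervalPartition n) : n ≠ 0 := by
  rintro rfl
  have h := P.pt_last
  rw [show Fin.last 0 = 0 from rfl, P.pt_zero] at h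
  exact zero_ne_one h

theorem volume_preimage_interval (P : IntervalPartition n) (j : Fin n) :
    (volume : Measure unitInterval) (Subtype.val ⁻¹' P.interval j) = volume (P.interval j) := by
  have hsub : P.interval j ⊆ unitInterval := fun x hx =>
    ⟨(P.pt_mem j.castSucc).1.trans hx.1.le, hx.2.le.trans (P.pt_mem j.succ).2⟩
  rw [Measure.Subtype.volume_def,
    comap_subtype_coe_apply (show MeasurableSet unitInterval from measurableSet_Icc),
    Subtype.image_preimage_coe, inter_eq_right.mpr hsub]

instance (P : IntervalPartition n) : IsProbabilityMeasure P.measure := by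
  classical
  constructor
  have hn : (n : ℝ≥0∞) ≠ 0 := by exact_mod_cast P.n_ne_zero
  have key : ∀ j : Fin n, (if P.left j < P.right j then
      (volume (P.interval j))⁻¹ •
        (volume : Measure unitInterval).restrict (Subtype.val ⁻¹' P.interval j)
      else Measure.dirac ⟨P.right j, P.pt_mem j.succ⟩) univ = 1 := by
    intro j
    split_ifs with h
    · rw [Measure.smul_apply, Measure.restrict_apply_univ, volume_preimage_interval, smul_eq_mul]
      apply ENNReal.inv_mul_cancel
      · simp [interval, Real.volume_Ioo, h]
      · simp [interval, Real.volume_Ioo]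
    · simp
  rw [measure, Measure.smul_apply, Measure.finsetSum_apply, smul_eq_mul,
    Finset.sum_congr rfl (fun j _ => key j)]
  simpa using ENNReal.inv_mul_cancel hn (ENNReal.natCast_ne_top n)

/-- The probability measure on `[0,1]` associated with the partition. -/
noncomputable def probMeasure (P : IntervalPartition n) : ProbabilityMeasure unitInterval :=
  ⟨P.measure, inferInstance⟩

/-- The cost `(1/n) ∑_j φ (n / λ(I_j)^{1/2})`; the argument of `φ` is `0` when `I_j` is empty. -/
noncomputable def cost (p q w : ℝ → ℝ) (φ : ℝ≥0 → ℝ≥0∞) (P : IntervalPartition n) : ℝ≥0∞ :=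
  (n : ℝ≥0∞)⁻¹ * ∑ j : Fin n,
    φ ((n : ℝ≥0∞) / firstEigenvalue p q w (P.interval j) ^ (1 / 2 : ℝ)).toNNReal

open Classical in
/-- The fraction of intervals of the partition lying in `A`. -/
noncomputable def portion (P : IntervalPartition n) (A : Set ℝ) : ℝ :=
  (∑ j : Fin n with P.left j < P.right j,
      volume.real (P.interval j ∩ A) / (n * volume.real (P.interval j))) +
    ((Finset.univ.filter fun j : Fin n => P.right j ∈ A ∧ P.left j = P.right j).card : ℝ) / n

end IntervalPartition

/-- The density `f_∞ = s / ∫_I s` on `I = (0,1)`. -/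
noncomputable def limitDensity (s : ℝ → ℝ) (x : ℝ) : ℝ := s x / ∫ t in Ioo (0 : ℝ) 1, s t

/-! Write `l_j = λ(I_j)^{-1/2}`, `σ_j = ∫_{I_j} s` and `T = (1/π) ∫_I s`. On a short interval the
term with `q` is negligible and `p`, `w` are nearly constant in mean, so `l_j ≈ σ_j / π`. The lower
bound for `λ` comes from a weighted Wirtinger inequality (`wirtinger_inequality`,
`ofReal_inv_le_firstEigenvalue`), the upper bound from a sine as test function
(`exists_firstEigenvalue_le`). The error on one interval is at most a constant times the `L¹`
oscillations of `p` and `w` plus the squared length. Since integrable functions are `L¹`-close to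
continuous ones, these errors are small in total over all short intervals of any partition
(`exists_sum_abs_invSqrtEigenvalue_sub_le`).

The cost is the mean of `φ (n l_j)`, and if all intervals are short the mean of the arguments is `∑
l_j ≈ T`. Convexity then bounds the cost below by about `φ(T)`, and partitions with equal `σ_j`
reach this value (`eventually_iInf_cost_le`). Strict convexity gives more: `φ` exceeds its
supporting line at `T` by at least `c (|t - T| - ε)`, so partitions of nearly minimal cost satisfy
`∑ |l_j - T/n| → 0` over the short intervals (`tendsto_cost_and_sum_abs`).

Long intervals, where `l_j ≈ σ_j / π` fails, are handled by the growth of `φ`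
(`eventually_le_mul_sum_short`). If `φ` is superlinear, a bounded cost forces their total `l_j` to
vanish. If `φ` is sublinear, the supporting line has slope at most `0`, and omitting them can only
raise the lower bound.

Finally the `σ_j` add up to `πT`, which the short intervals already exhaust in the limit. Hence `∑
|σ_j/π - T/n| → 0` over all `j` (`tendsto_sum_abs_weight_sub`): each interval carries about `1/n` of
the mass of `f_∞`, and `s` oscillates little over it. This gives the limit of the portion in any
measurable subset of `I`, and weak convergence follows from the portmanteau theorem. -/

/-! ### Bounded measurable coefficients -/

/-- A measurable coefficient with `1 / β ≤ f ≤ β` almost everywhere. -/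
structure IsCoeff (β : ℝ) (f : ℝ → ℝ) : Prop where
  meas : AEStronglyMeasurable f volume
  bound : ∀ᵐ x, 1 / β ≤ f x ∧ f x ≤ β

namespace IsCoeff

variable {β : ℝ} {f : ℝ → ℝ}

theorem abs_le (hβ : 0 < β) (hf : IsCoeff β f) : ∀ᵐ x, ‖f x‖ ≤ β := by
  have := one_div_pos.mpr hβ
  filter_upwards [hf.bound] with x hx
  rw [Real.norm_eq_abs, abs_of_nonneg (by linarith [hx.1])]
  exact hx.2

theorem inv (hβ : 0 < β) (hf : IsCoeff β f) : IsCoeff β fun x => 1 / f x := by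
  refine ⟨?_, ?_⟩
  · simp_rw [one_div]
    exact hf.meas.aemeasurable.inv.aestronglyMeasurable
  · have := one_div_pos.mpr hβ
    filter_upwards [hf.bound] with x hx
    refine ⟨one_div_le_one_div_of_le (by linarith [hx.1]) hx.2, ?_⟩
    have h := one_div_le_one_div_of_le this hx.1
    rwa [one_div_one_div] at h

theorem intervalIntegrable (hβ : 0 < β) (hf : IsCoeff β f) (a b : ℝ) :
    IntervalIntegrable f volume a b := by
  refine (intervalIntegrable_const (c := β)).mono_fun hf.meas.restrict ?_
  filter_upwards [ae_restrict_of_ae (hf.abs_le hβ)] with x hx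
  exact hx.trans (le_abs_self β)

theorem integrableOn (hβ : 0 < β) (hf : IsCoeff β f) {A : Set ℝ} (hA : volume A ≠ ⊤) :
    IntegrableOn f A :=
  Measure.integrableOn_of_bounded hA hf.meas (ae_restrict_of_ae (hf.abs_le hβ))

theorem le_setIntegral (hβ : 0 < β) (hf : IsCoeff β f) {A : Set ℝ}
    (hA : volume A ≠ ⊤) : volume.real A / β ≤ ∫ x in A, f x := by
  have h : ∫ _ in A, (1 / β : ℝ) ≤ ∫ x in A, f x := by
    refine integral_mono_ae (integrableOn_const hA) (hf.integrableOn hβ hA) ?_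
    filter_upwards [ae_restrict_of_ae hf.bound] with x hx
    exact hx.1
  simpa [div_eq_mul_inv] using h

theorem setIntegral_le (hβ : 0 < β) (hf : IsCoeff β f) {A : Set ℝ}
    (hA : volume A ≠ ⊤) : ∫ x in A, f x ≤ β * volume.real A := by
  have h : ∫ x in A, f x ≤ ∫ _ in A, (β : ℝ) := by
    refine integral_mono_ae (hf.integrableOn hβ hA) (integrableOn_const hA) ?_
    filter_upwards [ae_restrict_of_ae hf.bound] with x hx
    exact hx.2
  simpa [mul_comm] using h

end IsCoeff

theorem setIntegral_Ioo_eq_intervalIntegral (f : ℝ → ℝ) {a b : ℝ} (hab : a ≤ b) :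
    ∫ x in Ioo a b, f x = ∫ x in a..b, f x := by
  rw [intervalIntegral.integral_of_le hab, integral_Ioc_eq_integral_Ioo]

theorem integral_inv_pos {β : ℝ} (hβ : 0 < β) {p : ℝ → ℝ} (hp : IsCoeff β p) {a b : ℝ}
    (hab : a < b) : 0 < ∫ x in Ioo a b, 1 / p x := by
  have h := (hp.inv hβ).le_setIntegral hβ (A := Ioo a b) (by simp)
  have : 0 < volume.real (Ioo a b) / β := by
    rw [Real.volume_real_Ioo_of_le hab.le]
    have := sub_pos.mpr hab
    positivity
  linarith

theorem intervalIntegrable_coeff_mul {β : ℝ} (hβ : 0 < β) {p g : ℝ → ℝ} (hp : IsCoeff β p)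
    (hg : Continuous g) (a b : ℝ) : IntervalIntegrable (fun x => p x * g x) volume a b := by
  simp_rw [mul_comm (p _)]
  refine ⟨(hg.intervalIntegrable a b).1.mul_bdd (c := β) hp.meas.restrict
    (ae_restrict_of_ae (hp.abs_le hβ)), (hg.intervalIntegrable a b).2.mul_bdd (c := β)
    hp.meas.restrict (ae_restrict_of_ae (hp.abs_le hβ))⟩

/-! ### Weighted Wirtinger inequality and pointwise energy bound -/

/-- The inequality behind `wirtinger_inequality`, with a Riccati multiplier which stays away from
the poles of the cotangent. -/
theorem wirtinger_inequality_of_lt {β : ℝ} (hβ : 0 < β) {p : ℝ → ℝ} (hp : IsCoeff β p) {a b : ℝ}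
    (hab : a < b) {ψ : ℝ → ℝ} (hψ : ContDiff ℝ 1 ψ) (ha : ψ a = 0) (hb : ψ b = 0)
    {δ : ℝ} (hδ : 0 < δ) (hδ' : 2 * δ < Real.pi) :
    ((Real.pi - 2 * δ) / ∫ x in Ioo a b, 1 / p x) ^ 2 * ∫ x in Ioo a b, ψ x ^ 2 / p x ≤
      ∫ x in Ioo a b, p x * deriv ψ x ^ 2 := by
  set G := ∫ x in Ioo a b, 1 / p x with hG
  have hGpos : 0 < G := integral_inv_pos hβ hp hab
  -- With this slope `θ` climbs from `δ` at `a` to `π - δ` at `b`, so `sin θ` stays away from zero.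
  set κ := (Real.pi - 2 * δ) / G with hκ
  have hκpos : 0 < κ := div_pos (by linarith) hGpos
  have hpi := hp.inv hβ
  set θ : ℝ → ℝ := fun x => δ + κ * ∫ t in a..x, 1 / p t with hθ
  have hint : ∀ x y, IntervalIntegrable (fun t => 1 / p t) volume x y :=
    fun x y => hpi.intervalIntegrable hβ x y
  have hθmem : ∀ x ∈ Icc a b, θ x ∈ Icc δ (Real.pi - δ) := by
    intro x hx
    have h1 : 0 ≤ ∫ t in a..x, 1 / p t := by
      refine intervalIntegral.integral_nonneg_of_ae hx.1 ?_
      filter_upwards [hpi.bound] with t ht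
      exact (one_div_pos.mpr hβ).le.trans ht.1
    have h2 : 0 ≤ ∫ t in x..b, 1 / p t := by
      refine intervalIntegral.integral_nonneg_of_ae hx.2 ?_
      filter_upwards [hpi.bound] with t ht
      exact (one_div_pos.mpr hβ).le.trans ht.1
    have h3 := intervalIntegral.integral_add_adjacent_intervals (hint a x) (hint x b)
    rw [← setIntegral_Ioo_eq_intervalIntegral _ hab.le, ← hG] at h3
    have h4 : κ * G = Real.pi - 2 * δ := by rw [hκ]; field_simp
    have h5 : κ * (∫ t in a..x, 1 / p t) ≤ κ * G := by gcongr; linarith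
    have h6 : 0 ≤ κ * ∫ t in a..x, 1 / p t := by positivity
    constructor <;> simp only [hθ] <;> linarith
  have hθlip : LipschitzOnWith (κ * β).toNNReal θ (Icc a b) := by
    refine LipschitzOnWith.of_dist_le_mul fun x hx y hy => ?_
    have h1 : θ x - θ y = κ * ∫ t in y..x, 1 / p t := by
      simp only [hθ]
      rw [← intervalIntegral.integral_interval_sub_left (hint a x) (hint a y)]
      ring
    rw [Real.dist_eq, Real.dist_eq, h1, abs_mul, abs_of_pos hκpos,
      Real.coe_toNNReal _ (by positivity), mul_assoc]
    gcongr
    rw [← Real.norm_eq_abs]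
    refine intervalIntegral.norm_integral_le_of_norm_le_const_ae (f := fun t => 1 / p t) ?_
    filter_upwards [hpi.abs_le hβ] with t ht _
    exact ht
  have hsin : ∀ y ∈ Icc δ (Real.pi - δ), 0 < Real.sin y := fun y hy =>
    Real.sin_pos_of_pos_of_lt_pi (by linarith [hy.1]) (by linarith [hy.2])
  have hcot : ContDiffOn ℝ 1 (fun y => κ * (Real.cos y / Real.sin y)) (Icc δ (Real.pi - δ)) :=
    contDiffOn_const.mul (Real.contDiff_cos.contDiffOn.div Real.contDiff_sin.contDiffOn
      fun y hy => (hsin y hy).ne')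
  obtain ⟨K, hK⟩ := hcot.exists_lipschitzOnWith (by decide) (convex_Icc _ _) isCompact_Icc
  -- `H = κ cot θ` solves the Riccati equation `H' = -(κ² + H²) / p` almost everywhere. As `1 / p`
  -- is only bounded and measurable, `θ` and `H` are merely Lipschitz, and the fundamental theorem
  -- of calculus is used for absolutely continuous functions.
  set H : ℝ → ℝ := fun x => κ * (Real.cos (θ x) / Real.sin (θ x)) with hH
  have hHac : AbsolutelyContinuousOnInterval H a b := by
    have := hK.comp hθlip hθmem
    rw [← uIcc_of_le hab.le] at this
    exact this.absolutelyContinuousOnInterval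
  have hψac : AbsolutelyContinuousOnInterval (fun x => ψ x ^ 2) a b :=
    (hψ.pow 2).contDiffOn.absolutelyContinuousOnInterval
  have hac := hHac.fun_mul hψac
  have hftc := hac.integral_deriv_eq_sub
  simp only [ha, hb] at hftc
  have hcont : Continuous (deriv ψ) := hψ.continuous_deriv le_rfl
  have hi1 : IntervalIntegrable (fun x => p x * deriv ψ x ^ 2) volume a b :=
    intervalIntegrable_coeff_mul hβ hp (hcont.pow 2) a b
  have hi2 : IntervalIntegrable (fun x => κ ^ 2 * (ψ x ^ 2 / p x)) volume a b := by
    refine IntervalIntegrable.const_mul ?_ _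
    have := intervalIntegrable_coeff_mul hβ hpi (hψ.continuous.pow 2) a b
    simpa [div_eq_inv_mul] using this
  rw [setIntegral_Ioo_eq_intervalIntegral _ hab.le, setIntegral_Ioo_eq_intervalIntegral _ hab.le,
    ← intervalIntegral.integral_const_mul, ← sub_nonneg, ← intervalIntegral.integral_sub hi1 hi2]
  have hz : ∫ x in a..b, deriv (fun x => H x * ψ x ^ 2) x = 0 := by rw [hftc]; ring
  rw [← hz]
  refine intervalIntegral.integral_mono_ae_restrict hab.le hac.intervalIntegrable_deriv
    (hi1.sub hi2) ?_
  have hder := (hint a b).ae_hasDerivAt_integral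
  rw [EventuallyLE, ae_restrict_iff' measurableSet_Icc]
  filter_upwards [hder, hp.bound] with x hx hpx hxI
  have hpx0 : 0 < p x := lt_of_lt_of_le (one_div_pos.mpr hβ) hpx.1
  have hxθ : HasDerivAt θ (κ * (1 / p x)) x :=
    ((hx (by rwa [uIcc_of_le hab.le]) a (by simp)).const_mul κ).const_add δ
  have hs := hsin _ (hθmem x hxI)
  have hHd : HasDerivAt H (κ * ((-Real.sin (θ x) * (κ * (1 / p x)) * Real.sin (θ x) -
      Real.cos (θ x) * (Real.cos (θ x) * (κ * (1 / p x)))) / Real.sin (θ x) ^ 2)) x :=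
    (hxθ.cos.div hxθ.sin hs.ne').const_mul κ
  have hψd : HasDerivAt (fun x => ψ x ^ 2) (2 * ψ x * deriv ψ x) x := by
    convert! ((hψ.differentiable one_ne_zero) x).hasDerivAt.fun_pow 2 using 1
    ring
  have hd := (hHd.mul hψd).deriv
  have hd' : deriv (fun x => H x * ψ x ^ 2) x = _ := hd
  rw [hd']
  -- Completing the square: the difference of the two energies and the exact derivative `(H ψ²)'` is
  -- a square over `p`. The exact derivative has integral zero because `ψ` vanishes at both ends.
  have hkey : p x * deriv ψ x ^ 2 - κ ^ 2 * (ψ x ^ 2 / p x) -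
      (κ * ((-Real.sin (θ x) * (κ * (1 / p x)) * Real.sin (θ x) -
      Real.cos (θ x) * (Real.cos (θ x) * (κ * (1 / p x)))) / Real.sin (θ x) ^ 2) * ψ x ^ 2 +
      H x * (2 * ψ x * deriv ψ x)) = (p x * deriv ψ x - H x * ψ x) ^ 2 / p x := by
    simp only [hH]
    field_simp
    ring
  have : 0 ≤ (p x * deriv ψ x - H x * ψ x) ^ 2 / p x := by positivity
  linarith

/-- The weighted one-dimensional Wirtinger inequality. -/
theorem wirtinger_inequality {β : ℝ} (hβ : 0 < β) {p : ℝ → ℝ} (hp : IsCoeff β p) {a b : ℝ}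
    (hab : a < b) {ψ : ℝ → ℝ} (hψ : ContDiff ℝ 1 ψ) (ha : ψ a = 0) (hb : ψ b = 0) :
    (Real.pi / ∫ x in Ioo a b, 1 / p x) ^ 2 * ∫ x in Ioo a b, ψ x ^ 2 / p x ≤
      ∫ x in Ioo a b, p x * deriv ψ x ^ 2 := by
  have ht : Tendsto (fun δ : ℝ => ((Real.pi - 2 * δ) / ∫ x in Ioo a b, 1 / p x) ^ 2 *
      ∫ x in Ioo a b, ψ x ^ 2 / p x) (𝓝[>] 0)
      (𝓝 (((Real.pi - 2 * 0) / ∫ x in Ioo a b, 1 / p x) ^ 2 *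
        ∫ x in Ioo a b, ψ x ^ 2 / p x)) :=
    (Continuous.tendsto (by fun_prop) 0).mono_left nhdsWithin_le_nhds
  rw [mul_zero, sub_zero] at ht
  refine le_of_tendsto ht ?_
  filter_upwards [Ioo_mem_nhdsGT (show (0 : ℝ) < Real.pi / 2 by positivity)] with δ hδ
  exact wirtinger_inequality_of_lt hβ hp hab hψ ha hb hδ.1 (by linarith [hδ.2])

/-- Pointwise bound of a function vanishing at an end point by its weighted energy. -/
theorem sq_le_energy {β : ℝ} (hβ : 0 < β) {p : ℝ → ℝ} (hp : IsCoeff β p) {a b : ℝ}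
    (hab : a < b) {ψ : ℝ → ℝ} (hψ : ContDiff ℝ 1 ψ) (ha : ψ a = 0) {y : ℝ} (hy : y ∈ Ioo a b) :
    ψ y ^ 2 ≤ (∫ x in Ioo a b, 1 / p x) * ∫ x in Ioo a b, p x * deriv ψ x ^ 2 := by
  set G := ∫ x in Ioo a b, 1 / p x with hG
  have hGpos : 0 < G := integral_inv_pos hβ hp hab
  have hcont : Continuous (deriv ψ) := hψ.continuous_deriv le_rfl
  have hpi := hp.inv hβ
  -- The optimal parameter in `2 t ψ' ≤ p ψ'² + t² / p`; integrating this pointwise inequality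
  -- replaces Cauchy–Schwarz.
  set t := ψ y / G with ht
  have hi1 : ∀ c d, IntervalIntegrable (fun x => p x * deriv ψ x ^ 2) volume c d :=
    fun c d => intervalIntegrable_coeff_mul hβ hp (hcont.pow 2) c d
  have hi2 : ∀ c d, IntervalIntegrable (fun x => t ^ 2 * (1 / p x)) volume c d :=
    fun c d => (hpi.intervalIntegrable hβ c d).const_mul _
  have hi3 : ∀ c d, IntervalIntegrable (fun x => 2 * t * deriv ψ x) volume c d :=
    fun c d => (hcont.intervalIntegrable c d).const_mul _
  have h1 : ∫ x in a..y, 2 * t * deriv ψ x ≤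
      ∫ x in a..y, (p x * deriv ψ x ^ 2 + t ^ 2 * (1 / p x)) := by
    refine intervalIntegral.integral_mono_ae hy.1.le (hi3 a y) ((hi1 a y).add (hi2 a y)) ?_
    filter_upwards [hp.bound] with x hx
    have hpx0 : 0 < p x := lt_of_lt_of_le (one_div_pos.mpr hβ) hx.1
    have : p x * deriv ψ x ^ 2 + t ^ 2 * (1 / p x) - 2 * t * deriv ψ x =
        (p x * deriv ψ x - t) ^ 2 / p x := by field_simp; ring
    have h : 0 ≤ (p x * deriv ψ x - t) ^ 2 / p x := by positivity
    linarith
  have h2 : ∫ x in a..y, deriv ψ x = ψ y := by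
    rw [intervalIntegral.integral_deriv_eq_sub
      (fun x _ => (hψ.differentiable one_ne_zero) x) (hcont.intervalIntegrable _ _), ha, sub_zero]
  have h3 : 0 ≤ ∫ x in y..b, (p x * deriv ψ x ^ 2 + t ^ 2 * (1 / p x)) := by
    refine intervalIntegral.integral_nonneg_of_ae hy.2.le ?_
    filter_upwards [hp.bound] with x hx
    have hpx0 : 0 < p x := lt_of_lt_of_le (one_div_pos.mpr hβ) hx.1
    show 0 ≤ _
    positivity
  have h4 := intervalIntegral.integral_add_adjacent_intervals
    ((hi1 a y).add (hi2 a y)) ((hi1 y b).add (hi2 y b))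
  rw [intervalIntegral.integral_add (hi1 a b) (hi2 a b), intervalIntegral.integral_const_mul,
    ← setIntegral_Ioo_eq_intervalIntegral _ hab.le,
    ← setIntegral_Ioo_eq_intervalIntegral _ hab.le, ← hG] at h4
  rw [intervalIntegral.integral_const_mul, h2] at h1
  have h5 : t * G = ψ y := by rw [ht]; field_simp
  have h6 : 2 * t * ψ y ≤ (∫ x in Ioo a b, p x * deriv ψ x ^ 2) + t ^ 2 * G := by linarith
  calc ψ y ^ 2 = G * (2 * t * ψ y - t ^ 2 * G) := by rw [← h5]; ring
    _ ≤ _ := by gcongr; linarith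

/-! ### Lower bound for the first eigenvalue -/

/-- The integral is the `L²` inner product of `g k` with `f * g k`, and both factors converge in
`L²` because `f` is bounded. It carries the energy inequality from test functions to their closure
`H¹₀`. -/
theorem tendsto_setIntegral_mul_sq {μ : Measure ℝ} {f u : ℝ → ℝ} {g : ℕ → ℝ → ℝ} {C : ℝ}
    (hf : AEStronglyMeasurable f μ) (hC : ∀ᵐ x ∂μ, ‖f x‖ ≤ C) (hg : ∀ k, MemLp (g k) 2 μ)
    (hu : MemLp u 2 μ) (h : Tendsto (fun k => eLpNorm (fun x => g k x - u x) 2 μ) atTop (𝓝 0)) :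
    Tendsto (fun k => ∫ x, f x * g k x ^ 2 ∂μ) atTop (𝓝 (∫ x, f x * u x ^ 2 ∂μ)) := by
  have hmul : ∀ v : ℝ → ℝ, MemLp v 2 μ → MemLp (fun x => f x * v x) 2 μ := by
    intro v hv
    refine MemLp.of_le_mul (c := C) hv (hf.mul hv.1) ?_
    filter_upwards [hC] with x hx
    rw [norm_mul]
    gcongr
  have h1 : Tendsto (fun k => (hg k).toLp (g k)) atTop (𝓝 (hu.toLp u)) :=
    (Lp.tendsto_Lp_iff_tendsto_eLpNorm'' g hg u hu).mpr h
  have h2 : Tendsto (fun k => (hmul _ (hg k)).toLp _) atTop (𝓝 ((hmul _ hu).toLp _)) := by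
    refine (Lp.tendsto_Lp_iff_tendsto_eLpNorm'' _ (fun k => hmul _ (hg k)) _ (hmul _ hu)).mpr ?_
    have hle : ∀ k, eLpNorm ((fun x => f x * g k x) - fun x => f x * u x) 2 μ ≤
        ENNReal.ofReal C * eLpNorm (fun x => g k x - u x) 2 μ := by
      intro k
      refine eLpNorm_le_mul_eLpNorm_of_ae_le_mul ?_ 2
      filter_upwards [hC] with x hx
      rw [Pi.sub_apply, ← mul_sub, norm_mul]
      gcongr
    refine tendsto_of_tendsto_of_tendsto_of_le_of_le tendsto_const_nhds ?_
      (fun _ => zero_le) hle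
    simpa using ENNReal.Tendsto.const_mul h (Or.inr ENNReal.ofReal_ne_top)
  have h3 := h1.inner (𝕜 := ℝ) h2
  have heq : ∀ (v : ℝ → ℝ) (hv : MemLp v 2 μ) (hv' : MemLp (fun x => f x * v x) 2 μ),
      inner ℝ (hv.toLp v) (hv'.toLp _) = ∫ x, f x * v x ^ 2 ∂μ := by
    intro v hv hv'
    rw [L2.inner_def]
    refine integral_congr_ae ?_
    filter_upwards [hv.coeFn_toLp, hv'.coeFn_toLp] with x h1 h2
    rw [h1, h2]
    simp only [RCLike.inner_apply, conj_trivial]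
    ring
  simp_rw [heq] at h3
  exact h3

/-- The energy inequality for test functions, relative to a constant `c` close to `w * p`. -/
theorem integral_mul_sq_le_of_contDiff {β : ℝ} (hβ : 0 < β) {p w : ℝ → ℝ} (hp : IsCoeff β p)
    (hw : IsCoeff β w) {a b : ℝ} (hab : a < b) {c : ℝ} (hc : 0 ≤ c) {ψ : ℝ → ℝ}
    (hψ : ContDiff ℝ 1 ψ) (ha : ψ a = 0) (hb : ψ b = 0) :
    ∫ x in Ioo a b, w x * ψ x ^ 2 ≤
      (c * (∫ x in Ioo a b, 1 / p x) ^ 2 / Real.pi ^ 2 +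
        (∫ x in Ioo a b, 1 / p x) * ∫ x in Ioo a b, |w x - c / p x|) *
      ∫ x in Ioo a b, p x * deriv ψ x ^ 2 := by
  have hwir := wirtinger_inequality hβ hp hab hψ ha hb
  have hsq := fun y hy => sq_le_energy hβ hp hab hψ ha (y := y) hy
  have hGpos := integral_inv_pos hβ hp hab
  have hpi := hp.inv hβ
  set G := ∫ x in Ioo a b, 1 / p x with hG
  set E := ∫ x in Ioo a b, p x * deriv ψ x ^ 2 with hE
  have hv : volume (Ioo a b) ≠ ⊤ := by simp
  have hi1 : IntegrableOn (fun x => ψ x ^ 2 / p x) (Ioo a b) := by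
    have := (intervalIntegrable_coeff_mul hβ hpi (hψ.continuous.pow 2) a b).1.mono_set
      (Ioo_subset_Ioc_self (a := b) (b := a))
    simpa [div_eq_inv_mul] using this
  have hi2 : IntegrableOn (fun x => |w x - c / p x|) (Ioo a b) := by
    have h := (hpi.integrableOn hβ hv).const_mul c
    simp only [mul_one_div] at h
    exact ((hw.integrableOn hβ hv).sub h).abs
  -- Write `w = c / p + (w - c / p)`: Wirtinger controls the first part, the sup bound `ψ² ≤ G E`
  -- the second.
  have h1 : ∫ x in Ioo a b, w x * ψ x ^ 2 ≤
      ∫ x in Ioo a b, (c * (ψ x ^ 2 / p x) + G * E * |w x - c / p x|) := by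
    refine integral_mono_ae ((intervalIntegrable_coeff_mul hβ hw (hψ.continuous.pow 2) a b).1.mono_set
      (Ioo_subset_Ioc_self (a := b) (b := a))) ((hi1.const_mul c).add (hi2.const_mul _)) ?_
    filter_upwards [ae_restrict_mem measurableSet_Ioo] with x hx
    have h2 : (w x - c / p x) * ψ x ^ 2 ≤ |w x - c / p x| * (G * E) :=
      (mul_le_mul_of_nonneg_right (le_abs_self _) (sq_nonneg _)).trans
        (mul_le_mul_of_nonneg_left (hsq x hx) (abs_nonneg _))
    have h3 : w x * ψ x ^ 2 = c * (ψ x ^ 2 / p x) + (w x - c / p x) * ψ x ^ 2 := by ring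
    linarith
  rw [integral_add (hi1.const_mul c) (hi2.const_mul _), integral_const_mul, integral_const_mul] at h1
  have h4 : ∫ x in Ioo a b, ψ x ^ 2 / p x ≤ G ^ 2 / Real.pi ^ 2 * E := by
    calc ∫ x in Ioo a b, ψ x ^ 2 / p x
        = G ^ 2 / Real.pi ^ 2 * ((Real.pi / G) ^ 2 * ∫ x in Ioo a b, ψ x ^ 2 / p x) := by
          field_simp
      _ ≤ _ := by gcongr
  calc _ ≤ _ := h1
    _ ≤ c * (G ^ 2 / Real.pi ^ 2 * E) + G * E * ∫ x in Ioo a b, |w x - c / p x| := by gcongr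
    _ = _ := by ring

theorem MemH10.integral_mul_sq_le {β : ℝ} (hβ : 0 < β) {p w : ℝ → ℝ} (hp : IsCoeff β p)
    (hw : IsCoeff β w) {a b : ℝ} (hab : a < b) {c : ℝ} (hc : 0 ≤ c) {u v : ℝ → ℝ}
    (h : MemH10 (Ioo a b) u v) :
    ∫ x in Ioo a b, w x * u x ^ 2 ≤
      (c * (∫ x in Ioo a b, 1 / p x) ^ 2 / Real.pi ^ 2 +
        (∫ x in Ioo a b, 1 / p x) * ∫ x in Ioo a b, |w x - c / p x|) *
      ∫ x in Ioo a b, p x * v x ^ 2 := by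
  obtain ⟨hu, hv, ψ, hψ, h1, h2⟩ := h
  have hψ1 : ∀ k, ContDiff ℝ 1 (ψ k) := fun k => (hψ k).1.of_le (by norm_cast)
  have hz : ∀ k x, x ∉ Ioo a b → ψ k x = 0 := fun k x hx =>
    image_eq_zero_of_notMem_tsupport fun h => hx ((hψ k).2.2 h)
  have t1 := tendsto_setIntegral_mul_sq hw.meas.restrict (ae_restrict_of_ae (hw.abs_le hβ))
    (fun k => ((hψ1 k).continuous.memLp_of_hasCompactSupport (p := 2) (hψ k).2.1).restrict _) hu h1
  have t2 := tendsto_setIntegral_mul_sq hp.meas.restrict (ae_restrict_of_ae (hp.abs_le hβ))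
    (fun k => (((hψ1 k).continuous_deriv le_rfl).memLp_of_hasCompactSupport (p := 2)
      (hψ k).2.1.deriv).restrict _) hv h2
  exact le_of_tendsto_of_tendsto' t1 (t2.const_mul _) fun k =>
    integral_mul_sq_le_of_contDiff hβ hp hw hab hc (hψ1 k) (hz k a (by simp)) (hz k b (by simp))

theorem integral_coeff_mul_sq_pos {β : ℝ} (hβ : 0 < β) {w u : ℝ → ℝ} (hw : IsCoeff β w)
    {A : Set ℝ} (hu : MemLp u 2 (volume.restrict A)) (hu0 : ¬ u =ᵐ[volume.restrict A] 0) :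
    0 < ∫ x in A, w x * u x ^ 2 := by
  have hpos : ∀ᵐ x ∂volume.restrict A, 0 < w x := by
    filter_upwards [ae_restrict_of_ae hw.bound] with x hx
    exact lt_of_lt_of_le (one_div_pos.mpr hβ) hx.1
  have hnn : 0 ≤ᵐ[volume.restrict A] fun x => w x * u x ^ 2 := by
    filter_upwards [hpos] with x hx
    show 0 ≤ _
    positivity
  refine lt_of_le_of_ne (integral_nonneg_of_ae hnn) fun h => hu0 ?_
  have hint : Integrable (fun x => w x * u x ^ 2) (volume.restrict A) :=
    hu.integrable_sq.bdd_mul (c := β) hw.meas.restrict (ae_restrict_of_ae (hw.abs_le hβ))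
  have h0 := (integral_eq_zero_iff_of_nonneg_ae hnn hint).mp h.symm
  filter_upwards [h0, hpos] with x hx hwx
  simpa [hwx.ne'] using hx

/-- Since `q ≥ 0`, its term may be dropped from the Rayleigh quotient; the energy inequality on
`H¹₀` bounds what remains. The free constant `c` is later taken as a typical value of `w * p`. -/
theorem ofReal_inv_le_firstEigenvalue {β : ℝ} (hβ : 0 < β) {p q w : ℝ → ℝ} (hp : IsCoeff β p)
    (hq : ∀ᵐ x, 0 ≤ q x) (hw : IsCoeff β w) {a b : ℝ} (hab : a < b) {c : ℝ} (hc : 0 < c) :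
    ENNReal.ofReal (c * (∫ x in Ioo a b, 1 / p x) ^ 2 / Real.pi ^ 2 +
        (∫ x in Ioo a b, 1 / p x) * ∫ x in Ioo a b, |w x - c / p x|)⁻¹ ≤
      firstEigenvalue p q w (Ioo a b) := by
  refine le_iInf fun u => le_iInf fun v => le_iInf fun h => le_iInf fun hu0 => ?_
  refine ENNReal.ofReal_le_ofReal ?_
  have hG := integral_inv_pos hβ hp hab
  set K := c * (∫ x in Ioo a b, 1 / p x) ^ 2 / Real.pi ^ 2 +
        (∫ x in Ioo a b, 1 / p x) * ∫ x in Ioo a b, |w x - c / p x| with hK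
  have hKpos : 0 < K := by
    have : 0 ≤ ∫ x in Ioo a b, |w x - c / p x| := integral_nonneg fun _ => abs_nonneg _
    have : 0 < c * (∫ x in Ioo a b, 1 / p x) ^ 2 / Real.pi ^ 2 := by positivity
    positivity
  have hD := integral_coeff_mul_sq_pos hβ hw h.1 hu0
  have hle := h.integral_mul_sq_le hβ hp hw hab hc.le
  have hq0 : 0 ≤ ∫ x in Ioo a b, q x * u x ^ 2 := by
    refine integral_nonneg_of_ae ?_
    filter_upwards [ae_restrict_of_ae hq] with x hx
    show 0 ≤ _
    positivity
  rw [rayleigh, le_div_iff₀ hD, inv_mul_le_iff₀ hKpos]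
  calc _ ≤ _ := hle
    _ ≤ _ := by gcongr; linarith

/-! ### Upper bound for the first eigenvalue by a sine test function -/

/-- Vitali's theorem: a uniform bound on a finite measure space makes the sequence uniformly
integrable. The truncation level `M + 1` exceeds all values, so almost nothing lies above it. -/
theorem tendsto_eLpNorm_sub_of_bounded {μ : Measure ℝ} [IsFiniteMeasure μ] {f : ℕ → ℝ → ℝ}
    {g : ℝ → ℝ} {M : ℝ} (hf : ∀ k, AEStronglyMeasurable (f k) μ) (hg : MemLp g 2 μ)
    (hM : ∀ k, ∀ᵐ x ∂μ, ‖f k x‖ ≤ M) (h : ∀ᵐ x ∂μ, Tendsto (fun k => f k x) atTop (𝓝 (g x))) :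
    Tendsto (fun k => eLpNorm (fun x => f k x - g x) 2 μ) atTop (𝓝 0) := by
  refine tendsto_Lp_finite_of_tendsto_ae (by norm_num) (by norm_num) hf hg ?_ h
  refine unifIntegrable_of (by norm_num) (by norm_num) hf fun ε _ => ⟨(M + 1).toNNReal, fun k => ?_⟩
  have h0 : {x | (M + 1).toNNReal ≤ ‖f k x‖₊}.indicator (f k) =ᵐ[μ] 0 := by
    filter_upwards [hM k] with x hx
    refine indicator_of_notMem ?_ _
    simp only [mem_ofPred_eq, not_le]
    rw [← NNReal.coe_lt_coe, coe_nnnorm]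
    exact lt_of_lt_of_le (by linarith) (Real.le_coe_toNNReal _)
  rw [eLpNorm_congr_ae h0]
  simp

theorem exists_deriv_smoothTransition_le :
    ∃ M : ℝ, ∀ x, |deriv Real.smoothTransition x| ≤ M := by
  have hc : Continuous (deriv Real.smoothTransition) :=
    (Real.smoothTransition.contDiff (n := 1)).continuous_deriv le_rfl
  obtain ⟨M, hM⟩ := isCompact_Icc.exists_bound_of_continuousOn (s := Icc (0 : ℝ) 1) hc.continuousOn
  refine ⟨M, fun x => ?_⟩
  have hM0 : 0 ≤ M := (norm_nonneg _).trans (hM 0 (by simp))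
  by_cases hx : x ∈ Icc (0 : ℝ) 1
  · exact hM x hx
  · rw [mem_Icc, not_and_or, not_le, not_le] at hx
    have : deriv Real.smoothTransition x = 0 := by
      rcases hx with hx | hx
      · have : Real.smoothTransition =ᶠ[𝓝 x] fun _ => 0 := by
          filter_upwards [Iio_mem_nhds hx] with y hy
          exact Real.smoothTransition.zero_of_nonpos (le_of_lt hy)
        rw [this.deriv_eq, deriv_const]
      · have : Real.smoothTransition =ᶠ[𝓝 x] fun _ => 1 := by
          filter_upwards [Ioi_mem_nhds hx] with y hy
          exact Real.smoothTransition.one_of_one_le (le_of_lt hy)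
        rw [this.deriv_eq, deriv_const]
    rwa [this, abs_zero]

theorem deriv_smoothTransition_of_one_lt {x : ℝ} (hx : 1 < x) :
    deriv Real.smoothTransition x = 0 := by
  have : Real.smoothTransition =ᶠ[𝓝 x] fun _ => 1 := by
    filter_upwards [Ioi_mem_nhds hx] with y hy
    exact Real.smoothTransition.one_of_one_le (le_of_lt hy)
  rw [this.deriv_eq, deriv_const]

/-- Smooth functions with a linear bound near the end points belong to `H¹₀(a, b)`. -/
theorem memH10_Ioo_of_contDiff {a b : ℝ} {u : ℝ → ℝ} (hu : ContDiff ℝ ∞ u) {K : ℝ}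
    (hua : ∀ x ∈ Ioo a b, |u x| ≤ K * (x - a)) (hub : ∀ x ∈ Ioo a b, |u x| ≤ K * (b - x)) :
    MemH10 (Ioo a b) u (deriv u) := by
  obtain ⟨M, hM⟩ := exists_deriv_smoothTransition_le
  have hM0 : 0 ≤ M := (abs_nonneg _).trans (hM 0)
  have hu1 : ContDiff ℝ 1 u := hu.of_le (by norm_cast)
  have hcu := hu1.continuous
  have hcd : Continuous (deriv u) := hu1.continuous_deriv le_rfl
  obtain ⟨B, hB⟩ := isCompact_Icc.exists_bound_of_continuousOn (s := Icc a b) hcu.continuousOn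
  obtain ⟨B', hB'⟩ := isCompact_Icc.exists_bound_of_continuousOn (s := Icc a b) hcd.continuousOn
  set S := Real.smoothTransition with hS
  have hS0 : ∀ x, 0 ≤ S x := Real.smoothTransition.nonneg
  have hS1 : ∀ x, S x ≤ 1 := Real.smoothTransition.le_one
  -- The cutoff `S (l k x)` vanishes for `x - a ≤ 1 / (k + 1)` and equals `1` once `x - a ≥ 2 / (k +
  -- 1)`; `r` does the same at `b`.
  set l : ℕ → ℝ → ℝ := fun k x => ((k : ℝ) + 1) * (x - a) - 1 with hl
  set r : ℕ → ℝ → ℝ := fun k x => ((k : ℝ) + 1) * (b - x) - 1 with hr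
  set ψ : ℕ → ℝ → ℝ := fun k x => u x * (S (l k x) * S (r k x)) with hψ
  have hSc : ContDiff ℝ ∞ S := Real.smoothTransition.contDiff
  have hψc : ∀ k, ContDiff ℝ ∞ (ψ k) := by
    intro k
    have h1 : ContDiff ℝ ∞ (l k) := by fun_prop
    have h2 : ContDiff ℝ ∞ (r k) := by fun_prop
    exact hu.mul ((hSc.comp h1).mul (hSc.comp h2))
  have hsupp : ∀ k, tsupport (ψ k) ⊆ Icc (a + 1 / ((k : ℝ) + 1)) (b - 1 / ((k : ℝ) + 1)) := by
    intro k
    refine closure_minimal (fun x hx => ?_) isClosed_Icc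
    have hk : (0 : ℝ) < k + 1 := by positivity
    have hx' := hx
    simp only [hψ, Function.mem_support, mul_ne_zero_iff] at hx'
    have h1 : 0 < l k x := by
      by_contra h; exact hx'.2.1 (Real.smoothTransition.zero_of_nonpos (not_lt.mp h))
    have h2 : 0 < r k x := by
      by_contra h; exact hx'.2.2 (Real.smoothTransition.zero_of_nonpos (not_lt.mp h))
    simp only [hl, hr] at h1 h2
    have e1 : 1 / ((k : ℝ) + 1) ≤ x - a := by rw [div_le_iff₀ hk]; linarith
    have e2 : 1 / ((k : ℝ) + 1) ≤ b - x := by rw [div_le_iff₀ hk]; linarith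
    constructor <;> linarith
  have hder : ∀ k x, HasDerivAt (ψ k) (deriv u x * (S (l k x) * S (r k x)) +
      u x * (deriv S (l k x) * ((k : ℝ) + 1) * S (r k x) +
        S (l k x) * (deriv S (r k x) * -((k : ℝ) + 1)))) x := by
    intro k x
    have h1 : HasDerivAt (l k) ((k : ℝ) + 1) x := by
      convert! (((hasDerivAt_id x).sub_const a).const_mul ((k : ℝ) + 1)).sub_const 1 using 1
      ring
    have h2 : HasDerivAt (r k) (-((k : ℝ) + 1)) x := by
      convert! (((hasDerivAt_id x).const_sub b).const_mul ((k : ℝ) + 1)).sub_const 1 using 1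
      ring
    have hSd : ∀ y, HasDerivAt S (deriv S y) y := fun y =>
      ((Real.smoothTransition.contDiff (n := 1)).differentiable one_ne_zero y).hasDerivAt
    have h3 := (hSd (l k x)).comp x h1
    have h4 := (hSd (r k x)).comp x h2
    exact ((hu1.differentiable one_ne_zero x).hasDerivAt).mul (h3.mul h4)
  -- The derivative of the cutoff has size `k + 1`, but only at distance `d ≤ 2 / (k + 1)` from the
  -- end point. There the linear bound on `u` compensates it, uniformly in `k`.
  have hcut : ∀ (t d : ℝ) (k : ℕ), 0 ≤ d → |t| ≤ K * d →
      |t * (deriv S (((k : ℝ) + 1) * d - 1) * ((k : ℝ) + 1))| ≤ 2 * |K| * M := by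
    intro t d k hd ht
    have hk : (0 : ℝ) < k + 1 := by positivity
    by_cases h : 1 < ((k : ℝ) + 1) * d - 1
    · rw [hS, deriv_smoothTransition_of_one_lt h]
      simp only [zero_mul, mul_zero, abs_zero]
      positivity
    · rw [abs_mul, abs_mul, abs_of_pos hk]
      have h1 : |t| ≤ |K| * d := ht.trans (by gcongr; exact le_abs_self K)
      calc |t| * (|deriv S (((k : ℝ) + 1) * d - 1)| * ((k : ℝ) + 1))
          ≤ (|K| * d) * (M * ((k : ℝ) + 1)) := by gcongr; exact hM _
        _ = |K| * M * (((k : ℝ) + 1) * d) := by ring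
        _ ≤ |K| * M * 2 := by gcongr; linarith
        _ = _ := by ring
  have hlim : ∀ x ∈ Ioo a b, ∀ᶠ k in atTop, ∀ᶠ y in 𝓝 x, ψ k y = u y := by
    intro x hx
    have h1 : Tendsto (fun k : ℕ => l k x) atTop atTop := by
      refine tendsto_atTop_add_const_right _ _ (Tendsto.atTop_mul_const (by linarith [hx.1]) ?_)
      exact tendsto_atTop_add_const_right _ _ tendsto_natCast_atTop_atTop
    have h2 : Tendsto (fun k : ℕ => r k x) atTop atTop := by
      refine tendsto_atTop_add_const_right _ _ (Tendsto.atTop_mul_const (by linarith [hx.2]) ?_)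
      exact tendsto_atTop_add_const_right _ _ tendsto_natCast_atTop_atTop
    filter_upwards [h1.eventually_gt_atTop 1, h2.eventually_gt_atTop 1] with k hk1 hk2
    have c1 : Continuous (l k) := by fun_prop
    have c2 : Continuous (r k) := by fun_prop
    filter_upwards [c1.continuousAt.eventually_const_lt hk1, c2.continuousAt.eventually_const_lt hk2]
      with y hy1 hy2
    simp only [hψ, hS, Real.smoothTransition.one_of_one_le hy1.le,
      Real.smoothTransition.one_of_one_le hy2.le, mul_one]
  have memLp : ∀ g : ℝ → ℝ, Continuous g → MemLp g 2 (volume.restrict (Ioo a b)) := by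
    intro g hg
    obtain ⟨C, hC⟩ := isCompact_Icc.exists_bound_of_continuousOn (s := Icc a b) hg.continuousOn
    refine MemLp.of_bound hg.aestronglyMeasurable C ?_
    filter_upwards [ae_restrict_mem measurableSet_Ioo] with x hx
    exact hC x (Ioo_subset_Icc_self hx)
  refine ⟨memLp u hcu, memLp _ hcd, ψ, fun k => ⟨hψc k, ?_, ?_⟩, ?_, ?_⟩
  · exact HasCompactSupport.of_support_subset_isCompact isCompact_Icc
      ((subset_tsupport _).trans (hsupp k))
  · refine (hsupp k).trans (Icc_subset_Ioo ?_ ?_)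
    · have : (0 : ℝ) < 1 / ((k : ℝ) + 1) := by positivity
      linarith
    · have : (0 : ℝ) < 1 / ((k : ℝ) + 1) := by positivity
      linarith
  · refine tendsto_eLpNorm_sub_of_bounded (M := B)
      (fun k => (hψc k).continuous.aestronglyMeasurable) (memLp u hcu) (fun k => ?_) ?_
    · filter_upwards [ae_restrict_mem measurableSet_Ioo] with x hx
      have h1 := hB x (Ioo_subset_Icc_self hx)
      have h2 : ‖S (l k x) * S (r k x)‖ ≤ 1 := by
        rw [Real.norm_eq_abs, abs_of_nonneg (mul_nonneg (hS0 _) (hS0 _))]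
        exact mul_le_one₀ (hS1 _) (hS0 _) (hS1 _)
      calc ‖ψ k x‖ = ‖u x‖ * ‖S (l k x) * S (r k x)‖ := norm_mul _ _
        _ ≤ B * 1 := by gcongr; exact (norm_nonneg _).trans h1
        _ = B := mul_one B
    · filter_upwards [ae_restrict_mem measurableSet_Ioo] with x hx
      refine tendsto_const_nhds.congr' ?_
      filter_upwards [hlim x hx] with k hk
      exact hk.self_of_nhds.symm
  · refine tendsto_eLpNorm_sub_of_bounded (M := B' + (2 * |K| * M + 2 * |K| * M))
      (fun k => (((hψc k).continuous_deriv (by norm_cast)).aestronglyMeasurable))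
      (memLp _ hcd) (fun k => ?_) ?_
    · filter_upwards [ae_restrict_mem measurableSet_Ioo] with x hx
      rw [(hder k x).deriv]
      have h1 := hB' x (Ioo_subset_Icc_self hx)
      have h2 : ‖S (l k x) * S (r k x)‖ ≤ 1 := by
        rw [Real.norm_eq_abs, abs_of_nonneg (mul_nonneg (hS0 _) (hS0 _))]
        exact mul_le_one₀ (hS1 _) (hS0 _) (hS1 _)
      have h3 : ‖deriv u x * (S (l k x) * S (r k x))‖ ≤ B' := by
        calc _ = ‖deriv u x‖ * ‖S (l k x) * S (r k x)‖ := norm_mul _ _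
          _ ≤ B' * 1 := by gcongr; exact (norm_nonneg _).trans h1
          _ = B' := mul_one B'
      have h4 := hcut (u x) (x - a) k (by linarith [hx.1]) (hua x hx)
      have h5 := hcut (u x) (b - x) k (by linarith [hx.2]) (hub x hx)
      refine (norm_add_le _ _).trans (add_le_add h3 ?_)
      rw [mul_add]
      refine (norm_add_le _ _).trans (add_le_add ?_ ?_)
      · calc _ = |u x * (deriv S (l k x) * ((k : ℝ) + 1))| * S (r k x) := by
              rw [← mul_assoc, norm_mul, Real.norm_eq_abs, Real.norm_eq_abs, abs_of_nonneg (hS0 (r k x))]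
          _ ≤ (2 * |K| * M) * 1 := mul_le_mul (by assumption) (hS1 _) (hS0 _) (by positivity)
          _ = _ := mul_one _
      · calc _ = |u x * (deriv S (r k x) * ((k : ℝ) + 1))| * S (l k x) := by
              rw [show u x * (S (l k x) * (deriv S (r k x) * -((k : ℝ) + 1))) =
                -(u x * (deriv S (r k x) * ((k : ℝ) + 1)) * S (l k x)) by ring, norm_neg, norm_mul,
                Real.norm_eq_abs, Real.norm_eq_abs, abs_of_nonneg (hS0 (l k x))]
          _ ≤ (2 * |K| * M) * 1 := mul_le_mul (by assumption) (hS1 _) (hS0 _) (by positivity)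
          _ = _ := mul_one _
    · filter_upwards [ae_restrict_mem measurableSet_Ioo] with x hx
      refine tendsto_const_nhds.congr' ?_
      filter_upwards [hlim x hx] with k hk
      exact (EventuallyEq.deriv_eq hk).symm

theorem integral_sin_sq_Ioo {a b : ℝ} (hab : a < b) :
    ∫ x in Ioo a b, Real.sin (Real.pi / (b - a) * (x - a)) ^ 2 = (b - a) / 2 := by
  have hL : b - a ≠ 0 := (sub_pos.mpr hab).ne'
  rw [setIntegral_Ioo_eq_intervalIntegral _ hab.le]
  have hd : ∀ x ∈ uIcc a b, HasDerivAt (fun x => (x - a) / 2 -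
      (b - a) / (4 * Real.pi) * Real.sin (2 * (Real.pi / (b - a) * (x - a))))
      (Real.sin (Real.pi / (b - a) * (x - a)) ^ 2) x := by
    intro x _
    have h1 : HasDerivAt (fun x => 2 * (Real.pi / (b - a) * (x - a)))
        (2 * (Real.pi / (b - a) * 1)) x :=
      (((hasDerivAt_id x).sub_const a).const_mul _).const_mul 2
    convert! (((hasDerivAt_id x).sub_const a).div_const 2).sub
      (h1.sin.const_mul ((b - a) / (4 * Real.pi))) using 1
    rw [Real.cos_two_mul, Real.cos_sq']
    field_simp
    ring
  rw [intervalIntegral.integral_eq_sub_of_hasDerivAt hd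
    (Continuous.intervalIntegrable (by fun_prop) _ _)]
  have : 2 * (Real.pi / (b - a) * (b - a)) = 2 * Real.pi := by field_simp
  rw [this, Real.sin_two_pi]
  simp

/-- Freezing the coefficient `f` at the value `c` costs at most its `L¹` distance from `c`, because
`0 ≤ g ≤ 1`. -/
theorem abs_integral_coeff_mul_sub_le {β : ℝ} (hβ : 0 < β) {f g : ℝ → ℝ} (hf : IsCoeff β f)
    {a b : ℝ} (hg : Continuous g) (hg0 : ∀ x, 0 ≤ g x) (hg1 : ∀ x, g x ≤ 1) (c : ℝ) :
    |(∫ x in Ioo a b, f x * g x) - c * ∫ x in Ioo a b, g x| ≤ ∫ x in Ioo a b, |f x - c| := by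
  have hi1 : IntegrableOn (fun x => f x * g x) (Ioo a b) :=
    (intervalIntegrable_coeff_mul hβ hf hg a b).1.mono_set (Ioo_subset_Ioc_self (a := b) (b := a))
  have hi2 : IntegrableOn (fun x => c * g x) (Ioo a b) :=
    ((hg.integrableOn_Icc).mono_set Ioo_subset_Icc_self).const_mul c
  rw [← integral_const_mul, ← integral_sub hi1 hi2]
  refine (abs_integral_le_integral_abs).trans (integral_mono (hi1.sub hi2).abs
    ((hf.integrableOn hβ (by simp)).sub (integrableOn_const (by simp))).abs fun x => ?_)
  simp only
  rw [← sub_mul, abs_mul, abs_of_nonneg (hg0 x)]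
  exact mul_le_of_le_one_right (abs_nonneg _) (hg1 x)

/-- Bounds for the first eigenvalue through the Rayleigh quotient `N / D` of a sine function. -/
theorem exists_firstEigenvalue_le {β : ℝ} (hβ : 0 < β) {p q w : ℝ → ℝ} (hp : IsCoeff β p)
    (hq : ∀ᵐ x, 0 ≤ q x ∧ q x ≤ β) (hqm : AEStronglyMeasurable q volume) (hw : IsCoeff β w)
    {a b : ℝ} (hab : a < b) :
    ∃ N D : ℝ, 0 < N ∧ 0 < D ∧ firstEigenvalue p q w (Ioo a b) ≤ ENNReal.ofReal (N / D) ∧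
      (b - a) / 2 / β ≤ D ∧
      (∀ c, c * ((b - a) / 2) - (∫ x in Ioo a b, |w x - c|) ≤ D) ∧
      N ≤ (Real.pi / (b - a)) ^ 2 * (β * ((b - a) / 2)) + β * (b - a) ∧
      (∀ c, N ≤ (Real.pi / (b - a)) ^ 2 * (c * ((b - a) / 2) + ∫ x in Ioo a b, |p x - c|) +
        β * (b - a)) := by
  have hL : 0 < b - a := sub_pos.mpr hab
  set k := Real.pi / (b - a) with hk
  have hkpos : 0 < k := div_pos Real.pi_pos hL
  -- The first Dirichlet eigenfunction of the interval for constant coefficients.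
  set u : ℝ → ℝ := fun x => Real.sin (k * (x - a)) with hu
  have huc : ContDiff ℝ ∞ u := by
    have : ContDiff ℝ ∞ fun x : ℝ => k * (x - a) := by fun_prop
    exact Real.contDiff_sin.comp this
  have hder : deriv u = fun x => k * Real.cos (k * (x - a)) := by
    funext x
    have h1 : HasDerivAt (fun x => k * (x - a)) (k * 1) x :=
      ((hasDerivAt_id x).sub_const a).const_mul k
    rw [h1.sin.deriv]
    ring
  have hmem : MemH10 (Ioo a b) u (deriv u) := by
    refine memH10_Ioo_of_contDiff huc (K := k) (fun x hx => ?_) fun x hx => ?_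
    · have : 0 ≤ k * (x - a) := mul_nonneg hkpos.le (by linarith [hx.1])
      exact (Real.abs_sin_le_abs).trans (abs_of_nonneg this).le
    · have : 0 ≤ k * (b - x) := mul_nonneg hkpos.le (by linarith [hx.2])
      have h2 : u x = Real.sin (k * (b - x)) := by
        rw [← Real.sin_pi_sub]
        simp only [hu]
        congr 1
        rw [hk]; field_simp; ring
      rw [h2]
      exact (Real.abs_sin_le_abs).trans (abs_of_nonneg this).le
  have hs2 : ∫ x in Ioo a b, u x ^ 2 = (b - a) / 2 := integral_sin_sq_Ioo hab
  have hcu : Continuous fun x => u x ^ 2 := by fun_prop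
  have hcc : Continuous fun x => Real.cos (k * (x - a)) ^ 2 := by fun_prop
  have hu1 : ∀ x, u x ^ 2 ≤ 1 := fun x => Real.sin_sq_le_one _
  have hc1 : ∀ x, Real.cos (k * (x - a)) ^ 2 ≤ 1 := fun x => Real.cos_sq_le_one _
  have hint : ∀ {g : ℝ → ℝ}, Continuous g → IntegrableOn g (Ioo a b) := fun hg =>
    hg.integrableOn_Icc.mono_set Ioo_subset_Icc_self
  have hc2 : ∫ x in Ioo a b, Real.cos (k * (x - a)) ^ 2 = (b - a) / 2 := by
    have h1 : ∀ x, Real.cos (k * (x - a)) ^ 2 = 1 - u x ^ 2 := fun x => Real.cos_sq' _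
    simp_rw [h1]
    rw [integral_sub (hint continuous_const) (hint hcu), hs2]
    simp [hab.le]
    ring
  have hiw : IntegrableOn (fun x => w x * u x ^ 2) (Ioo a b) :=
    (intervalIntegrable_coeff_mul hβ hw hcu a b).1.mono_set (Ioo_subset_Ioc_self (a := b) (b := a))
  have hip : IntegrableOn (fun x => p x * Real.cos (k * (x - a)) ^ 2) (Ioo a b) :=
    (intervalIntegrable_coeff_mul hβ hp hcc a b).1.mono_set (Ioo_subset_Ioc_self (a := b) (b := a))
  have hD : (b - a) / 2 / β ≤ ∫ x in Ioo a b, w x * u x ^ 2 := by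
    rw [← hs2, ← integral_div]
    refine integral_mono_ae ((hint hcu).div_const β) hiw ?_
    filter_upwards [ae_restrict_of_ae hw.bound] with x hx
    have := mul_le_mul_of_nonneg_right hx.1 (sq_nonneg (u x))
    rwa [one_div_mul_eq_div] at this
  have hDpos : 0 < ∫ x in Ioo a b, w x * u x ^ 2 := lt_of_lt_of_le (by positivity) hD
  have hpu : ∫ x in Ioo a b, p x * deriv u x ^ 2 =
      k ^ 2 * ∫ x in Ioo a b, p x * Real.cos (k * (x - a)) ^ 2 := by
    rw [← integral_const_mul, hder]
    congr 1
    funext x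
    ring
  have hE : 0 < ∫ x in Ioo a b, p x * Real.cos (k * (x - a)) ^ 2 := by
    have : (b - a) / 2 / β ≤ ∫ x in Ioo a b, p x * Real.cos (k * (x - a)) ^ 2 := by
      rw [← hc2, ← integral_div]
      refine integral_mono_ae ((hint hcc).div_const β) hip ?_
      filter_upwards [ae_restrict_of_ae hp.bound] with x hx
      have := mul_le_mul_of_nonneg_right hx.1 (sq_nonneg (Real.cos (k * (x - a))))
      rwa [one_div_mul_eq_div] at this
    exact lt_of_lt_of_le (by positivity) this
  have hq0 : 0 ≤ ∫ x in Ioo a b, q x * u x ^ 2 := by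
    refine integral_nonneg_of_ae ?_
    filter_upwards [ae_restrict_of_ae hq] with x hx
    exact mul_nonneg hx.1 (sq_nonneg _)
  have hq1 : ∫ x in Ioo a b, q x * u x ^ 2 ≤ β * (b - a) := by
    have h1 : ∫ x in Ioo a b, q x * u x ^ 2 ≤ ∫ _ in Ioo a b, β := by
      refine integral_mono_ae ?_ (integrableOn_const (by simp)) ?_
      · refine (hint hcu).bdd_mul (c := β) hqm.restrict ?_
        filter_upwards [ae_restrict_of_ae hq] with x hx
        rw [Real.norm_eq_abs, abs_of_nonneg hx.1]
        exact hx.2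
      · filter_upwards [ae_restrict_of_ae hq] with x hx
        calc q x * u x ^ 2 ≤ β * 1 := mul_le_mul hx.2 (hu1 x) (sq_nonneg _) hβ.le
          _ = β := mul_one β
    simpa [hab.le, mul_comm] using h1
  refine ⟨(∫ x in Ioo a b, p x * deriv u x ^ 2) + ∫ x in Ioo a b, q x * u x ^ 2,
    ∫ x in Ioo a b, w x * u x ^ 2, ?_, hDpos, ?_, hD, ?_, ?_, ?_⟩
  · rw [hpu]; positivity
  · refine iInf_le_of_le u (iInf_le_of_le (deriv u) (iInf_le_of_le hmem (iInf_le_of_le ?_ le_rfl)))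
    intro h
    have : ∫ x in Ioo a b, u x ^ 2 = 0 := by
      rw [integral_congr_ae (g := fun _ => 0), integral_zero]
      filter_upwards [h] with x hx
      simp [hx]
    rw [hs2] at this
    linarith
  · intro c
    have := (abs_le.mp (abs_integral_coeff_mul_sub_le hβ hw (a := a) (b := b) hcu
      (fun x => sq_nonneg _) hu1 c)).1
    rw [hs2] at this
    linarith
  · rw [hpu]
    have h1 : ∫ x in Ioo a b, p x * Real.cos (k * (x - a)) ^ 2 ≤ β * ((b - a) / 2) := by
      rw [← hc2, ← integral_const_mul]
      refine integral_mono_ae hip ((hint hcc).const_mul β) ?_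
      filter_upwards [ae_restrict_of_ae hp.bound] with x hx
      exact mul_le_mul_of_nonneg_right hx.2 (sq_nonneg _)
    gcongr
  · intro c
    rw [hpu]
    have := (abs_le.mp (abs_integral_coeff_mul_sub_le hβ hp (a := a) (b := b) hcc
      (fun x => sq_nonneg _) hc1 c)).2
    rw [hc2] at this
    gcongr
    linarith

/-! ### Asymptotics of the inverse root of the eigenvalue on short intervals -/

/-- The real number `λ(a, b)^{-1/2}`. -/
noncomputable def invSqrtEigenvalue (p q w : ℝ → ℝ) (a b : ℝ) : ℝ :=
  ((firstEigenvalue p q w (Ioo a b) ^ (1 / 2 : ℝ))⁻¹).toReal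

theorem invSqrtEigenvalue_nonneg (p q w : ℝ → ℝ) (a b : ℝ) : 0 ≤ invSqrtEigenvalue p q w a b :=
  ENNReal.toReal_nonneg

/-- No hypothesis on the eigenvalue is needed: at the values `0` and `∞` both sides are `0` by
convention. -/
theorem invSqrtEigenvalue_sq (p q w : ℝ → ℝ) (a b : ℝ) :
    invSqrtEigenvalue p q w a b ^ 2 = (firstEigenvalue p q w (Ioo a b)).toReal⁻¹ := by
  rw [invSqrtEigenvalue, ENNReal.toReal_inv, ← ENNReal.toReal_rpow, inv_pow, ← Real.rpow_natCast,
    ← Real.rpow_mul ENNReal.toReal_nonneg]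
  norm_num

theorem invSqrtEigenvalue_of_le (p q w : ℝ → ℝ) {a b : ℝ} (h : b ≤ a) :
    invSqrtEigenvalue p q w a b = 0 := by
  have h1 : firstEigenvalue p q w (Ioo a b) = ⊤ := by
    rw [Ioo_eq_empty (not_lt.mpr h), firstEigenvalue]
    simp only [iInf_eq_top]
    intro u v _ hu
    exact absurd (by simp [EventuallyEq]) hu
  rw [invSqrtEigenvalue, h1, ENNReal.top_rpow_of_pos (by norm_num)]
  simp

theorem toNNReal_div_sqrt_eigenvalue (p q w : ℝ → ℝ) (a b : ℝ) (n : ℕ) :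
    (((n : ℝ≥0∞) / firstEigenvalue p q w (Ioo a b) ^ (1 / 2 : ℝ)).toNNReal : ℝ) =
      n * invSqrtEigenvalue p q w a b := by
  rw [ENNReal.coe_toNNReal_eq_toReal, div_eq_mul_inv, ENNReal.toReal_mul, ENNReal.toReal_natCast,
    invSqrtEigenvalue]

theorem IsCoeff.sqrt_div {β : ℝ} (hβ : 0 < β) {p w : ℝ → ℝ} (hp : IsCoeff β p)
    (hw : IsCoeff β w) : IsCoeff β fun x => √(w x / p x) := by
  refine ⟨(Real.continuous_sqrt.comp_aestronglyMeasurable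
    (hw.meas.aemeasurable.div hp.meas.aemeasurable).aestronglyMeasurable), ?_⟩
  have hb := one_div_pos.mpr hβ
  filter_upwards [hp.bound, hw.bound] with x h1 h2
  have hpx : 0 < p x := hb.trans_le h1.1
  constructor
  · refine Real.le_sqrt_of_sq_le ?_
    rw [le_div_iff₀ hpx]
    calc (1 / β) ^ 2 * p x ≤ (1 / β) ^ 2 * β := by gcongr; exact h1.2
      _ = 1 / β := by field_simp
      _ ≤ w x := h2.1
  · refine (Real.sqrt_le_left hβ.le).mpr ?_
    rw [div_le_iff₀ hpx]
    calc w x ≤ β := h2.2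
      _ = β ^ 2 * (1 / β) := by field_simp
      _ ≤ β ^ 2 * p x := by gcongr; exact h1.1

theorem abs_inv_sub_inv_le {β x y : ℝ} (hβ : 0 < β) (hx : 1 / β ≤ x) (hy : 1 / β ≤ y) :
    |1 / x - 1 / y| ≤ β ^ 2 * |x - y| := by
  have hb := one_div_pos.mpr hβ
  have hx0 := hb.trans_le hx
  have hy0 := hb.trans_le hy
  have h1 : 1 / x ≤ β := by have := one_div_le_one_div_of_le hb hx; rwa [one_div_one_div] at this
  have h2 : 1 / y ≤ β := by have := one_div_le_one_div_of_le hb hy; rwa [one_div_one_div] at this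
  have h3 : 1 / x - 1 / y = (1 / x) * (1 / y) * (y - x) := by field_simp
  rw [h3, abs_mul, abs_sub_comm, abs_of_pos (by positivity)]
  gcongr
  calc 1 / x * (1 / y) ≤ β * β := by gcongr
    _ = β ^ 2 := by ring

/-- The difference of the roots, times their sum, is the difference of the quotients, and the sum is
at least `1 / β`. -/
theorem abs_sqrt_div_sub_le {β p w p0 w0 : ℝ} (hβ : 1 < β) (hp : 1 / β ≤ p ∧ p ≤ β)
    (hw : 1 / β ≤ w ∧ w ≤ β) (hp0 : 1 / β ≤ p0 ∧ p0 ≤ β) (hw0 : 1 / β ≤ w0 ∧ w0 ≤ β) :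
    |√(w / p) - √(w0 / p0)| ≤ β ^ 4 * (|p - p0| + |w - w0|) := by
  have hβ0 : 0 < β := by linarith
  have hb := one_div_pos.mpr hβ0
  have hpp := hb.trans_le hp.1
  have hpp0 := hb.trans_le hp0.1
  have hww := hb.trans_le hw.1
  have hww0 := hb.trans_le hw0.1
  have hs : 1 / β ≤ √(w0 / p0) := by
    refine Real.le_sqrt_of_sq_le ?_
    rw [le_div_iff₀ hpp0]
    calc (1 / β) ^ 2 * p0 ≤ (1 / β) ^ 2 * β := by gcongr; exact hp0.2
      _ = 1 / β := by field_simp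
      _ ≤ w0 := hw0.1
  have h1 : (√(w / p) - √(w0 / p0)) * (√(w / p) + √(w0 / p0)) = w / p - w0 / p0 := by
    have e1 := Real.sq_sqrt (show 0 ≤ w / p by positivity)
    have e2 := Real.sq_sqrt (show 0 ≤ w0 / p0 by positivity)
    linear_combination e1 - e2
  have h2 : |√(w / p) - √(w0 / p0)| * (1 / β) ≤ |w / p - w0 / p0| := by
    rw [← h1, abs_mul]
    gcongr
    rw [abs_of_nonneg (by positivity)]
    linarith [Real.sqrt_nonneg (w / p)]
  have h3 : |w / p - w0 / p0| ≤ β * |w - w0| + β * (β ^ 2 * |p - p0|) := by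
    have e : w / p - w0 / p0 = 1 / p * (w - w0) + w0 * (1 / p - 1 / p0) := by ring
    rw [e]
    refine (abs_add_le _ _).trans ?_
    rw [abs_mul, abs_mul, abs_of_pos hww0, abs_of_pos (one_div_pos.mpr hpp)]
    have := one_div_le_one_div_of_le hb hp.1
    rw [one_div_one_div] at this
    gcongr
    · exact hw0.2
    · exact abs_inv_sub_inv_le hβ0 hp.1 hp0.1
  have h4 : |√(w / p) - √(w0 / p0)| ≤ β * |w / p - w0 / p0| := by
    calc _ = β * (|√(w / p) - √(w0 / p0)| * (1 / β)) := by field_simp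
      _ ≤ _ := by gcongr
  have h5 : β ^ 2 ≤ β ^ 4 := pow_le_pow_right₀ hβ.le (by norm_num)
  calc _ ≤ β * (β * |w - w0| + β * (β ^ 2 * |p - p0|)) := h4.trans (by gcongr)
    _ = β ^ 2 * |w - w0| + β ^ 4 * |p - p0| := by ring
    _ ≤ β ^ 4 * |w - w0| + β ^ 4 * |p - p0| := by gcongr
    _ = _ := by ring

theorem toReal_inv_mem_of_bounds {x : ℝ≥0∞} {A B : ℝ} (hA : 0 < A)
    (h1 : ENNReal.ofReal A ≤ x) (h2 : x ≤ ENNReal.ofReal B) :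
    B⁻¹ ≤ x.toReal⁻¹ ∧ x.toReal⁻¹ ≤ A⁻¹ := by
  have hx : x ≠ ⊤ := ne_top_of_le_ne_top ENNReal.ofReal_ne_top h2
  have h3 : A ≤ x.toReal := (ENNReal.ofReal_le_iff_le_toReal hx).mp h1
  have hpos := hA.trans_le h3
  have h4 : x.toReal ≤ B := by
    by_contra h
    rw [not_le] at h
    have := (ENNReal.lt_ofReal_iff_toReal_lt (a := B.toNNReal) (b := x.toReal) (by simp)).mpr
      (by rcases le_total 0 B with hB | hB
          · simpa [hB] using h
          · simpa [Real.toNNReal_of_nonpos hB] using hpos)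
    rw [ENNReal.ofReal_toReal hx] at this
    exact absurd h2 (not_le.mpr this)
  exact ⟨inv_anti₀ hpos h4, inv_anti₀ hA h3⟩

section

variable {β : ℝ} {p q w : ℝ → ℝ} {a b : ℝ}

set_option maxHeartbeats 1000000 in
/-- Quantitative asymptotics of `λ⁻¹` on short intervals with almost constant coefficients. -/
theorem abs_pi_sq_mul_invSqrtEigenvalue_sq_sub_le (hβ : 1 < β) (hp : IsCoeff β p)
    (hq : ∀ᵐ x, 0 ≤ q x ∧ q x ≤ β) (hqm : AEStronglyMeasurable q volume) (hw : IsCoeff β w)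
    (hab : a < b) {p0 w0 : ℝ} (hp0 : 1 / β ≤ p0 ∧ p0 ≤ β)
    (hw0 : 1 / β ≤ w0 ∧ w0 ≤ β) :
    |Real.pi ^ 2 * invSqrtEigenvalue p q w a b ^ 2 - w0 / p0 * (b - a) ^ 2| ≤
      15 * β ^ 5 * (b - a) * ((∫ x in Ioo a b, |p x - p0|) + (∫ x in Ioo a b, |w x - w0|) +
        (b - a) ^ 3) := by
  have hβ0 : 0 < β := by linarith
  have hb := one_div_pos.mpr hβ0
  have hpp0 := hb.trans_le hp0.1
  have hww0 := hb.trans_le hw0.1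
  obtain ⟨N, D, hN, hD, hle, hD1, hD2, hN1, hN2⟩ := exists_firstEigenvalue_le hβ0 hp hq hqm hw hab
  -- With `c = w0 * p0`, the function `c / p` is close to `w0`, hence to `w`, and `c G²` is close to
  -- `(w0 / p0) L²`.
  have hlow := ofReal_inv_le_firstEigenvalue hβ0 hp (hq.mono fun x hx => hx.1) hw hab
    (c := w0 * p0) (by positivity)
  have hG := integral_inv_pos hβ0 hp hab
  have hv : volume (Ioo a b) ≠ ⊤ := by simp
  have hpi := hp.inv hβ0
  set G := ∫ x in Ioo a b, 1 / p x with hGdef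
  set ηp := ∫ x in Ioo a b, |p x - p0| with hηp
  set ηw := ∫ x in Ioo a b, |w x - w0| with hηw
  set R := ∫ x in Ioo a b, |w x - w0 * p0 / p x| with hR
  set L := b - a with hL
  have hL0 : 0 < L := sub_pos.mpr hab
  have hηp0 : 0 ≤ ηp := integral_nonneg fun _ => abs_nonneg _
  have hηw0 : 0 ≤ ηw := integral_nonneg fun _ => abs_nonneg _
  have hR0 : 0 ≤ R := integral_nonneg fun _ => abs_nonneg _
  have hip : IntegrableOn (fun x => |p x - p0|) (Ioo a b) :=
    ((hp.integrableOn hβ0 hv).sub (integrableOn_const hv)).abs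
  have hiw : IntegrableOn (fun x => |w x - w0|) (Ioo a b) :=
    ((hw.integrableOn hβ0 hv).sub (integrableOn_const hv)).abs
  have hGle : G ≤ β * L := by
    have := hpi.setIntegral_le hβ0 hv
    rwa [Real.volume_real_Ioo_of_le hab.le] at this
  have hG2 : G ≤ L / p0 + β ^ 2 * ηp := by
    have h1 : G ≤ ∫ x in Ioo a b, (1 / p0 + β ^ 2 * |p x - p0|) := by
      refine integral_mono_ae (hpi.integrableOn hβ0 hv)
        ((integrableOn_const hv).add (hip.const_mul _)) ?_
      filter_upwards [ae_restrict_of_ae hp.bound] with x hx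
      have := le_of_abs_le (abs_inv_sub_inv_le hβ0 hx.1 hp0.1)
      linarith
    rw [integral_add (integrable_const _) (hip.const_mul _), integral_const_mul] at h1
    simp only [integral_const, measureReal_restrict_apply_univ,
      Real.volume_real_Ioo_of_le hab.le, smul_eq_mul] at h1
    rwa [← hL, mul_one_div] at h1
  have hRle : R ≤ ηw + β ^ 2 * ηp := by
    have h1 : R ≤ ∫ x in Ioo a b, (|w x - w0| + β ^ 2 * |p x - p0|) := by
      have hi : IntegrableOn (fun x => |w x - w0 * p0 / p x|) (Ioo a b) := by
        have h := (hpi.integrableOn hβ0 hv).const_mul (w0 * p0)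
        simp only [mul_one_div] at h
        exact ((hw.integrableOn hβ0 hv).sub h).abs
      refine integral_mono_ae hi (hiw.add (hip.const_mul _)) ?_
      filter_upwards [ae_restrict_of_ae hp.bound] with x hx
      have hpx := hb.trans_le hx.1
      have e : w x - w0 * p0 / p x = (w x - w0) + w0 * (1 / p x) * (p x - p0) := by
        field_simp
        ring
      have h2 : 1 / p x ≤ β := by
        have := one_div_le_one_div_of_le hb hx.1
        rwa [one_div_one_div] at this
      rw [e]
      refine (abs_add_le _ _).trans ?_
      rw [abs_mul, abs_of_pos (by positivity : 0 < w0 * (1 / p x))]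
      gcongr
      calc w0 * (1 / p x) ≤ β * β := by gcongr; exact hw0.2
        _ = β ^ 2 := by ring
    rwa [integral_add hiw (hip.const_mul _), integral_const_mul] at h1
  have hKpos : 0 < w0 * p0 * G ^ 2 / Real.pi ^ 2 + G * R := by positivity
  obtain ⟨h1, h2⟩ := toReal_inv_mem_of_bounds (inv_pos.mpr hKpos) hlow hle
  rw [inv_inv] at h2
  rw [← invSqrtEigenvalue_sq] at h1 h2
  set z := invSqrtEigenvalue p q w a b ^ 2 with hz
  have hπ : Real.pi ^ 2 ≤ 10 := by nlinarith [Real.pi_lt_d2, Real.pi_pos]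
  have hπ9 : 9 ≤ Real.pi ^ 2 := by nlinarith [Real.pi_gt_three]
  have hs0 : w0 / p0 ≤ β ^ 2 := by
    rw [div_le_iff₀ hpp0]
    calc w0 ≤ β := hw0.2
      _ = β ^ 2 * (1 / β) := by field_simp
      _ ≤ β ^ 2 * p0 := by gcongr; exact hp0.1
  have b35 : β ^ 3 ≤ β ^ 5 := pow_le_pow_right₀ hβ.le (by norm_num)
  have b15 : β ≤ β ^ 5 := by simpa using pow_le_pow_right₀ hβ.le (show 1 ≤ 5 by norm_num)
  have b45 : β ^ 4 ≤ β ^ 5 := pow_le_pow_right₀ hβ.le (by norm_num)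
  rw [abs_le]
  constructor
  · have hzN : D ≤ N * z := by
      rw [inv_div] at h1
      rw [mul_comm]
      exact (div_le_iff₀ hN).mp h1
    have h3 := hD2 w0
    have h4 := hN2 p0
    have hz0 : 0 ≤ z := sq_nonneg _
    -- `M` is `L² / π²` times the upper bound for `N` in `h4`; its last term is the contribution of
    -- `q`.
    set M := p0 * (L / 2) + ηp + β * L ^ 3 / Real.pi ^ 2 with hM
    have hMpos : 0 < M := by positivity
    have h5 : N ≤ Real.pi ^ 2 / L ^ 2 * M := by
      refine h4.trans (le_of_eq ?_)
      rw [hM]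
      field_simp
      ring
    set Y := 15 * β ^ 5 * L * (ηp + ηw + L ^ 3) with hY
    have h6 : w0 * (L / 2) - ηw ≤ Real.pi ^ 2 / L ^ 2 * M * z :=
      h3.trans (hzN.trans (by gcongr))
    have h7 : L ^ 2 * (w0 * (L / 2) - ηw) ≤ M * (Real.pi ^ 2 * z) := by
      calc L ^ 2 * (w0 * (L / 2) - ηw) ≤ L ^ 2 * (Real.pi ^ 2 / L ^ 2 * M * z) := by gcongr
        _ = _ := by field_simp
    -- The comparison is made after multiplication by `M > 0`, so the sign of `w0 * (L / 2) - ηw`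
    -- does not matter.
    have h8 : M * (w0 / p0 * L ^ 2 - Y) ≤ L ^ 2 * (w0 * (L / 2) - ηw) := by
      have e1 : M * (w0 / p0 * L ^ 2) =
          L ^ 2 * (w0 * (L / 2)) + w0 / p0 * L ^ 2 * (ηp + β * L ^ 3 / Real.pi ^ 2) := by
        rw [hM]; field_simp; ring
      have e2 : p0 * (L / 2) * Y ≤ M * Y := by
        have : 0 ≤ Y := by positivity
        gcongr
        have : 0 ≤ β * L ^ 3 / Real.pi ^ 2 := by positivity
        linarith
      have e3 : w0 / p0 * L ^ 2 * (ηp + β * L ^ 3 / Real.pi ^ 2) + L ^ 2 * ηw ≤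
          p0 * (L / 2) * Y := by
        have i1 : β * L ^ 3 / Real.pi ^ 2 ≤ β * L ^ 3 := div_le_self (by positivity) (by linarith)
        have i2 : w0 / p0 * L ^ 2 * (ηp + β * L ^ 3 / Real.pi ^ 2) ≤
            β ^ 2 * L ^ 2 * (ηp + β * L ^ 3) := by gcongr
        have i3 : 7 * L ^ 2 * β ^ 4 * (ηp + ηw + L ^ 3) ≤ p0 * (L / 2) * Y := by
          have : 1 / β * (L / 2) * Y ≤ p0 * (L / 2) * Y := by gcongr; exact hp0.1
          refine le_trans ?_ this
          have e : 1 / β * (L / 2) * Y = 15 / 2 * L ^ 2 * β ^ 4 * (ηp + ηw + L ^ 3) := by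
            rw [hY]; field_simp
          rw [e]
          gcongr
          norm_num
        have j1 : β ^ 2 ≤ β ^ 4 := pow_le_pow_right₀ hβ.le (by norm_num)
        have j2 : β ^ 3 ≤ β ^ 4 := pow_le_pow_right₀ hβ.le (by norm_num)
        have j3 : 1 ≤ β ^ 4 := one_le_pow₀ hβ.le
        have k1 : β ^ 2 * (L ^ 2 * ηp) ≤ β ^ 4 * (L ^ 2 * ηp) := by gcongr
        have k2 : β ^ 3 * (L ^ 2 * L ^ 3) ≤ β ^ 4 * (L ^ 2 * L ^ 3) := by gcongr
        have k3 : 1 * (L ^ 2 * ηw) ≤ β ^ 4 * (L ^ 2 * ηw) := by gcongr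
        have l1 : 0 ≤ β ^ 4 * (L ^ 2 * ηp) := by positivity
        have l2 : 0 ≤ β ^ 4 * (L ^ 2 * L ^ 3) := by positivity
        have l3 : 0 ≤ β ^ 4 * (L ^ 2 * ηw) := by positivity
        linarith
      rw [mul_sub]
      linarith
    have h9 := le_of_mul_le_mul_left (h8.trans h7) hMpos
    linarith
  · have h3 : Real.pi ^ 2 * z ≤ w0 * p0 * G ^ 2 + Real.pi ^ 2 * (G * R) := by
      calc Real.pi ^ 2 * z ≤ Real.pi ^ 2 * (w0 * p0 * G ^ 2 / Real.pi ^ 2 + G * R) := by gcongr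
        _ = _ := by field_simp
    have h4 : Real.pi ^ 2 * (G * R) ≤ 10 * (β * L * (ηw + β ^ 2 * ηp)) := by gcongr
    have h5 : L / p0 ≤ β * L := by
      rw [div_le_iff₀ hpp0]
      calc L = β * L * (1 / β) := by field_simp
        _ ≤ _ := by gcongr; exact hp0.1
    have h6 : G ^ 2 ≤ (L / p0) ^ 2 + 2 * β ^ 3 * L * ηp := by
      have : (G - L / p0) * (G + L / p0) ≤ β ^ 2 * ηp * (2 * (β * L)) := by
        refine mul_le_mul (by linarith) (by linarith) (by positivity) (by positivity)
      linarith
    have h7 : w0 * p0 * G ^ 2 ≤ w0 / p0 * L ^ 2 + 2 * β ^ 5 * L * ηp := by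
      calc w0 * p0 * G ^ 2 ≤ w0 * p0 * ((L / p0) ^ 2 + 2 * β ^ 3 * L * ηp) := by gcongr
        _ = w0 / p0 * L ^ 2 + w0 * p0 * (2 * β ^ 3 * L * ηp) := by field_simp
        _ ≤ w0 / p0 * L ^ 2 + β * β * (2 * β ^ 3 * L * ηp) := by
            gcongr
            · exact hw0.2
            · exact hp0.2
        _ = _ := by ring
    -- Here `ηp` needs the constant `12`, of which `10` bounds `π²` and `2` comes from `G²`; `ηw`
    -- needs `10`. The constant `15` leaves room.
    have k1 : β * (L * ηw) ≤ β ^ 5 * (L * ηw) := by gcongr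
    have k2 : β ^ 3 * (L * ηp) ≤ β ^ 5 * (L * ηp) := by gcongr
    have l1 : 0 ≤ β ^ 5 * (L * ηp) := by positivity
    have l2 : 0 ≤ β ^ 5 * (L * ηw) := by positivity
    have l3 : 0 ≤ β ^ 5 * (L * L ^ 3) := by positivity
    linarith

/-- Dividing the estimate for squares by `π l + s0 L ≥ L / β` gives one for `π l - s0 L`. Then `s0
L` is replaced by the integral of `√(w / p)`, which depends on `p` and `w` in a Lipschitz way. -/
theorem abs_invSqrtEigenvalue_sub_le (hβ : 1 < β) (hp : IsCoeff β p)
    (hq : ∀ᵐ x, 0 ≤ q x ∧ q x ≤ β) (hqm : AEStronglyMeasurable q volume) (hw : IsCoeff β w)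
    (hab : a < b) (hab1 : b - a ≤ 1) {p0 w0 : ℝ} (hp0 : 1 / β ≤ p0 ∧ p0 ≤ β)
    (hw0 : 1 / β ≤ w0 ∧ w0 ≤ β) :
    |invSqrtEigenvalue p q w a b - 1 / Real.pi * ∫ x in Ioo a b, √(w x / p x)| ≤
      16 * β ^ 6 * ((∫ x in Ioo a b, |p x - p0|) + (∫ x in Ioo a b, |w x - w0|) +
        (b - a) ^ 2) := by
  have hβ0 : 0 < β := by linarith
  have hb := one_div_pos.mpr hβ0
  have hpp0 := hb.trans_le hp0.1
  have hww0 := hb.trans_le hw0.1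
  have h1 := abs_pi_sq_mul_invSqrtEigenvalue_sq_sub_le hβ hp hq hqm hw hab hp0 hw0
  have hv : volume (Ioo a b) ≠ ⊤ := by simp
  have hip : IntegrableOn (fun x => |p x - p0|) (Ioo a b) :=
    ((hp.integrableOn hβ0 hv).sub (integrableOn_const hv)).abs
  have hiw : IntegrableOn (fun x => |w x - w0|) (Ioo a b) :=
    ((hw.integrableOn hβ0 hv).sub (integrableOn_const hv)).abs
  have hsi := (hp.sqrt_div hβ0 hw).integrableOn hβ0 hv
  have hl0 := invSqrtEigenvalue_nonneg p q w a b
  set ηp := ∫ x in Ioo a b, |p x - p0| with hηp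
  set ηw := ∫ x in Ioo a b, |w x - w0| with hηw
  set l := invSqrtEigenvalue p q w a b with hl
  have hηp0 : 0 ≤ ηp := integral_nonneg fun _ => abs_nonneg _
  have hηw0 : 0 ≤ ηw := integral_nonneg fun _ => abs_nonneg _
  have h2 : |(∫ x in Ioo a b, √(w x / p x)) - √(w0 / p0) * (b - a)| ≤ β ^ 4 * (ηp + ηw) := by
    have e : √(w0 / p0) * (b - a) = ∫ _ in Ioo a b, √(w0 / p0) := by
      simp [hab.le, mul_comm]
    rw [e, ← integral_sub hsi (integrableOn_const hv), hηp, hηw, ← integral_add hip hiw,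
      ← integral_const_mul]
    refine abs_integral_le_integral_abs.trans (integral_mono_ae
      (hsi.sub (integrableOn_const hv)).abs ((hip.add hiw).const_mul _) ?_)
    filter_upwards [ae_restrict_of_ae hp.bound, ae_restrict_of_ae hw.bound] with x h1 h2
    exact abs_sqrt_div_sub_le hβ h1 h2 hp0 hw0
  set L := b - a with hL
  have hL0 : 0 < L := sub_pos.mpr hab
  set S := ∫ x in Ioo a b, √(w x / p x) with hS
  have hs : 1 / β ≤ √(w0 / p0) := by
    refine Real.le_sqrt_of_sq_le ?_
    rw [le_div_iff₀ hpp0]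
    calc (1 / β) ^ 2 * p0 ≤ (1 / β) ^ 2 * β := by gcongr; exact hp0.2
      _ = 1 / β := by field_simp
      _ ≤ w0 := hw0.1
  have hsq := Real.sq_sqrt (show 0 ≤ w0 / p0 by positivity)
  set s0 := √(w0 / p0) with hs0
  have h3 : |Real.pi * l - s0 * L| ≤ 15 * β ^ 6 * (ηp + ηw + L ^ 3) := by
    have e : (Real.pi * l - s0 * L) * (Real.pi * l + s0 * L) =
        Real.pi ^ 2 * l ^ 2 - w0 / p0 * L ^ 2 := by rw [← hsq]; ring
    rw [← e, abs_mul] at h1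
    have h4 : 1 / β * L ≤ |Real.pi * l + s0 * L| := by
      rw [abs_of_nonneg (by positivity)]
      have : 1 / β * L ≤ s0 * L := by gcongr
      have : 0 ≤ Real.pi * l := by positivity
      linarith
    have h5 : |Real.pi * l - s0 * L| * (1 / β * L) ≤ 15 * β ^ 5 * L * (ηp + ηw + L ^ 3) :=
      le_trans (by gcongr) h1
    have h6 : 15 * β ^ 5 * L * (ηp + ηw + L ^ 3) =
        15 * β ^ 6 * (ηp + ηw + L ^ 3) * (1 / β * L) := by field_simp
    rw [h6] at h5
    exact le_of_mul_le_mul_right h5 (by positivity)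
  have h4 : |Real.pi * l - S| ≤ 16 * β ^ 6 * (ηp + ηw + L ^ 2) := by
    have e : Real.pi * l - S = (Real.pi * l - s0 * L) - (S - s0 * L) := by ring
    have b46 : β ^ 4 ≤ β ^ 6 := pow_le_pow_right₀ hβ.le (by norm_num)
    have hL3 : L ^ 3 ≤ L ^ 2 := pow_le_pow_of_le_one hL0.le hab1 (by norm_num)
    rw [e]
    calc _ ≤ _ := abs_sub _ _
      _ ≤ 15 * β ^ 6 * (ηp + ηw + L ^ 3) + β ^ 4 * (ηp + ηw) := add_le_add h3 h2
      _ ≤ 15 * β ^ 6 * (ηp + ηw + L ^ 2) + β ^ 6 * (ηp + ηw + L ^ 2) := by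
          have : 0 ≤ L ^ 2 := sq_nonneg L
          exact add_le_add (by gcongr) (mul_le_mul b46 (by linarith) (by positivity) (by positivity))
      _ = _ := by ring
  have e : l - 1 / Real.pi * S = (Real.pi * l - S) / Real.pi := by field_simp
  rw [e, abs_div, abs_of_pos Real.pi_pos]
  exact (div_le_self (abs_nonneg _) (by linarith [Real.pi_gt_three])).trans h4

/-- A crude bound, valid also on long intervals, where the asymptotics says nothing. The sine
quotient gives `l² ≥ L² / (12 β²)`. -/
theorem le_invSqrtEigenvalue (hβ : 1 < β) (hp : IsCoeff β p)
    (hq : ∀ᵐ x, 0 ≤ q x ∧ q x ≤ β) (hqm : AEStronglyMeasurable q volume) (hw : IsCoeff β w)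
    (hab : a ≤ b) (hab1 : b - a ≤ 1) : (b - a) / (5 * β) ≤ invSqrtEigenvalue p q w a b := by
  rcases hab.eq_or_lt with rfl | hab
  · simpa using invSqrtEigenvalue_nonneg p q w a a
  have hβ0 : 0 < β := by linarith
  obtain ⟨N, D, hN, hD, hle, hD1, hD2, hN1, hN2⟩ := exists_firstEigenvalue_le hβ0 hp hq hqm hw hab
  -- Any positive `c` would do: this only ensures `λ > 0`, without which the real inverse of `λ`
  -- would be `0`.
  have hlow := ofReal_inv_le_firstEigenvalue hβ0 hp (hq.mono fun x hx => hx.1) hw hab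
    (c := 1) (by positivity)
  have hG := integral_inv_pos hβ0 hp hab
  have hR0 : 0 ≤ ∫ x in Ioo a b, |w x - 1 / p x| := integral_nonneg fun _ => abs_nonneg _
  obtain ⟨h1, -⟩ := toReal_inv_mem_of_bounds (inv_pos.mpr (by positivity)) hlow hle
  rw [← invSqrtEigenvalue_sq, inv_div, div_le_iff₀ hN] at h1
  set l := invSqrtEigenvalue p q w a b
  have hl0 : 0 ≤ l := invSqrtEigenvalue_nonneg p q w a b
  set L := b - a with hL
  have hL0 : 0 < L := sub_pos.mpr hab
  have hπ : Real.pi ^ 2 ≤ 10 := by nlinarith [Real.pi_lt_d2, Real.pi_pos]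
  have h2 : N ≤ 6 * β / L := by
    refine hN1.trans ?_
    calc (Real.pi / L) ^ 2 * (β * (L / 2)) + β * L
        = (Real.pi ^ 2 / 2 + L ^ 2) * β / L := by field_simp
      _ ≤ (10 / 2 + 1) * β / L := by gcongr; exact pow_le_one₀ hL0.le hab1
      _ = _ := by norm_num
  have h3 : L / 2 / β ≤ l ^ 2 * (6 * β / L) := hD1.trans (h1.trans (by gcongr))
  have h4 : L ^ 2 / (12 * β ^ 2) ≤ l ^ 2 := by
    calc L ^ 2 / (12 * β ^ 2) = L / 2 / β * (L / (6 * β)) := by field_simp; norm_num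
      _ ≤ l ^ 2 * (6 * β / L) * (L / (6 * β)) := by gcongr
      _ = l ^ 2 := by field_simp
  refine abs_le_of_sq_le_sq' ?_ hl0 |>.2
  refine le_trans ?_ h4
  rw [div_pow, mul_pow]
  gcongr
  norm_num

end

/-! ### Additivity over the intervals of a partition -/

theorem sum_succ_sub_castSucc {n : ℕ} (g : Fin (n + 1) → ℝ) :
    ∑ j : Fin n, (g j.succ - g j.castSucc) = g (Fin.last n) - g 0 := by
  induction n with
  | zero => simp
  | succ n ih =>
    rw [Fin.sum_univ_castSucc]
    have := ih fun i => g i.castSucc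
    simp only [Fin.castSucc_zero, ← Fin.succ_castSucc] at this ⊢
    rw [this, Fin.succ_last]
    ring

namespace IntervalPartition

variable {n : ℕ} (P : IntervalPartition n)

theorem left_le_right (j : Fin n) : P.left j ≤ P.right j := P.mono (Fin.castSucc_le_succ j)

theorem left_nonneg (j : Fin n) : 0 ≤ P.left j := (P.pt_mem _).1

theorem right_le_one (j : Fin n) : P.right j ≤ 1 := (P.pt_mem _).2

/-- The length of the interval with index `j`. -/
def len (j : Fin n) : ℝ := P.right j - P.left j

theorem len_nonneg (j : Fin n) : 0 ≤ P.len j := sub_nonneg.mpr (P.left_le_right j)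

theorem len_le_one (j : Fin n) : P.len j ≤ 1 := by
  have := P.left_nonneg j
  have := P.right_le_one j
  rw [len]
  linarith

theorem sum_len : ∑ j, P.len j = 1 := by
  have := sum_succ_sub_castSucc P.pt
  rw [P.pt_last, P.pt_zero, sub_zero] at this
  exact this

theorem measurableSet_interval (j : Fin n) : MeasurableSet (P.interval j) := measurableSet_Ioo

theorem volume_real_interval (j : Fin n) : volume.real (P.interval j) = P.len j :=
  Real.volume_real_Ioo_of_le (P.left_le_right j)

theorem interval_subset (j : Fin n) : P.interval j ⊆ Ioo 0 1 :=
  Ioo_subset_Ioo (P.left_nonneg j) (P.right_le_one j)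

theorem sum_setIntegral {f : ℝ → ℝ} (hf : IntegrableOn f (Ioo 0 1)) :
    ∑ j, ∫ x in P.interval j, f x = ∫ x in Ioo 0 1, f x := by
  have hi : ∀ x ∈ unitInterval, IntervalIntegrable f volume 0 x := by
    intro x hx
    rw [intervalIntegrable_iff_integrableOn_Ioc_of_le hx.1, integrableOn_Ioc_iff_integrableOn_Ioo]
    exact hf.mono_set (Ioo_subset_Ioo_right hx.2)
  have h := sum_succ_sub_castSucc fun i => ∫ x in (0 : ℝ)..P.pt i, f x
  simp only [P.pt_last, P.pt_zero, intervalIntegral.integral_same, sub_zero] at h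
  rw [← setIntegral_Ioo_eq_intervalIntegral _ zero_le_one] at h
  rw [← h]
  refine Finset.sum_congr rfl fun j _ => ?_
  rw [intervalIntegral.integral_interval_sub_left (hi _ (P.pt_mem _)) (hi _ (P.pt_mem _))]
  exact setIntegral_Ioo_eq_intervalIntegral _ (P.left_le_right j)

theorem sum_setIntegral_inter {f : ℝ → ℝ} (hf : IntegrableOn f (Ioo 0 1)) {A : Set ℝ}
    (hA : MeasurableSet A) (hA1 : A ⊆ Ioo 0 1) :
    ∑ j, ∫ x in P.interval j ∩ A, f x = ∫ x in A, f x := by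
  have h := P.sum_setIntegral (f := A.indicator f) (hf.indicator hA)
  simp only [setIntegral_indicator hA] at h
  rwa [inter_eq_right.mpr hA1] at h

theorem sum_setIntegral_le {f : ℝ → ℝ} (hf : IntegrableOn f (Ioo 0 1))
    (hf0 : ∀ x, 0 ≤ f x) (J : Finset (Fin n)) :
    ∑ j ∈ J, ∫ x in P.interval j, f x ≤ ∫ x in Ioo 0 1, f x := by
  rw [← P.sum_setIntegral hf]
  exact Finset.sum_le_sum_of_subset_of_nonneg (Finset.subset_univ J)
    fun j _ _ => integral_nonneg hf0

theorem sum_len_le_one (J : Finset (Fin n)) : ∑ j ∈ J, P.len j ≤ 1 := by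
  rw [← P.sum_len]
  exact Finset.sum_le_sum_of_subset_of_nonneg (Finset.subset_univ J) fun j _ _ => P.len_nonneg j

end IntervalPartition

/-! ### Total oscillation and total eigenvalue error over short intervals -/

/-- The mean oscillation of `f` over `(a, b)`, multiplied by the length of the interval. -/
noncomputable def intervalDeviation (f : ℝ → ℝ) (a b : ℝ) : ℝ :=
  ∫ x in Ioo a b, |f x - (∫ t in Ioo a b, f t) / (b - a)|

theorem intervalDeviation_nonneg (f : ℝ → ℝ) (a b : ℝ) : 0 ≤ intervalDeviation f a b :=
  integral_nonneg fun _ => abs_nonneg _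

/-- The mean of `f` differs from `c` by at most the mean of `|f - c|`, whence the factor `2`. -/
theorem intervalDeviation_le {f : ℝ → ℝ} {a b : ℝ} (hab : a ≤ b) (hf : IntegrableOn f (Ioo a b))
    (c : ℝ) : intervalDeviation f a b ≤ 2 * ∫ x in Ioo a b, |f x - c| := by
  rcases hab.eq_or_lt with rfl | hab'
  · simp [intervalDeviation]
  have hL : 0 < b - a := sub_pos.mpr hab'
  have hv : volume (Ioo a b) ≠ ⊤ := by simp
  have hi : IntegrableOn (fun x => f x - c) (Ioo a b) := hf.sub (integrableOn_const hv)
  set m := (∫ t in Ioo a b, f t) / (b - a) with hm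
  have h1 : (b - a) * |c - m| ≤ ∫ x in Ioo a b, |f x - c| := by
    have e : ∫ x in Ioo a b, (f x - c) = (b - a) * (m - c) := by
      rw [integral_sub hf (integrableOn_const hv), hm]
      simp only [integral_const, measureReal_restrict_apply_univ,
        Real.volume_real_Ioo_of_le hab, smul_eq_mul]
      field_simp
    have e' : (b - a) * |c - m| = |(b - a) * (m - c)| := by
      rw [abs_mul, abs_of_pos hL, abs_sub_comm]
    rw [e', ← e]
    exact abs_integral_le_integral_abs
  have h2 : intervalDeviation f a b ≤ ∫ x in Ioo a b, (|f x - c| + |c - m|) := by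
    refine integral_mono (hf.sub (integrableOn_const hv)).abs
      (hi.abs.add (integrableOn_const hv)) fun x => ?_
    have : f x - m = (f x - c) + (c - m) := by ring
    exact (congrArg abs this).le.trans (abs_add_le _ _)
  rw [integral_add hi.abs (integrableOn_const hv)] at h2
  simp only [integral_const, measureReal_restrict_apply_univ,
        Real.volume_real_Ioo_of_le hab, smul_eq_mul] at h2
  linarith

/-- The mean oscillations of an integrable function over the short intervals of a partition are small
in total. -/
theorem exists_sum_intervalDeviation_le {f : ℝ → ℝ} (hf : IntegrableOn f (Ioo 0 1)) {ε : ℝ}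
    (hε : 0 < ε) : ∃ δ > 0, ∀ (n : ℕ) (P : IntervalPartition n) (J : Finset (Fin n)),
      (∀ j ∈ J, P.len j ≤ δ) → ∑ j ∈ J, intervalDeviation f (P.left j) (P.right j) ≤ ε := by
  have hf' : Integrable ((Ioo (0 : ℝ) 1).indicator f) := (integrable_indicator_iff measurableSet_Ioo).mpr hf
  obtain ⟨g, -, hg1, hgc, hgi⟩ :=
    hf'.exists_hasCompactSupport_integral_sub_le (show 0 < ε / 4 by positivity)
  have hg2 : ∫ x in Ioo 0 1, |f x - g x| ≤ ε / 4 := by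
    refine le_trans ?_ hg1
    have : ∫ x in Ioo (0 : ℝ) 1, |f x - g x| =
        ∫ x in Ioo (0 : ℝ) 1, ‖(Ioo (0 : ℝ) 1).indicator f x - g x‖ :=
      setIntegral_congr_fun measurableSet_Ioo fun x hx => by
        simp only [indicator_of_mem hx, Real.norm_eq_abs]
    rw [this]
    exact setIntegral_le_integral (hf'.sub hgi).norm (Eventually.of_forall fun _ => norm_nonneg _)
  have huc := isCompact_Icc.uniformContinuousOn_of_continuous (s := Icc (0 : ℝ) 1) hgc.continuousOn
  rw [Metric.uniformContinuousOn_iff] at huc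
  obtain ⟨δ, hδ, hδ'⟩ := huc (ε / 4) (by positivity)
  -- Halving `δ` gives the strict inequality of uniform continuity. The `L¹` error of `g` and its
  -- oscillation then account for `ε / 2` each.
  refine ⟨δ / 2, by positivity, fun n P J hJ => ?_⟩
  have hi1 : IntegrableOn (fun x => |f x - g x|) (Ioo 0 1) :=
    (hf.sub hgi.integrableOn).abs
  have hosc : ∀ j ∈ J, intervalDeviation f (P.left j) (P.right j) ≤
      2 * (∫ x in P.interval j, |f x - g x|) + ε / 2 * P.len j := by
    intro j hj
    have hv : volume (P.interval j) ≠ ⊤ := by simp [IntervalPartition.interval]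
    refine (intervalDeviation_le (P.left_le_right j) (hf.mono_set (P.interval_subset j))
      (g (P.left j))).trans ?_
    have h1 : ∫ x in P.interval j, |f x - g (P.left j)| ≤
        ∫ x in P.interval j, (|f x - g x| + ε / 4) := by
      refine setIntegral_mono_on ((hf.mono_set (P.interval_subset j)).sub (integrableOn_const hv)).abs
        ((hi1.mono_set (P.interval_subset j)).add (integrableOn_const hv))
        (P.measurableSet_interval j) fun x hx => ?_
      have h2 : dist (g x) (g (P.left j)) < ε / 4 := by
        refine hδ' x (Ioo_subset_Icc_self (P.interval_subset j hx)) _ (P.pt_mem _) ?_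
        have := hJ j hj
        rw [IntervalPartition.len] at this
        rw [Real.dist_eq, abs_of_pos (sub_pos.mpr hx.1)]
        linarith [hx.2]
      rw [Real.dist_eq] at h2
      have : f x - g (P.left j) = (f x - g x) + (g x - g (P.left j)) := by ring
      rw [this]
      exact (abs_add_le _ _).trans (by linarith)
    rw [integral_add (hi1.mono_set (P.interval_subset j)) (integrableOn_const hv)] at h1
    simp only [integral_const, measureReal_restrict_apply_univ, smul_eq_mul,
      P.volume_real_interval j] at h1
    change 2 * ∫ x in P.interval j, |f x - g (P.left j)| ≤ _
    linarith
  calc _ ≤ ∑ j ∈ J, (2 * (∫ x in P.interval j, |f x - g x|) + ε / 2 * P.len j) :=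
        Finset.sum_le_sum hosc
    _ = 2 * ∑ j ∈ J, (∫ x in P.interval j, |f x - g x|) + ε / 2 * ∑ j ∈ J, P.len j := by
        rw [Finset.sum_add_distrib, Finset.mul_sum, Finset.mul_sum]
    _ ≤ 2 * (ε / 4) + ε / 2 * 1 := by
        gcongr
        · exact (P.sum_setIntegral_le hi1 (fun _ => abs_nonneg _) J).trans hg2
        · exact P.sum_len_le_one J
    _ = ε := by ring

/-- The quantities `λ(I_j)^{-1/2}` over the short intervals of a partition are close to
`(1 / π) ∫_{I_j} √(w / p)` in total. -/
theorem exists_sum_abs_invSqrtEigenvalue_sub_le {β : ℝ} {p q w : ℝ → ℝ} (hβ : 1 < β)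
    (hp : IsCoeff β p) (hq : ∀ᵐ x, 0 ≤ q x ∧ q x ≤ β) (hqm : AEStronglyMeasurable q volume)
    (hw : IsCoeff β w) {ε : ℝ} (hε : 0 < ε) :
    ∃ δ > 0, ∀ (n : ℕ) (P : IntervalPartition n) (J : Finset (Fin n)),
      (∀ j ∈ J, P.len j ≤ δ) → ∑ j ∈ J, |invSqrtEigenvalue p q w (P.left j) (P.right j) -
        1 / Real.pi * ∫ x in P.interval j, √(w x / p x)| ≤ ε := by
  have hβ0 : 0 < β := by linarith
  have hv : volume (Ioo (0 : ℝ) 1) ≠ ⊤ := by simp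
  set C := 16 * β ^ 6 with hC
  have hC0 : 0 < C := by positivity
  obtain ⟨δ1, hδ1, h1⟩ := exists_sum_intervalDeviation_le (hp.integrableOn hβ0 hv)
    (show 0 < ε / (3 * C) by positivity)
  obtain ⟨δ2, hδ2, h2⟩ := exists_sum_intervalDeviation_le (hw.integrableOn hβ0 hv)
    (show 0 < ε / (3 * C) by positivity)
  refine ⟨min (min δ1 δ2) (ε / (3 * C)), by positivity, fun n P J hJ => ?_⟩
  have hterm : ∀ j ∈ J, |invSqrtEigenvalue p q w (P.left j) (P.right j) -
        1 / Real.pi * ∫ x in P.interval j, √(w x / p x)| ≤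
      C * (intervalDeviation p (P.left j) (P.right j) + intervalDeviation w (P.left j) (P.right j) +
        ε / (3 * C) * P.len j) := by
    intro j hj
    rcases (P.left_le_right j).eq_or_lt with h | h
    · have hI : P.interval j = ∅ := by rw [IntervalPartition.interval, h, Ioo_self]
      rw [hI, invSqrtEigenvalue_of_le p q w h.ge]
      simp only [Measure.restrict_empty, integral_zero_measure, mul_zero, sub_zero, abs_zero]
      have := intervalDeviation_nonneg p (P.left j) (P.right j)
      have := intervalDeviation_nonneg w (P.left j) (P.right j)
      have := P.len_nonneg j
      positivity
    · have hLpos : 0 < P.right j - P.left j := sub_pos.mpr h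
      -- The means of `p` and `w` over the interval respect the bounds of the coefficients, so they
      -- may serve as frozen values `p0` and `w0`.
      have hmean : ∀ f : ℝ → ℝ, IsCoeff β f →
          1 / β ≤ (∫ t in Ioo (P.left j) (P.right j), f t) / (P.right j - P.left j) ∧
          (∫ t in Ioo (P.left j) (P.right j), f t) / (P.right j - P.left j) ≤ β := by
        intro f hf
        have e1 := hf.le_setIntegral hβ0 (A := Ioo (P.left j) (P.right j)) (by simp)
        have e2 := hf.setIntegral_le hβ0 (A := Ioo (P.left j) (P.right j)) (by simp)
        rw [Real.volume_real_Ioo_of_le h.le] at e1 e2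
        rw [le_div_iff₀ hLpos, div_le_iff₀ hLpos, one_div_mul_eq_div]
        exact ⟨e1, e2⟩
      have key := abs_invSqrtEigenvalue_sub_le hβ hp hq hqm hw h (P.len_le_one j)
        (hmean p hp) (hmean w hw)
      refine key.trans ?_
      -- The squared lengths sum to at most the maximal length, since the lengths add up to at most
      -- `1`.
      have hsq : (P.right j - P.left j) ^ 2 ≤ ε / (3 * C) * P.len j := by
        have h3 : P.len j ≤ ε / (3 * C) := (hJ j hj).trans (min_le_right _ _)
        have := mul_le_mul_of_nonneg_right h3 (P.len_nonneg j)
        rwa [← sq] at this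
      rw [← hC]
      refine mul_le_mul_of_nonneg_left ?_ hC0.le
      exact add_le_add le_rfl hsq
  calc _ ≤ _ := Finset.sum_le_sum hterm
    _ = C * (∑ j ∈ J, intervalDeviation p (P.left j) (P.right j) +
          ∑ j ∈ J, intervalDeviation w (P.left j) (P.right j) + ε / (3 * C) * ∑ j ∈ J, P.len j) := by
        rw [← Finset.mul_sum, Finset.sum_add_distrib, Finset.sum_add_distrib, Finset.mul_sum]
    _ ≤ C * (ε / (3 * C) + ε / (3 * C) + ε / (3 * C) * 1) := by
        gcongr
        · exact h1 n P J fun j hj => (hJ j hj).trans ((min_le_left _ _).trans (min_le_left _ _))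
        · exact h2 n P J fun j hj => (hJ j hj).trans ((min_le_left _ _).trans (min_le_right _ _))
        · exact P.sum_len_le_one J
    _ = ε := by field_simp; ring

/-! ### Strict convexity: supporting lines, quantified gap and growth -/

section Convex

variable {φ : ℝ≥0 → ℝ≥0∞}

/-- `t` is the midpoint of `t / 2` and `3 t / 2`, and a strict inequality in `[0, ∞]` makes its left
side finite. Only at `0` may `φ` be infinite. -/
theorem StrictConvexOn.ne_top_of_pos (hφ : StrictConvexOn ℝ≥0 univ φ) {t : ℝ≥0} (ht : 0 < t) :
    φ t ≠ ⊤ := by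
  have hne : (2⁻¹ * t : ℝ≥0) ≠ (3 / 2) * t := by
    intro h
    have := mul_right_cancel₀ ht.ne' h
    have := congrArg NNReal.toReal this
    push_cast at this
    norm_num at this
  have h := hφ.2 (mem_univ (2⁻¹ * t)) (mem_univ ((3 / 2) * t)) hne
    (show (0 : ℝ≥0) < 2⁻¹ by positivity) (show (0 : ℝ≥0) < 2⁻¹ by positivity)
    (by rw [← NNReal.coe_inj]; push_cast; norm_num)
  have e : (2⁻¹ : ℝ≥0) • (2⁻¹ * t) + (2⁻¹ : ℝ≥0) • ((3 / 2) * t) = t := by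
    rw [← NNReal.coe_inj]; simp only [smul_eq_mul]; push_cast; ring
  rw [e] at h
  exact h.ne_top

/-- The real part of a strictly convex function on its domain of finiteness. -/
theorem StrictConvexOn.toReal (hφ : StrictConvexOn ℝ≥0 univ φ) :
    StrictConvexOn ℝ {t : ℝ | 0 ≤ t ∧ φ t.toNNReal ≠ ⊤} fun t => (φ t.toNNReal).toReal := by
  have hpos : ∀ t : ℝ, 0 < t → t ∈ {t : ℝ | 0 ≤ t ∧ φ t.toNNReal ≠ ⊤} := fun t ht =>
    ⟨ht.le, hφ.ne_top_of_pos (Real.toNNReal_pos.mpr ht)⟩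
  refine ⟨?_, ?_⟩
  · rw [convex_iff_forall_pos]
    intro x hx y hy a b ha hb hab
    rcases hx.1.eq_or_lt with h | h
    · rcases hy.1.eq_or_lt with h' | h'
      · rw [← h, ← h', smul_zero, smul_zero, add_zero]
        exact ⟨le_rfl, h ▸ hx.2⟩
      · refine hpos _ ?_
        rw [← h, smul_zero, zero_add]
        exact mul_pos hb h'
    · exact hpos _ (add_pos_of_pos_of_nonneg (mul_pos ha h) (mul_nonneg hb.le hy.1))
  · intro x hx y hy hxy a b ha hb hab
    have hne : x.toNNReal ≠ y.toNNReal := fun h => hxy ((Real.toNNReal_eq_toNNReal_iff hx.1 hy.1).mp h)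
    have h := hφ.2 (mem_univ x.toNNReal) (mem_univ y.toNNReal) hne
      (show (0 : ℝ≥0) < a.toNNReal from Real.toNNReal_pos.mpr ha)
      (show (0 : ℝ≥0) < b.toNNReal from Real.toNNReal_pos.mpr hb)
      (by rw [← Real.toNNReal_add ha.le hb.le, hab, Real.toNNReal_one])
    have e : a.toNNReal • x.toNNReal + b.toNNReal • y.toNNReal = (a • x + b • y).toNNReal := by
      simp only [smul_eq_mul]
      rw [Real.toNNReal_add (mul_nonneg ha.le hx.1) (mul_nonneg hb.le hy.1),
        Real.toNNReal_mul ha.le, Real.toNNReal_mul hb.le]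
    rw [e] at h
    have h1 : a.toNNReal • φ x.toNNReal ≠ ⊤ := by
      rw [ENNReal.smul_def, smul_eq_mul]
      exact ENNReal.mul_ne_top ENNReal.coe_ne_top hx.2
    have h2 : b.toNNReal • φ y.toNNReal ≠ ⊤ := by
      rw [ENNReal.smul_def, smul_eq_mul]
      exact ENNReal.mul_ne_top ENNReal.coe_ne_top hy.2
    have h3 := (ENNReal.toReal_lt_toReal h.ne_top (ENNReal.add_ne_top.mpr ⟨h1, h2⟩)).mpr h
    rw [ENNReal.toReal_add h1 h2] at h3
    simp only [ENNReal.smul_def] at h3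
    rw [smul_eq_mul (_ : ℝ≥0∞), smul_eq_mul (_ : ℝ≥0∞), ENNReal.toReal_mul, ENNReal.toReal_mul, ENNReal.coe_toReal, ENNReal.coe_toReal,
      Real.coe_toNNReal _ ha.le, Real.coe_toNNReal _ hb.le] at h3
    exact h3

end Convex

/-- A convex function lies above its supporting lines. -/
theorem ConvexOn.exists_add_mul_sub_le {D : Set ℝ} {f : ℝ → ℝ} (hf : ConvexOn ℝ D f) {T : ℝ}
    (hT : T ∈ interior D) : ∃ m : ℝ, ∀ t ∈ D, f T + m * (t - T) ≤ f t := by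
  refine ⟨derivWithin f (Ioi T) T, fun t ht => ?_⟩
  rcases lt_trichotomy t T with h | rfl | h
  · have h1 := (hf.slope_le_leftDeriv_of_mem_interior ht hT h).trans
      (hf.leftDeriv_le_rightDeriv_of_mem_interior hT)
    rw [slope_def_field, div_le_iff₀ (sub_pos.mpr h)] at h1
    linarith
  · simp
  · have h1 := hf.rightDeriv_le_slope_of_mem_interior hT ht h
    rw [slope_def_field, le_div_iff₀ (sub_pos.mpr h)] at h1
    linarith

/-- Strict convexity makes `g` positive at `T ± d` for a small `d ≤ ε`, and convexity along segments
from `T` continues this as linear growth. Within distance `d` of `T` the left side is not positive,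
so `g ≥ 0` suffices. -/
theorem StrictConvexOn.exists_mul_abs_le {D : Set ℝ} {g : ℝ → ℝ} (hg : StrictConvexOn ℝ D g)
    {T : ℝ} (hT : T ∈ interior D) (hgT : g T = 0) (hg0 : ∀ t ∈ D, 0 ≤ g t) {ε : ℝ} (hε : 0 < ε) :
    ∃ c > 0, ∀ t ∈ D, c * (|t - T| - ε) ≤ g t := by
  rw [mem_interior_iff_mem_nhds, Metric.mem_nhds_iff] at hT
  obtain ⟨r, hr, hrD⟩ := hT
  set d := min (r / 2) ε with hd
  have hd0 : 0 < d := by positivity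
  have hdε : d ≤ ε := min_le_right _ _
  have hdr : d < r := (min_le_left _ _).trans_lt (by linarith)
  have hTD : T ∈ D := hrD (Metric.mem_ball_self hr)
  have hmem : ∀ x, |x| ≤ d → T + x ∈ D := fun x hx => hrD (by
    rw [Metric.mem_ball, Real.dist_eq, add_sub_cancel_left]; linarith)
  have hposx : ∀ x, |x| = d → 0 < g (T + x) := by
    intro x hx
    have hx0 : x ≠ 0 := by rintro rfl; simp at hx; linarith
    have h := hg.2 hTD (hmem x hx.le) (by simpa using hx0) (show (0 : ℝ) < 1 / 2 by norm_num)
      (show (0 : ℝ) < 1 / 2 by norm_num) (by norm_num)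
    have e : (1 / 2 : ℝ) • T + (1 / 2 : ℝ) • (T + x) = T + x / 2 := by
      simp only [smul_eq_mul]; ring
    rw [e, hgT] at h
    have h2 := hg0 (T + x / 2) (hmem _ (by rw [abs_div]; norm_num; linarith))
    simp only [smul_eq_mul] at h
    linarith
  set c := min (g (T + d)) (g (T + -d)) / d with hc
  have hc0 : 0 < c := div_pos (lt_min (hposx d (abs_of_pos hd0))
    (hposx (-d) (by rw [abs_neg, abs_of_pos hd0]))) hd0
  refine ⟨c, hc0, fun t ht => ?_⟩
  rcases le_or_gt |t - T| d with h | h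
  · exact (mul_nonpos_of_nonneg_of_nonpos hc0.le (by linarith)).trans (hg0 t ht)
  · have htT : 0 < |t - T| := hd0.trans h
    set x := d / |t - T| * (t - T) with hx
    have hxd : |x| = d := by
      rw [hx, abs_mul, abs_of_pos (by positivity)]; field_simp
    have hconv := hg.convexOn.2 hTD ht (show 0 ≤ 1 - d / |t - T| by
      rw [sub_nonneg, div_le_one htT]; exact h.le) (show 0 ≤ d / |t - T| by positivity) (by ring)
    have e : (1 - d / |t - T|) • T + (d / |t - T|) • t = T + x := by
      simp only [smul_eq_mul, hx]; ring
    rw [e, hgT, smul_zero, zero_add, smul_eq_mul] at hconv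
    have h1 : c * d ≤ g (T + x) := by
      rw [hc, div_mul_cancel₀ _ hd0.ne']
      rcases (abs_eq hd0.le).mp hxd with h | h
      · rw [h]; exact min_le_left _ _
      · rw [h]; exact min_le_right _ _
    have h2 : c * |t - T| ≤ g t := by
      have h3 : c * d ≤ d * g t / |t - T| := by
        rw [← div_mul_eq_mul_div]; exact h1.trans hconv
      rw [le_div_iff₀ htT] at h3
      have : d * (c * |t - T|) ≤ d * g t := by linarith
      exact le_of_mul_le_mul_left this hd0
    have : 0 ≤ c * ε := by positivity
    linarith

/-- A convex function grows at most linearly away from an interior point of an interval. -/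
theorem ConvexOn.exists_le_add_mul_abs {D : Set ℝ} {f : ℝ → ℝ} (hf : ConvexOn ℝ D f) {c T C : ℝ}
    (hc : c ∈ D) (hC : C ∈ D) (hcT : c < T) (hTC : T < C) :
    ∃ K, 0 ≤ K ∧ ∀ t ∈ Icc c C, f t ≤ f T + K * |t - T| := by
  have hTD : T ∈ D := hf.1.ordConnected.out hc hC ⟨hcT.le, hTC.le⟩
  refine ⟨max (|f c - f T| / (T - c)) (|f C - f T| / (C - T)),
    le_max_of_le_left (div_nonneg (abs_nonneg _) (by linarith)), fun t ht => ?_⟩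
  -- On the segment from `T` to an end point `d`, the graph lies below its chord.
  have key : ∀ d ∈ D, d ≠ T → ∀ x : ℝ, 0 ≤ x → x ≤ 1 →
      f (T + x * (d - T)) ≤ f T + |f d - f T| / |d - T| * |x * (d - T)| := by
    intro d hd hdT x hx0 hx1
    have h := hf.2 hTD hd (sub_nonneg.mpr hx1) hx0 (by ring)
    simp only [smul_eq_mul] at h
    have e : (1 - x) * T + x * d = T + x * (d - T) := by ring
    rw [e] at h
    have hd0 : 0 < |d - T| := abs_pos.mpr (sub_ne_zero.mpr hdT)
    have e2 : |f d - f T| / |d - T| * |x * (d - T)| = x * |f d - f T| := by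
      rw [abs_mul, abs_of_nonneg hx0]; field_simp
    rw [e2]
    have := mul_le_mul_of_nonneg_left (le_abs_self (f d - f T)) hx0
    linarith
  rcases le_total t T with h | h
  · have h1 := key c hc hcT.ne ((T - t) / (T - c)) (div_nonneg (by linarith) (by linarith))
      ((div_le_one (by linarith)).mpr (by linarith [ht.1]))
    have e : (T - t) / (T - c) * (c - T) = t - T := by
      have : T - c ≠ 0 := by linarith
      field_simp
      ring
    rw [e, add_sub_cancel, abs_of_neg (sub_neg.mpr hcT), neg_sub] at h1
    refine h1.trans ?_
    gcongr
    exact le_max_left _ _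
  · have h1 := key C hC hTC.ne' ((t - T) / (C - T)) (div_nonneg (by linarith) (by linarith))
      ((div_le_one (by linarith)).mpr (by linarith [ht.2]))
    have e : (t - T) / (C - T) * (C - T) = t - T := by
      have : C - T ≠ 0 := by linarith
      field_simp
    rw [e, add_sub_cancel, abs_of_pos (sub_pos.mpr hTC)] at h1
    refine h1.trans ?_
    gcongr
    exact le_max_right _ _

section Growth

variable {φ : ℝ≥0 → ℝ≥0∞}

/-- Supporting lines of strictly convex functions, with a quantified gap away from the point of
contact. -/
theorem StrictConvexOn.exists_support (hφ : StrictConvexOn ℝ≥0 univ φ) {T : ℝ} (hT : 0 < T) :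
    ∃ m : ℝ, (∀ t : ℝ≥0, φ t ≠ ⊤ → (φ T.toNNReal).toReal + m * (t - T) ≤ (φ t).toReal) ∧
      ∀ ε > 0, ∃ c > 0, ∀ t : ℝ≥0, φ t ≠ ⊤ →
        (φ T.toNNReal).toReal + m * (t - T) + c * (|(t : ℝ) - T| - ε) ≤ (φ t).toReal := by
  have hf := hφ.toReal
  set D := {t : ℝ | 0 ≤ t ∧ φ t.toNNReal ≠ ⊤} with hD
  have hTi : T ∈ interior D := by
    rw [mem_interior_iff_mem_nhds]
    filter_upwards [Ioi_mem_nhds hT] with t ht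
    exact ⟨le_of_lt ht, hφ.ne_top_of_pos (Real.toNNReal_pos.mpr ht)⟩
  obtain ⟨m, hm⟩ := hf.convexOn.exists_add_mul_sub_le hTi
  have hcoe : ∀ t : ℝ≥0, φ t ≠ ⊤ → (t : ℝ) ∈ D := fun t ht =>
    ⟨t.2, by rwa [Real.toNNReal_coe]⟩
  refine ⟨m, fun t ht => ?_, fun ε hε => ?_⟩
  · simpa using hm t (hcoe t ht)
  -- Subtracting the supporting line leaves a nonnegative strictly convex function that vanishes at
  -- `T`.
  · have hg : StrictConvexOn ℝ D fun t => (φ t.toNNReal).toReal +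
        (-m * t + (m * T - (φ T.toNNReal).toReal)) := by
      refine hf.add_convexOn ⟨hf.1, fun x _ y _ a b _ _ hab => ?_⟩
      simp only [smul_eq_mul]
      have : b = 1 - a := by linarith
      subst this
      linarith
    obtain ⟨c, hc, h⟩ := hg.exists_mul_abs_le hTi (by ring) (fun t ht => by
      have := hm t ht; linarith) hε
    refine ⟨c, hc, fun t ht => ?_⟩
    have := h t (hcoe t ht)
    simp only [Real.toNNReal_coe] at this
    linarith

theorem eventually_ne_top_of_strictConvexOn (hφ : StrictConvexOn ℝ≥0 univ φ) :
    ∀ᶠ t : ℝ≥0 in atTop, 0 < t ∧ φ t ≠ ⊤ := by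
  filter_upwards [eventually_gt_atTop 0] with t ht
  exact ⟨ht, hφ.ne_top_of_pos ht⟩

/-- The slope of a supporting line of a sublinear function is not positive. -/
theorem slope_nonpos_of_tendsto_div_zero (hφ : StrictConvexOn ℝ≥0 univ φ)
    (h : Tendsto (fun t : ℝ≥0 => φ t / (t : ℝ≥0∞)) atTop (𝓝 0)) {k m : ℝ}
    (hm : ∀ t : ℝ≥0, φ t ≠ ⊤ → k + m * t ≤ (φ t).toReal) : m ≤ 0 := by
  by_contra hm0
  rw [not_le] at hm0
  have h1 : ∀ᶠ t : ℝ≥0 in atTop, φ t / (t : ℝ≥0∞) ≤ ENNReal.ofReal (m / 2) :=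
    (h.eventually_lt_const (ENNReal.ofReal_pos.mpr (half_pos hm0))).mono fun t ht => ht.le
  have h2 : ∀ᶠ t : ℝ≥0 in atTop, (2 * |k| / m + 1) ≤ (t : ℝ) :=
    (NNReal.tendsto_coe_atTop.mpr tendsto_id).eventually_ge_atTop _
  obtain ⟨t, ⟨ht0, htop⟩, ht1, ht2⟩ :=
    ((eventually_ne_top_of_strictConvexOn hφ).and (h1.and h2)).exists
  have e1 : φ t ≤ ENNReal.ofReal (m / 2) * t :=
    (ENNReal.div_le_iff (by simpa using ht0.ne') ENNReal.coe_ne_top).mp ht1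
  have e2 : (φ t).toReal ≤ m / 2 * t := by
    have := ENNReal.toReal_mono (ENNReal.mul_ne_top ENNReal.ofReal_ne_top ENNReal.coe_ne_top) e1
    rwa [ENNReal.toReal_mul, ENNReal.toReal_ofReal (by positivity), ENNReal.coe_toReal] at this
  have e3 := hm t htop
  have e4 : m * (2 * |k| / m + 1) ≤ m * t := by gcongr
  have e5 : m * (2 * |k| / m + 1) = 2 * |k| + m := by field_simp
  have := neg_abs_le k
  linarith

theorem eventually_mul_le_of_tendsto_div_top (hφ : StrictConvexOn ℝ≥0 univ φ)
    (h : Tendsto (fun t : ℝ≥0 => φ t / (t : ℝ≥0∞)) atTop (𝓝 ⊤)) (K : ℝ) :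
    ∃ M : ℝ, ∀ t : ℝ≥0, M ≤ t → K * t ≤ (φ t).toReal := by
  have h1 : ∀ᶠ t : ℝ≥0 in atTop, ENNReal.ofReal K ≤ φ t / (t : ℝ≥0∞) :=
    (h.eventually_const_lt ENNReal.ofReal_lt_top).mono fun t ht => ht.le
  obtain ⟨M, hM⟩ := eventually_atTop.mp (h1.and (eventually_ne_top_of_strictConvexOn hφ))
  refine ⟨M, fun t ht => ?_⟩
  obtain ⟨ht1, ht0, htop⟩ := hM t (by exact_mod_cast ht)
  have e1 := (ENNReal.le_div_iff_mul_le (Or.inl (by simpa using ht0.ne'))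
    (Or.inl ENNReal.coe_ne_top)).mp ht1
  have e2 := ENNReal.toReal_mono htop e1
  rw [ENNReal.toReal_mul, ENNReal.coe_toReal] at e2
  refine le_trans ?_ e2
  gcongr
  rw [ENNReal.toReal_ofReal']
  exact le_max_left _ _

end Growth

/-! ### Uniform bounds for admissible coefficients -/

/-- Coefficients satisfying the uniform bounds of a regular Sturm-Liouville problem. -/
structure IsAdmissible (β : ℝ) (p q w : ℝ → ℝ) : Prop where
  one_lt : 1 < β
  coeff_p : IsCoeff β p
  bound_q : ∀ᵐ x, 0 ≤ q x ∧ q x ≤ β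
  meas_q : AEStronglyMeasurable q volume
  coeff_w : IsCoeff β w

namespace IsAdmissible

variable {β : ℝ} {p q w : ℝ → ℝ}

theorem pos (h : IsAdmissible β p q w) : 0 < β := zero_lt_one.trans h.one_lt

theorem coeff_sqrt (h : IsAdmissible β p q w) : IsCoeff β fun x => √(w x / p x) :=
  h.coeff_p.sqrt_div h.pos h.coeff_w

theorem integrableOn_sqrt (h : IsAdmissible β p q w) :
    IntegrableOn (fun x => √(w x / p x)) (Ioo 0 1) := h.coeff_sqrt.integrableOn h.pos (by simp)

theorem integral_sqrt_pos (h : IsAdmissible β p q w) : 0 < ∫ x in Ioo 0 1, √(w x / p x) := by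
  have h1 := h.coeff_sqrt.le_setIntegral h.pos (A := Ioo (0 : ℝ) 1) (by simp)
  have : 0 < volume.real (Ioo (0 : ℝ) 1) / β := by simpa using h.pos
  linarith

theorem len_div_le (h : IsAdmissible β p q w) {n : ℕ} (P : IntervalPartition n) (j : Fin n) :
    P.len j / β ≤ ∫ x in P.interval j, √(w x / p x) := by
  have := h.coeff_sqrt.le_setIntegral h.pos (A := P.interval j) (by simp [IntervalPartition.interval])
  rwa [P.volume_real_interval] at this

theorem setIntegral_le (h : IsAdmissible β p q w) {n : ℕ} (P : IntervalPartition n) (j : Fin n) :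
    ∫ x in P.interval j, √(w x / p x) ≤ β * P.len j := by
  have := h.coeff_sqrt.setIntegral_le h.pos (A := P.interval j) (by simp [IntervalPartition.interval])
  rwa [P.volume_real_interval] at this

/-- The frozen values `p0 = w0 = 1` are admissible because `β > 1`. The constant is `49 = 16 * 3 +
1`, from the three error terms and the main term. -/
theorem invSqrtEigenvalue_le (h : IsAdmissible β p q w) {a b : ℝ} (hab : a ≤ b)
    (hab1 : b - a ≤ 1) : invSqrtEigenvalue p q w a b ≤ 49 * β ^ 7 * (b - a) := by
  rcases hab.eq_or_lt with rfl | hab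
  · simp [invSqrtEigenvalue_of_le]
  have hβ := h.one_lt
  have hβ0 := h.pos
  have hv : volume (Ioo a b) ≠ ⊤ := by simp
  have h1 : 1 / β ≤ 1 ∧ (1 : ℝ) ≤ β := ⟨(div_le_one hβ0).mpr hβ.le, hβ.le⟩
  have key := abs_invSqrtEigenvalue_sub_le hβ h.coeff_p h.bound_q h.meas_q h.coeff_w hab hab1 h1 h1
  have hf : ∀ f, IsCoeff β f → ∫ x in Ioo a b, |f x - 1| ≤ β * (b - a) := by
    intro f hf
    have e : ∫ x in Ioo a b, |f x - 1| ≤ ∫ _ in Ioo a b, β := by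
      refine integral_mono_ae ((hf.integrableOn hβ0 hv).sub (integrableOn_const hv)).abs
        (integrableOn_const hv) ?_
      filter_upwards [ae_restrict_of_ae hf.bound] with x hx
      have := one_div_pos.mpr hβ0
      exact abs_le.mpr ⟨by linarith [hx.1], by linarith [hx.2]⟩
    simpa [hab.le, mul_comm] using e
  have hp := hf p h.coeff_p
  have hw := hf w h.coeff_w
  have hs := h.coeff_sqrt.setIntegral_le hβ0 hv
  have hs0 : 0 ≤ ∫ x in Ioo a b, √(w x / p x) := integral_nonneg fun _ => Real.sqrt_nonneg _
  rw [Real.volume_real_Ioo_of_le hab.le] at hs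
  have hL : 0 < b - a := sub_pos.mpr hab
  have hsq : (b - a) ^ 2 ≤ β * (b - a) := by rw [sq]; gcongr; linarith
  have hπ : 1 / Real.pi * (∫ x in Ioo a b, √(w x / p x)) ≤ β * (b - a) := by
    have : 1 / Real.pi ≤ 1 := (div_le_one Real.pi_pos).mpr (by linarith [Real.pi_gt_three])
    exact (mul_le_of_le_one_left hs0 this).trans hs
  have b17 : β ≤ β ^ 7 := by simpa using pow_le_pow_right₀ hβ.le (show 1 ≤ 7 by norm_num)
  calc invSqrtEigenvalue p q w a b
      ≤ 16 * β ^ 6 * (β * (b - a) + β * (b - a) + β * (b - a)) + β * (b - a) := by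
        have h3 : 16 * β ^ 6 * ((∫ x in Ioo a b, |p x - 1|) + (∫ x in Ioo a b, |w x - 1|) +
          (b - a) ^ 2) ≤ 16 * β ^ 6 * (β * (b - a) + β * (b - a) + β * (b - a)) := by gcongr
        linarith [le_abs_self (invSqrtEigenvalue p q w a b -
          1 / Real.pi * ∫ x in Ioo a b, √(w x / p x))]
    _ = 48 * β ^ 7 * (b - a) + β * (b - a) := by ring
    _ ≤ 48 * β ^ 7 * (b - a) + β ^ 7 * (b - a) := by gcongr
    _ = _ := by ring

end IsAdmissible

/-! ### Cost of a partition and the upper bound for the infimum -/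

namespace IntervalPartition

/-- The argument of `φ` in the cost of a partition. -/
noncomputable def costArg (p q w : ℝ → ℝ) {n : ℕ} (P : IntervalPartition n) (j : Fin n) : ℝ≥0 :=
  ((n : ℝ≥0∞) / firstEigenvalue p q w (P.interval j) ^ (1 / 2 : ℝ)).toNNReal

variable {p q w : ℝ → ℝ} {φ : ℝ≥0 → ℝ≥0∞} {n : ℕ} (P : IntervalPartition n)

theorem coe_costArg (j : Fin n) :
    (P.costArg p q w j : ℝ) = n * invSqrtEigenvalue p q w (P.left j) (P.right j) :=
  toNNReal_div_sqrt_eigenvalue p q w (P.left j) (P.right j) n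

theorem cost_eq : P.cost p q w φ = (n : ℝ≥0∞)⁻¹ * ∑ j, φ (P.costArg p q w j) := rfl

theorem ne_top_of_cost_ne_top (h : P.cost p q w φ ≠ ⊤) (j : Fin n) :
    φ (P.costArg p q w j) ≠ ⊤ := by
  intro htop
  refine h ?_
  have : ∑ j, φ (P.costArg p q w j) = ⊤ := ENNReal.sum_eq_top.mpr ⟨j, Finset.mem_univ j, htop⟩
  rw [cost_eq, this, ENNReal.mul_top]
  simp

theorem toReal_cost (h : ∀ j, φ (P.costArg p q w j) ≠ ⊤) :
    (P.cost p q w φ).toReal = (n : ℝ)⁻¹ * ∑ j, (φ (P.costArg p q w j)).toReal := by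
  rw [cost_eq, ENNReal.toReal_mul, ENNReal.toReal_sum fun j _ => h j, ENNReal.toReal_inv,
    ENNReal.toReal_natCast]

theorem cost_ne_top (h : ∀ j, φ (P.costArg p q w j) ≠ ⊤) : P.cost p q w φ ≠ ⊤ := by
  rw [cost_eq]
  refine ENNReal.mul_ne_top ?_ (ENNReal.sum_ne_top.mpr fun j _ => h j)
  simpa using P.n_ne_zero

/-- Partitions into intervals of equal weight. -/
theorem exists_setIntegral_eq {β : ℝ} (hβ : 0 < β) {s : ℝ → ℝ} (hs : IsCoeff β s) (n : ℕ) :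
    ∃ Q : IntervalPartition (n + 1), ∀ j,
      ∫ x in Q.interval j, s x = (∫ x in Ioo 0 1, s x) / ((n + 1 : ℕ) : ℝ) := by
  set F : ℝ → ℝ := fun x => ∫ t in (0 : ℝ)..x, s t with hF
  have hi : ∀ x y, IntervalIntegrable s volume x y := fun x y => hs.intervalIntegrable hβ x y
  have hsub : ∀ x y, F y - F x = ∫ t in x..y, s t := fun x y =>
    intervalIntegral.integral_interval_sub_left (hi _ _) (hi _ _)
  have hmono : StrictMono F := by
    intro x y hxy
    have h1 := hs.le_setIntegral hβ (A := Ioo x y) (by simp)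
    rw [setIntegral_Ioo_eq_intervalIntegral _ hxy.le, ← hsub, Real.volume_real_Ioo_of_le hxy.le] at h1
    have : 0 < (y - x) / β := div_pos (sub_pos.mpr hxy) hβ
    linarith
  have hcont : Continuous F := intervalIntegral.continuous_primitive hi 0
  have hF0 : F 0 = 0 := intervalIntegral.integral_same
  set S := ∫ x in Ioo (0 : ℝ) 1, s x with hS
  have hF1 : F 1 = S := (setIntegral_Ioo_eq_intervalIntegral s zero_le_one).symm
  have hS0 : 0 < S := by rw [← hF1, ← hF0]; exact hmono zero_lt_one
  have hN : (0 : ℝ) < ((n + 1 : ℕ) : ℝ) := by positivity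
  have hex : ∀ i : Fin (n + 1 + 1), ∃ x, F x = (i : ℕ) * (S / ((n + 1 : ℕ) : ℝ)) := by
    intro i
    have hi1 : ((i : ℕ) : ℝ) ≤ ((n + 1 : ℕ) : ℝ) := by exact_mod_cast Nat.lt_succ_iff.mp i.2
    have hmem : (i : ℕ) * (S / ((n + 1 : ℕ) : ℝ)) ∈ Icc (F 0) (F 1) := by
      rw [hF0, hF1]
      refine ⟨by positivity, ?_⟩
      rw [mul_div_assoc', div_le_iff₀ hN, mul_comm]
      gcongr
    obtain ⟨x, -, hx⟩ := intermediate_value_Icc zero_le_one hcont.continuousOn hmem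
    exact ⟨x, hx⟩
  choose x hx using hex
  refine ⟨⟨x, fun i k hik => ?_, ?_, ?_⟩, fun j => ?_⟩
  · rw [← hmono.le_iff_le, hx, hx]
    gcongr
    exact hik
  · refine hmono.injective ?_
    rw [hx, hF0]; simp
  · refine hmono.injective ?_
    rw [hx, hF1, Fin.val_last]
    field_simp
  · have hle : x j.castSucc ≤ x j.succ := by
      rw [← hmono.le_iff_le, hx, hx]
      gcongr
      simp
    change ∫ t in Ioo (x j.castSucc) (x j.succ), s t = _
    rw [setIntegral_Ioo_eq_intervalIntegral _ hle, ← hsub, hx, hx, Fin.val_succ, Fin.val_castSucc]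
    push_cast
    ring

end IntervalPartition

/-- For a partition into intervals of equal weight every `σ_j / π` equals `T / n`, so the arguments
of `φ` differ from `T` by `n |l_j - σ_j / π|`. They stay in a compact subset of `(0, ∞)`, where
convexity gives `φ(t) ≤ φ(T) + K |t - T|`; the mean of the errors tends to `0`. -/
theorem eventually_iInf_cost_le {β : ℝ} {p q w : ℝ → ℝ} (h : IsAdmissible β p q w)
    {φ : ℝ≥0 → ℝ≥0∞} (hφ : StrictConvexOn ℝ≥0 univ φ) {T : ℝ}
    (hT : T = 1 / Real.pi * ∫ x in Ioo (0 : ℝ) 1, √(w x / p x)) {r : ℝ} (hr : 0 < r) :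
    ∀ᶠ n : ℕ in atTop, (⨅ Q : IntervalPartition (n + 1), Q.cost p q w φ) ≤
      ENNReal.ofReal ((φ T.toNNReal).toReal + r) := by
  have hβ0 := h.pos
  have hSpos := h.integral_sqrt_pos
  set S := ∫ x in Ioo (0 : ℝ) 1, √(w x / p x) with hS
  have hT0 : 0 < T := by rw [hT]; positivity
  -- Equal weights give lengths between `S / (β N)` and `β S / N`; with the crude bounds on `l_j`
  -- this yields the first entries of `c` and `C`. The second entries only ensure `c < T < C`.
  set c := min (S / (5 * β ^ 2)) (T / 2) with hc
  set C := max (49 * β ^ 7 * (β * S)) (2 * T) with hC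
  have hc0 : 0 < c := by positivity
  have hcT : c < T := (min_le_right _ _).trans_lt (by linarith)
  have hTC : T < C := lt_of_lt_of_le (by linarith) (le_max_right _ _)
  have hmem : ∀ t : ℝ, 0 < t → t ∈ {t : ℝ | 0 ≤ t ∧ φ t.toNNReal ≠ ⊤} := fun t ht =>
    ⟨ht.le, hφ.ne_top_of_pos (Real.toNNReal_pos.mpr ht)⟩
  obtain ⟨K, hK0, hK⟩ := hφ.toReal.convexOn.exists_le_add_mul_abs (hmem c hc0)
    (hmem C (hT0.trans hTC)) hcT hTC
  obtain ⟨δ, hδ, hsum⟩ := exists_sum_abs_invSqrtEigenvalue_sub_le h.one_lt h.coeff_p h.bound_q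
    h.meas_q h.coeff_w (show 0 < r / (K + 1) by positivity)
  have hlim : Tendsto (fun n : ℕ => β * S / ((n + 1 : ℕ) : ℝ)) atTop (𝓝 0) :=
    tendsto_const_nhds.div_atTop
      ((tendsto_natCast_atTop_atTop (R := ℝ)).comp (tendsto_add_atTop_nat 1))
  filter_upwards [hlim.eventually_le_const hδ] with n hn
  obtain ⟨Q, hQ⟩ := IntervalPartition.exists_setIntegral_eq hβ0 h.coeff_sqrt n
  refine (iInf_le _ Q).trans ?_
  set N : ℝ := ((n + 1 : ℕ) : ℝ) with hN
  have hN0 : 0 < N := by positivity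
  set l : Fin (n + 1) → ℝ := fun j => invSqrtEigenvalue p q w (Q.left j) (Q.right j) with hl
  have hlen1 : ∀ j, Q.len j ≤ β * S / N := by
    intro j
    have := h.len_div_le Q j
    rw [hQ, div_le_iff₀ hβ0] at this
    calc _ ≤ _ := this
      _ = _ := by ring
  have hlen2 : ∀ j, S / (β * N) ≤ Q.len j := by
    intro j
    have := h.setIntegral_le Q j
    rw [hQ] at this
    calc S / (β * N) = S / N / β := by field_simp
      _ ≤ β * Q.len j / β := by gcongr
      _ = _ := by field_simp
  have harg : ∀ j, (Q.costArg p q w j : ℝ) ∈ Icc c C := by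
    intro j
    rw [Q.coe_costArg]
    constructor
    · refine (min_le_left _ _).trans ?_
      have h1 := le_invSqrtEigenvalue h.one_lt h.coeff_p h.bound_q h.meas_q h.coeff_w
        (Q.left_le_right j) (Q.len_le_one j)
      calc S / (5 * β ^ 2) = N * (S / (β * N) / (5 * β)) := by field_simp
        _ ≤ N * (Q.len j / (5 * β)) := by gcongr; exact hlen2 j
        _ ≤ _ := mul_le_mul_of_nonneg_left h1 hN0.le
    · refine le_trans ?_ (le_max_left _ _)
      have h1 := h.invSqrtEigenvalue_le (Q.left_le_right j) (Q.len_le_one j)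
      calc _ ≤ N * (49 * β ^ 7 * Q.len j) := mul_le_mul_of_nonneg_left h1 hN0.le
        _ ≤ N * (49 * β ^ 7 * (β * S / N)) := by gcongr; exact hlen1 j
        _ = _ := by field_simp
  have htop : ∀ j, φ (Q.costArg p q w j) ≠ ⊤ := fun j =>
    hφ.ne_top_of_pos (by exact_mod_cast hc0.trans_le (harg j).1)
  refine (ENNReal.le_ofReal_iff_toReal_le (Q.cost_ne_top htop) (by positivity)).mpr ?_
  rw [Q.toReal_cost htop]
  have hterm : ∀ j, (φ (Q.costArg p q w j)).toReal ≤
      (φ T.toNNReal).toReal + K * (N * |l j - 1 / Real.pi * ∫ x in Q.interval j, √(w x / p x)|) := by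
    intro j
    have h1 := hK _ (harg j)
    rw [Real.toNNReal_coe] at h1
    refine h1.trans (le_of_eq ?_)
    have e : (Q.costArg p q w j : ℝ) - T =
        N * (l j - 1 / Real.pi * ∫ x in Q.interval j, √(w x / p x)) := by
      have e1 : (Q.costArg p q w j : ℝ) = N * l j := Q.coe_costArg j
      rw [e1, hQ, hT, ← hS]
      field_simp
    rw [e, abs_mul, abs_of_pos hN0]
  have hs := hsum (n + 1) Q Finset.univ fun j _ => (hlen1 j).trans hn
  calc N⁻¹ * ∑ j, (φ (Q.costArg p q w j)).toReal
      ≤ N⁻¹ * ∑ j, ((φ T.toNNReal).toReal +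
          K * (N * |l j - 1 / Real.pi * ∫ x in Q.interval j, √(w x / p x)|)) := by
        gcongr with j
        exact hterm j
    _ = (φ T.toNNReal).toReal +
          K * ∑ j, |l j - 1 / Real.pi * ∫ x in Q.interval j, √(w x / p x)| := by
        rw [Finset.sum_add_distrib, ← Finset.mul_sum, ← Finset.mul_sum, Finset.sum_const,
          Finset.card_univ, Fintype.card_fin, nsmul_eq_mul, ← hN]
        generalize ∑ j, |l j - 1 / Real.pi * ∫ x in Q.interval j, √(w x / p x)| = X
        field_simp
    _ ≤ (φ T.toNNReal).toReal + K * (r / (K + 1)) := by gcongr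
    _ ≤ (φ T.toNNReal).toReal + r := by
        gcongr
        rw [mul_div_assoc', div_le_iff₀ (by positivity)]
        linarith

/-! ### Short and long intervals, and the lower bound by supporting lines -/

namespace IntervalPartition

variable {p q w : ℝ → ℝ} {φ : ℝ≥0 → ℝ≥0∞}

/-- The intervals of length at most `1 / √n`. -/
noncomputable def short {n : ℕ} (P : IntervalPartition n) : Finset (Fin n) :=
  Finset.univ.filter fun j => P.len j ≤ 1 / √n

theorem len_le_of_mem_short {n : ℕ} (P : IntervalPartition n) {j : Fin n} (hj : j ∈ P.short) :
    P.len j ≤ 1 / √n := (Finset.mem_filter.mp hj).2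

theorem lt_len_of_mem_compl_short {n : ℕ} (P : IntervalPartition n) {j : Fin n}
    (hj : j ∈ P.shortᶜ) : 1 / √n < P.len j := by
  rw [Finset.mem_compl, short, Finset.mem_filter] at hj
  by_contra h
  exact hj ⟨Finset.mem_univ j, not_lt.mp h⟩

/-- Since the lengths add up to `1`, at most `√n` of them exceed `1 / √n`. The threshold tends to
`0`, so the asymptotics holds on short intervals, yet on long ones the argument of `φ` is at least
of order `√n`. -/
theorem card_compl_short_le {n : ℕ} (P : IntervalPartition n) :
    ((P.shortᶜ).card : ℝ) / n ≤ 1 / √n := by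
  have hn : (0 : ℝ) < n := by exact_mod_cast Nat.pos_of_ne_zero P.n_ne_zero
  have h1 : ((P.shortᶜ).card : ℝ) * (1 / √n) ≤ 1 := by
    calc ((P.shortᶜ).card : ℝ) * (1 / √n) = ∑ _j ∈ P.shortᶜ, 1 / √(n : ℝ) := by
          rw [Finset.sum_const, nsmul_eq_mul]
      _ ≤ ∑ j ∈ P.shortᶜ, P.len j :=
          Finset.sum_le_sum fun j hj => (P.lt_len_of_mem_compl_short hj).le
      _ ≤ 1 := P.sum_len_le_one _
  have hs : 0 < √(n : ℝ) := Real.sqrt_pos.mpr hn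
  rw [mul_one_div, div_le_one hs] at h1
  rw [div_le_div_iff₀ hn hs, one_mul]
  calc ((P.shortᶜ).card : ℝ) * √n ≤ √n * √n := by gcongr
    _ = n := Real.mul_self_sqrt hn.le

theorem card_short_div {n : ℕ} (P : IntervalPartition n) :
    (P.short.card : ℝ) / n = 1 - ((P.shortᶜ).card : ℝ) / n := by
  have hn : (n : ℝ) ≠ 0 := by exact_mod_cast P.n_ne_zero
  have h := Finset.card_add_card_compl P.short
  rw [Fintype.card_fin] at h
  have h' : (P.short.card : ℝ) + ((P.shortᶜ).card : ℝ) = n := by exact_mod_cast h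
  field_simp
  linarith

/-- Lower bound for the cost by supporting lines. -/
theorem le_toReal_cost {n : ℕ} (P : IntervalPartition n) (hP : P.cost p q w φ ≠ ⊤)
    {T k m c ε : ℝ}
    (hsupp : ∀ t : ℝ≥0, φ t ≠ ⊤ → k + m * (t - T) + c * (|(t : ℝ) - T| - ε) ≤ (φ t).toReal)
    (J : Finset (Fin n)) :
    (J.card : ℝ) / n * (k - m * T - c * ε) +
      m * ∑ j ∈ J, invSqrtEigenvalue p q w (P.left j) (P.right j) +
      c * ∑ j ∈ J, |invSqrtEigenvalue p q w (P.left j) (P.right j) - T / n| ≤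
      (P.cost p q w φ).toReal := by
  have hn : (0 : ℝ) < n := by exact_mod_cast Nat.pos_of_ne_zero P.n_ne_zero
  have htop := P.ne_top_of_cost_ne_top hP
  rw [P.toReal_cost htop]
  have h1 : ∑ j ∈ J, (φ (P.costArg p q w j)).toReal ≤ ∑ j, (φ (P.costArg p q w j)).toReal :=
    Finset.sum_le_sum_of_subset_of_nonneg (Finset.subset_univ J) fun _ _ _ => ENNReal.toReal_nonneg
  have h2 : ∑ j ∈ J, ((k - m * T - c * ε) +
      n * (m * invSqrtEigenvalue p q w (P.left j) (P.right j)) +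
      n * (c * |invSqrtEigenvalue p q w (P.left j) (P.right j) - T / n|)) ≤
      ∑ j ∈ J, (φ (P.costArg p q w j)).toReal := by
    refine Finset.sum_le_sum fun j _ => le_trans (le_of_eq ?_) (hsupp _ (htop j))
    rw [P.coe_costArg]
    have e : n * invSqrtEigenvalue p q w (P.left j) (P.right j) - T =
        n * (invSqrtEigenvalue p q w (P.left j) (P.right j) - T / n) := by field_simp
    rw [e, abs_mul, abs_of_pos hn]
    field_simp
    ring
  rw [Finset.sum_add_distrib, Finset.sum_add_distrib, Finset.sum_const, nsmul_eq_mul,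
    ← Finset.mul_sum, ← Finset.mul_sum, ← Finset.mul_sum, ← Finset.mul_sum] at h2
  rw [inv_mul_eq_div, le_div_iff₀ hn]
  refine le_trans (le_of_eq ?_) (h2.trans h1)
  field_simp

end IntervalPartition

theorem tendsto_one_div_sqrt_succ :
    Tendsto (fun n : ℕ => 1 / √((n + 1 : ℕ) : ℝ)) atTop (𝓝 0) :=
  tendsto_const_nhds.div_atTop (Real.tendsto_sqrt_atTop.comp
    ((tendsto_natCast_atTop_atTop (R := ℝ)).comp (tendsto_add_atTop_nat 1)))

section Asymptotics

variable {β : ℝ} {p q w : ℝ → ℝ} {φ : ℝ≥0 → ℝ≥0∞}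

theorem tendsto_sum_short_abs_invSqrtEigenvalue_sub (h : IsAdmissible β p q w)
    (P : (n : ℕ) → IntervalPartition (n + 1)) :
    Tendsto (fun n => ∑ j ∈ (P n).short, |invSqrtEigenvalue p q w ((P n).left j) ((P n).right j) -
      1 / Real.pi * ∫ x in (P n).interval j, √(w x / p x)|) atTop (𝓝 0) := by
  rw [Metric.tendsto_atTop']
  intro ε hε
  obtain ⟨δ, hδ, hsum⟩ := exists_sum_abs_invSqrtEigenvalue_sub_le h.one_lt h.coeff_p h.bound_q
    h.meas_q h.coeff_w (half_pos hε)
  obtain ⟨n0, hn0⟩ := eventually_atTop.mp (tendsto_one_div_sqrt_succ.eventually_le_const hδ)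
  refine ⟨n0, fun n hn => ?_⟩
  have := hsum (n + 1) (P n) (P n).short
    fun j hj => ((P n).len_le_of_mem_short hj).trans (hn0 n hn.le)
  rw [Real.dist_0_eq_abs, abs_of_nonneg (Finset.sum_nonneg fun _ _ => abs_nonneg _)]
  linarith

theorem tendsto_sum_short_intervalDeviation {f : ℝ → ℝ} (hf : IntegrableOn f (Ioo 0 1))
    (P : (n : ℕ) → IntervalPartition (n + 1)) :
    Tendsto (fun n => ∑ j ∈ (P n).short, intervalDeviation f ((P n).left j) ((P n).right j))
      atTop (𝓝 0) := by
  rw [Metric.tendsto_atTop']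
  intro ε hε
  obtain ⟨δ, hδ, hsum⟩ := exists_sum_intervalDeviation_le hf (half_pos hε)
  obtain ⟨n0, hn0⟩ := eventually_atTop.mp (tendsto_one_div_sqrt_succ.eventually_le_const hδ)
  refine ⟨n0, fun n hn => ?_⟩
  have := hsum (n + 1) (P n) (P n).short
    fun j hj => ((P n).len_le_of_mem_short hj).trans (hn0 n hn.le)
  rw [Real.dist_0_eq_abs, abs_of_nonneg (Finset.sum_nonneg fun _ _ => intervalDeviation_nonneg _ _ _)]
  linarith

/-- In the superlinear case the long intervals of partitions of bounded cost are negligible. -/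
theorem eventually_sum_compl_short_le (h : IsAdmissible β p q w)
    (hφ : StrictConvexOn ℝ≥0 univ φ)
    (hgrowth : Tendsto (fun t : ℝ≥0 => φ t / (t : ℝ≥0∞)) atTop (𝓝 ⊤))
    {P : (n : ℕ) → IntervalPartition (n + 1)} {B : ℝ} (hB : 0 < B)
    (hP : ∀ᶠ n in atTop, (P n).cost p q w φ ≤ ENNReal.ofReal B) {r : ℝ} (hr : 0 < r) :
    ∀ᶠ n in atTop, ∑ j ∈ (P n).shortᶜ,
      invSqrtEigenvalue p q w ((P n).left j) ((P n).right j) ≤ r := by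
  -- The arguments on long intervals eventually exceed any `M`, so `φ` lies above the line of slope
  -- `B / r` there. A cost of at most `B` then leaves at most `r` for the sum of the `l_j`.
  obtain ⟨M, hM⟩ := eventually_mul_le_of_tendsto_div_top hφ hgrowth (B / r)
  have hβ0 := h.pos
  have hlarge : Tendsto (fun n : ℕ => √((n + 1 : ℕ) : ℝ) / (5 * β)) atTop atTop :=
    (Real.tendsto_sqrt_atTop.comp
      ((tendsto_natCast_atTop_atTop (R := ℝ)).comp (tendsto_add_atTop_nat 1))).atTop_div_const
      (by positivity)
  filter_upwards [hP, hlarge.eventually_ge_atTop M] with n hn hnM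
  set N : ℝ := ((n + 1 : ℕ) : ℝ) with hN
  have hN0 : 0 < N := by positivity
  have hcost : (P n).cost p q w φ ≠ ⊤ := ne_top_of_le_ne_top ENNReal.ofReal_ne_top hn
  have htop := (P n).ne_top_of_cost_ne_top hcost
  have hle : ((P n).cost p q w φ).toReal ≤ B := ENNReal.toReal_le_of_le_ofReal hB.le hn
  rw [(P n).toReal_cost htop, ← hN] at hle
  have h1 : ∑ j ∈ (P n).shortᶜ,
      B / r * (N * invSqrtEigenvalue p q w ((P n).left j) ((P n).right j)) ≤
      ∑ j, (φ ((P n).costArg p q w j)).toReal := by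
    refine le_trans (Finset.sum_le_sum fun j hj => ?_)
      (Finset.sum_le_sum_of_subset_of_nonneg (Finset.subset_univ (P n).shortᶜ)
        fun _ _ _ => ENNReal.toReal_nonneg)
    have hc : ((P n).costArg p q w j : ℝ) =
        N * invSqrtEigenvalue p q w ((P n).left j) ((P n).right j) := (P n).coe_costArg j
    rw [← hc]
    refine hM _ (hnM.trans ?_)
    rw [hc]
    have h2 := le_invSqrtEigenvalue h.one_lt h.coeff_p h.bound_q h.meas_q h.coeff_w
        ((P n).left_le_right j) ((P n).len_le_one j)
    have h3 : 1 / √N < (P n).len j := (P n).lt_len_of_mem_compl_short hj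
    have hs : 0 < √N := Real.sqrt_pos.mpr hN0
    calc √N / (5 * β) = √N * √N * (1 / √N / (5 * β)) := by field_simp
      _ = N * (1 / √N / (5 * β)) := by rw [Real.mul_self_sqrt hN0.le]
      _ ≤ N * ((P n).len j / (5 * β)) := by gcongr
      _ ≤ _ := mul_le_mul_of_nonneg_left h2 hN0.le
  rw [← Finset.mul_sum, ← Finset.mul_sum] at h1
  set X := ∑ j ∈ (P n).shortᶜ, invSqrtEigenvalue p q w ((P n).left j) ((P n).right j) with hX
  have h4 : N⁻¹ * (B / r * (N * X)) ≤ B := le_trans (by gcongr) hle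
  have h5 : N⁻¹ * (B / r * (N * X)) = B * (X / r) := by field_simp
  rw [h5] at h4
  have h6 : X / r ≤ 1 := le_of_mul_le_mul_left (by linarith) hB
  rwa [div_le_one hr] at h6

/-- The linear part of the lower bound for the cost, asymptotically. -/
theorem eventually_le_mul_sum_short (h : IsAdmissible β p q w)
    (hφ : StrictConvexOn ℝ≥0 univ φ)
    (hgrowth : Tendsto (fun t : ℝ≥0 => φ t / (t : ℝ≥0∞)) atTop (𝓝 0) ∨
      Tendsto (fun t : ℝ≥0 => φ t / (t : ℝ≥0∞)) atTop (𝓝 ⊤)) {T k m : ℝ}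
    (hT : T = 1 / Real.pi * ∫ x in Ioo (0 : ℝ) 1, √(w x / p x))
    (hm : ∀ t : ℝ≥0, φ t ≠ ⊤ → k + m * (t - T) ≤ (φ t).toReal)
    {P : (n : ℕ) → IntervalPartition (n + 1)} {B : ℝ} (hB : 0 < B)
    (hP : ∀ᶠ n in atTop, (P n).cost p q w φ ≤ ENNReal.ofReal B) {r : ℝ} (hr : 0 < r) :
    ∀ᶠ n in atTop, m * T - r ≤ m * ∑ j ∈ (P n).short,
      invSqrtEigenvalue p q w ((P n).left j) ((P n).right j) := by
  have hβ0 := h.pos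
  set σ : (n : ℕ) → Fin (n + 1) → ℝ := fun n j =>
    ∫ x in (P n).interval j, √(w x / p x) with hσ
  have hσ0 : ∀ n j, 0 ≤ σ n j := fun n j => integral_nonneg fun _ => Real.sqrt_nonneg _
  have hσsum : ∀ n, 1 / Real.pi * ∑ j, σ n j = T := fun n => by
    rw [hT, ← (P n).sum_setIntegral h.integrableOn_sqrt]
  have hA := tendsto_sum_short_abs_invSqrtEigenvalue_sub h P
  have hdiff : ∀ n, |(∑ j ∈ (P n).short, invSqrtEigenvalue p q w ((P n).left j) ((P n).right j)) -
      1 / Real.pi * ∑ j ∈ (P n).short, σ n j| ≤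
      ∑ j ∈ (P n).short, |invSqrtEigenvalue p q w ((P n).left j) ((P n).right j) -
        1 / Real.pi * σ n j| := fun n => by
    rw [Finset.mul_sum, ← Finset.sum_sub_distrib]
    exact Finset.abs_sum_le_sum_abs _ _
  have hsplit : ∀ n, 1 / Real.pi * ∑ j ∈ (P n).short, σ n j +
      1 / Real.pi * ∑ j ∈ (P n).shortᶜ, σ n j = T := fun n => by
    rw [← mul_add, Finset.sum_add_sum_compl, hσsum]
  have hlong0 : ∀ n, 0 ≤ 1 / Real.pi * ∑ j ∈ (P n).shortᶜ, σ n j := fun n =>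
    mul_nonneg (one_div_pos.mpr Real.pi_pos).le (Finset.sum_nonneg fun j _ => hσ0 n j)
  have hr' : 0 < r / (2 * (|m| + 1)) := by positivity
  have hr2 : |m| * (r / (2 * (|m| + 1))) ≤ r / 2 := by
    rw [mul_div_assoc', div_le_div_iff₀ (by positivity) (by positivity)]
    nlinarith [abs_nonneg m]
  rcases hgrowth with hg | hg
  -- Sublinear case: an upper bound for the sum suffices, as `m ≤ 0`, and omitting the long
  -- intervals only lowers the sum.
  · have hm0 : m ≤ 0 := slope_nonpos_of_tendsto_div_zero hφ hg (k := k - m * T) (m := m)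
      fun t ht => by have := hm t ht; linarith
    filter_upwards [hA.eventually_le_const hr'] with n hn
    have h1 := le_of_abs_le ((hdiff n).trans hn)
    have h2 : (∑ j ∈ (P n).short, invSqrtEigenvalue p q w ((P n).left j) ((P n).right j)) ≤
        T + r / (2 * (|m| + 1)) := by linarith [hsplit n, hlong0 n]
    have h3 := mul_le_mul_of_nonpos_left h2 hm0
    rw [abs_of_nonpos hm0] at h3 hr2
    linarith
  -- Superlinear case: `m` may have either sign, so the sum must be close to `T` from both sides.
  -- The weight of the long intervals is small because `σ_j ≤ β L_j ≤ 5 β² l_j`, with `L_j` the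
  -- length.
  · have hr3 : 0 < r / (2 * (|m| + 1)) / (5 * β ^ 2) := by positivity
    filter_upwards [hA.eventually_le_const hr', eventually_sum_compl_short_le h hφ hg hB hP hr3]
      with n hn hn2
    have h4 : 1 / Real.pi * ∑ j ∈ (P n).shortᶜ, σ n j ≤ r / (2 * (|m| + 1)) := by
      have h5 : ∑ j ∈ (P n).shortᶜ, σ n j ≤ ∑ j ∈ (P n).shortᶜ,
          5 * β ^ 2 * invSqrtEigenvalue p q w ((P n).left j) ((P n).right j) := by
        refine Finset.sum_le_sum fun j _ => (h.setIntegral_le (P n) j).trans ?_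
        have h6 := le_invSqrtEigenvalue h.one_lt h.coeff_p h.bound_q h.meas_q h.coeff_w
          ((P n).left_le_right j) ((P n).len_le_one j)
        calc β * (P n).len j = 5 * β ^ 2 * ((P n).len j / (5 * β)) := by field_simp
          _ ≤ _ := by gcongr; exact h6
      rw [← Finset.mul_sum] at h5
      have h7 : 5 * β ^ 2 * ∑ j ∈ (P n).shortᶜ,
          invSqrtEigenvalue p q w ((P n).left j) ((P n).right j) ≤ r / (2 * (|m| + 1)) := by
        calc _ ≤ 5 * β ^ 2 * (r / (2 * (|m| + 1)) / (5 * β ^ 2)) := by gcongr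
          _ = _ := by field_simp
      refine le_trans (mul_le_of_le_one_left (Finset.sum_nonneg fun j _ => hσ0 n j) ?_)
        (h5.trans h7)
      exact (div_le_one Real.pi_pos).mpr (by linarith [Real.pi_gt_three])
    have h8 := abs_le.mp ((hdiff n).trans hn)
    have h9 : |(∑ j ∈ (P n).short, invSqrtEigenvalue p q w ((P n).left j) ((P n).right j)) - T| ≤
        2 * (r / (2 * (|m| + 1))) := by
      rw [abs_le]
      constructor <;> linarith [hsplit n, hlong0 n, h8.1, h8.2]
    have h10 := neg_abs_le (m * ((∑ j ∈ (P n).short,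
      invSqrtEigenvalue p q w ((P n).left j) ((P n).right j)) - T))
    rw [abs_mul] at h10
    have h11 := mul_le_mul_of_nonneg_left h9 (abs_nonneg m)
    linarith

/-- The supporting line at `T` bounds the cost below by `φ(T)` up to vanishing errors, because the
short intervals make up almost all of the `n` indices. With the upper bound assumed in `hP`, nothing
is left for the gap term `c ∑ |l_j - T/n|`. -/
theorem tendsto_cost_and_sum_abs (h : IsAdmissible β p q w)
    (hφ : StrictConvexOn ℝ≥0 univ φ)
    (hgrowth : Tendsto (fun t : ℝ≥0 => φ t / (t : ℝ≥0∞)) atTop (𝓝 0) ∨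
      Tendsto (fun t : ℝ≥0 => φ t / (t : ℝ≥0∞)) atTop (𝓝 ⊤)) {T : ℝ}
    (hT : T = 1 / Real.pi * ∫ x in Ioo (0 : ℝ) 1, √(w x / p x))
    {P : (n : ℕ) → IntervalPartition (n + 1)}
    (hP : ∀ r > 0, ∀ᶠ n in atTop, (P n).cost p q w φ ≤
      ENNReal.ofReal ((φ T.toNNReal).toReal + r)) :
    Tendsto (fun n => ((P n).cost p q w φ).toReal) atTop (𝓝 (φ T.toNNReal).toReal) ∧
    Tendsto (fun n => ∑ j ∈ (P n).short,
      |invSqrtEigenvalue p q w ((P n).left j) ((P n).right j) - T / ((n + 1 : ℕ) : ℝ)|)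
      atTop (𝓝 0) := by
  have hT0 : 0 < T := by rw [hT]; exact mul_pos (one_div_pos.mpr Real.pi_pos) h.integral_sqrt_pos
  obtain ⟨m, hm, hmc⟩ := hφ.exists_support hT0
  set k := (φ T.toNNReal).toReal with hk
  have hk0 : 0 ≤ k := ENNReal.toReal_nonneg
  have hlin := fun r (hr : 0 < r) => eventually_le_mul_sum_short h hφ hgrowth hT hm
    (P := P) (B := k + 1) (by positivity) (hP 1 one_pos) hr
  have hfin : ∀ᶠ n in atTop, (P n).cost p q w φ ≠ ⊤ :=
    (hP 1 one_pos).mono fun n hn => ne_top_of_le_ne_top ENNReal.ofReal_ne_top hn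
  have hup : ∀ r > 0, ∀ᶠ n in atTop, ((P n).cost p q w φ).toReal ≤ k + r := fun r hr =>
    (hP r hr).mono fun n hn => ENNReal.toReal_le_of_le_ofReal (by positivity) hn
  have hcard : ∀ a r : ℝ, 0 < r →
      ∀ᶠ n in atTop, a - r ≤ ((P n).short.card : ℝ) / ((n + 1 : ℕ) : ℝ) * a := by
    intro a r hr
    have h1 := (tendsto_one_div_sqrt_succ.mul_const |a|).eventually_le_const
      (show 0 * |a| < r by simpa using hr)
    filter_upwards [h1] with n hn
    rw [(P n).card_short_div, sub_mul, one_mul]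
    have h2 := (P n).card_compl_short_le
    have h3 : (((P n).shortᶜ).card : ℝ) / ((n + 1 : ℕ) : ℝ) * a ≤
        1 / √((n + 1 : ℕ) : ℝ) * |a| :=
      (mul_le_mul_of_nonneg_left (le_abs_self a) (by positivity)).trans
        (mul_le_mul_of_nonneg_right h2 (abs_nonneg a))
    linarith
  refine ⟨?_, ?_⟩
  · refine tendsto_order.mpr ⟨fun x hx => ?_, fun x hx => ?_⟩
    · have hr : 0 < (k - x) / 4 := by linarith
      filter_upwards [hfin, hlin _ hr, hcard (k - m * T) _ hr] with n h1 h2 h3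
      have h4 := (P n).le_toReal_cost h1 (T := T) (k := k) (m := m) (c := 0) (ε := 0)
        (fun t ht => by simpa using hm t ht) (P n).short
      simp only [zero_mul, sub_zero, add_zero] at h4
      linarith
    · have hr : 0 < (x - k) / 2 := by linarith
      filter_upwards [hup _ hr] with n hn
      linarith
  · refine tendsto_order.mpr ⟨fun x hx => Eventually.of_forall fun n =>
      hx.trans_le (Finset.sum_nonneg fun _ _ => abs_nonneg _), fun x hx => ?_⟩
    -- The gap loses `c * x / 2` and there are three errors of `c * x / 8`, in all less than `c *
    -- x`.
    obtain ⟨c, hc, hsupp⟩ := hmc (x / 2) (by positivity)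
    have hr : 0 < c * x / 8 := by positivity
    filter_upwards [hfin, hlin _ hr, hcard (k - m * T - c * (x / 2)) _ hr, hup _ hr]
      with n h1 h2 h3 h5
    have h4 := (P n).le_toReal_cost h1 hsupp (P n).short
    have h6 : c * ∑ j ∈ (P n).short, |invSqrtEigenvalue p q w ((P n).left j) ((P n).right j) -
        T / ((n + 1 : ℕ) : ℝ)| < c * x := by linarith
    exact lt_of_mul_lt_mul_left h6 hc.le

/-- The weights of the intervals of asymptotically optimal partitions are equidistributed, and the
oscillation of the weight over the intervals is negligible. -/
theorem tendsto_sum_abs_weight_sub (h : IsAdmissible β p q w) {T : ℝ}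
    (hT : T = 1 / Real.pi * ∫ x in Ioo (0 : ℝ) 1, √(w x / p x))
    {P : (n : ℕ) → IntervalPartition (n + 1)}
    (hP : Tendsto (fun n => ∑ j ∈ (P n).short,
      |invSqrtEigenvalue p q w ((P n).left j) ((P n).right j) - T / ((n + 1 : ℕ) : ℝ)|)
      atTop (𝓝 0)) :
    Tendsto (fun n => ∑ j, |1 / Real.pi * (∫ x in (P n).interval j, √(w x / p x)) -
      T / ((n + 1 : ℕ) : ℝ)|) atTop (𝓝 0) ∧
    Tendsto (fun n => ∑ j, intervalDeviation (fun x => √(w x / p x)) ((P n).left j)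
      ((P n).right j)) atTop (𝓝 0) := by
  have hT0 : 0 < T := by rw [hT]; exact mul_pos (one_div_pos.mpr Real.pi_pos) h.integral_sqrt_pos
  set σ : (n : ℕ) → Fin (n + 1) → ℝ := fun n j =>
    ∫ x in (P n).interval j, √(w x / p x) with hσ
  have hσ0 : ∀ n j, 0 ≤ σ n j := fun n j => integral_nonneg fun _ => Real.sqrt_nonneg _
  have hσsum : ∀ n, 1 / Real.pi * ∑ j, σ n j = T := fun n => by
    rw [hT, ← (P n).sum_setIntegral h.integrableOn_sqrt]
  have hA := tendsto_sum_short_abs_invSqrtEigenvalue_sub h P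
  have hshort : Tendsto (fun n => ∑ j ∈ (P n).short, |1 / Real.pi * σ n j -
      T / ((n + 1 : ℕ) : ℝ)|) atTop (𝓝 0) := by
    have h1 := hA.add hP
    rw [add_zero] at h1
    refine squeeze_zero (fun n => Finset.sum_nonneg fun _ _ => abs_nonneg _) (fun n => ?_) h1
    rw [← Finset.sum_add_distrib]
    refine Finset.sum_le_sum fun j _ => ?_
    rw [abs_sub_comm (invSqrtEigenvalue _ _ _ _ _)]
    exact abs_sub_le _ _ _
  have hcard : Tendsto (fun n => (((P n).shortᶜ).card : ℝ) / ((n + 1 : ℕ) : ℝ) * T)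
      atTop (𝓝 0) := by
    have := tendsto_one_div_sqrt_succ.mul_const T
    rw [zero_mul] at this
    exact squeeze_zero (fun n => by positivity)
      (fun n => mul_le_mul_of_nonneg_right (P n).card_compl_short_le hT0.le) this
  -- Conservation of weight: the total is `T`, and the short intervals, almost `n` in number, carry
  -- about `T / n` each. This needs no growth of `φ`.
  have hlong : Tendsto (fun n => 1 / Real.pi * ∑ j ∈ (P n).shortᶜ, σ n j) atTop (𝓝 0) := by
    have h1 := hshort.add hcard
    rw [add_zero] at h1
    refine squeeze_zero (fun n => mul_nonneg (one_div_pos.mpr Real.pi_pos).le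
      (Finset.sum_nonneg fun j _ => hσ0 n j)) (fun n => ?_) h1
    have h2 : 1 / Real.pi * ∑ j ∈ (P n).short, σ n j +
        1 / Real.pi * ∑ j ∈ (P n).shortᶜ, σ n j = T := by
      rw [← mul_add, Finset.sum_add_sum_compl, hσsum]
    have h3 := neg_abs_le (∑ j ∈ (P n).short, (1 / Real.pi * σ n j - T / ((n + 1 : ℕ) : ℝ)))
    have h4 := Finset.abs_sum_le_sum_abs (fun j => 1 / Real.pi * σ n j - T / ((n + 1 : ℕ) : ℝ))
      (P n).short
    have h5 : ∑ j ∈ (P n).short, (1 / Real.pi * σ n j - T / ((n + 1 : ℕ) : ℝ)) =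
        1 / Real.pi * ∑ j ∈ (P n).short, σ n j -
          ((P n).short.card : ℝ) / ((n + 1 : ℕ) : ℝ) * T := by
      rw [Finset.sum_sub_distrib, Finset.sum_const, nsmul_eq_mul, Finset.mul_sum]
      ring
    rw [(P n).card_short_div, sub_mul, one_mul] at h5
    linarith
  refine ⟨?_, ?_⟩
  · have h1 := hshort.add (hlong.add hcard)
    rw [add_zero, add_zero] at h1
    refine squeeze_zero (fun n => Finset.sum_nonneg fun _ _ => abs_nonneg _) (fun n => ?_) h1
    rw [← Finset.sum_add_sum_compl (P n).short]
    refine add_le_add le_rfl ?_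
    calc _ ≤ ∑ j ∈ (P n).shortᶜ, (1 / Real.pi * σ n j + T / ((n + 1 : ℕ) : ℝ)) := by
          refine Finset.sum_le_sum fun j _ => (abs_sub _ _).trans (le_of_eq ?_)
          rw [abs_of_nonneg (mul_nonneg (one_div_pos.mpr Real.pi_pos).le (hσ0 n j)),
            abs_of_nonneg (by positivity)]
      _ = _ := by
          rw [Finset.sum_add_distrib, Finset.sum_const, nsmul_eq_mul, Finset.mul_sum]
          ring
  · have h1 := (tendsto_sum_short_intervalDeviation h.integrableOn_sqrt P).add
      (hlong.const_mul (2 * Real.pi))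
    rw [mul_zero, add_zero] at h1
    refine squeeze_zero (fun n => Finset.sum_nonneg fun _ _ => intervalDeviation_nonneg _ _ _)
      (fun n => ?_) h1
    rw [← Finset.sum_add_sum_compl (P n).short]
    refine add_le_add le_rfl ?_
    have e : 2 * Real.pi * (1 / Real.pi * ∑ j ∈ (P n).shortᶜ, σ n j) =
        ∑ j ∈ (P n).shortᶜ, 2 * σ n j := by
      rw [← Finset.mul_sum]; field_simp
    rw [e]
    -- On long intervals the deviation is at most `2 σ_j`, by comparison with the constant `0`.
    refine Finset.sum_le_sum fun j _ => ?_
    refine (intervalDeviation_le ((P n).left_le_right j)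
      (h.integrableOn_sqrt.mono_set ((P n).interval_subset j)) 0).trans (le_of_eq ?_)
    simp only [sub_zero, abs_of_nonneg (Real.sqrt_nonneg _)]
    rfl

end Asymptotics

/-! ### Portions of a partition and the limit measure -/

namespace IntervalPartition

variable {n : ℕ} (P : IntervalPartition n)

open Classical in
/-- The contribution of the interval with index `j` to the portion of the partition in `A`. -/
noncomputable def portionTerm (A : Set ℝ) (j : Fin n) : ℝ :=
  if P.left j < P.right j then volume.real (P.interval j ∩ A) / (n * volume.real (P.interval j))
  else if P.right j ∈ A then 1 / (n : ℝ) else 0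

theorem portion_eq_sum (A : Set ℝ) : P.portion A = ∑ j, P.portionTerm A j := by
  classical
  have h : ((Finset.univ.filter fun j : Fin n => P.right j ∈ A ∧ P.left j = P.right j).card : ℝ) / n
      = ∑ j : Fin n with ¬ P.left j < P.right j, if P.right j ∈ A then 1 / (n : ℝ) else 0 := by
    rw [← Finset.sum_filter, Finset.sum_const, nsmul_eq_mul, Finset.filter_filter, mul_one_div]
    congr 3
    ext j
    simp only [Finset.mem_filter, Finset.mem_univ, true_and, not_lt]
    have := P.left_le_right j
    constructor
    · rintro ⟨h1, h2⟩; exact ⟨h2.ge, h1⟩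
    · rintro ⟨h1, h2⟩; exact ⟨h2, le_antisymm this h1⟩
  have h2 : P.portion A = (∑ j : Fin n with P.left j < P.right j,
      volume.real (P.interval j ∩ A) / (n * volume.real (P.interval j))) +
      ∑ j : Fin n with ¬ P.left j < P.right j, if P.right j ∈ A then 1 / (n : ℝ) else 0 := by
    rw [← h, portion]
  rw [h2, ← Finset.sum_filter_add_sum_filter_not Finset.univ fun j => P.left j < P.right j]
  congr 1
  · refine Finset.sum_congr rfl fun j hj => ?_
    rw [portionTerm, if_pos (Finset.mem_filter.mp hj).2]
  · refine Finset.sum_congr rfl fun j hj => ?_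
    rw [portionTerm, if_neg (Finset.mem_filter.mp hj).2]

theorem portionTerm_nonneg (A : Set ℝ) (j : Fin n) : 0 ≤ P.portionTerm A j := by
  rw [portionTerm]
  split_ifs <;> positivity

/-- If `I_j` has length `L`, and `M = |I_j ∩ A|`, `τ = ∫_{I_j ∩ A} s`, then `M / (n L) - τ / S = (M
/ L) (1 / n - σ_j / S) - (τ - M σ_j / L) / S`. The first term measures unequal weights, the second
the oscillation of `s`. An empty interval contributes at most `1 / n`, and then `σ_j = 0`. -/
theorem abs_portionTerm_sub_le {s : ℝ → ℝ} (hs : IntegrableOn s (Ioo 0 1)) {S : ℝ} (hS : 0 < S)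
    (A : Set ℝ) (j : Fin n) :
    |P.portionTerm A j - (∫ x in P.interval j ∩ A, s x) / S| ≤
      |(∫ x in P.interval j, s x) / S - 1 / n| +
        1 / S * intervalDeviation s (P.left j) (P.right j) := by
  rw [portionTerm]
  have hn : (0 : ℝ) < n := by exact_mod_cast Nat.pos_of_ne_zero P.n_ne_zero
  split_ifs with h h'
  · have hL : 0 < P.len j := sub_pos.mpr h
    have hi := hs.mono_set (P.interval_subset j)
    have hv : volume (P.interval j) ≠ ⊤ := by simp [interval]
    have hv' : volume (P.interval j ∩ A) ≠ ⊤ :=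
      ne_top_of_le_ne_top hv (measure_mono inter_subset_left)
    set M := volume.real (P.interval j ∩ A) with hM
    have hM0 : 0 ≤ M := measureReal_nonneg
    have hML : M ≤ P.len j := by
      rw [← P.volume_real_interval]
      exact measureReal_mono inter_subset_left hv
    set σ := ∫ x in P.interval j, s x with hσ
    set τ := ∫ x in P.interval j ∩ A, s x with hτ
    have hdev : |τ - M * (σ / P.len j)| ≤ intervalDeviation s (P.left j) (P.right j) := by
      have e : τ - M * (σ / P.len j) = ∫ x in P.interval j ∩ A, (s x - σ / P.len j) := by
        rw [integral_sub (hi.mono_set inter_subset_left) (integrableOn_const hv')]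
        simp [hM, hτ]
      rw [e]
      refine abs_integral_le_integral_abs.trans ?_
      exact setIntegral_mono_set (hi.sub (integrableOn_const hv)).abs
        (Eventually.of_forall fun _ => abs_nonneg _) inter_subset_left.eventuallyLE
    rw [P.volume_real_interval]
    have e : M / (n * P.len j) - τ / S =
        M / P.len j * (1 / n - σ / S) - 1 / S * (τ - M * (σ / P.len j)) := by
      field_simp
      ring
    rw [e]
    refine (abs_sub _ _).trans (add_le_add ?_ ?_)
    · rw [abs_mul, abs_sub_comm, abs_of_nonneg (div_nonneg hM0 hL.le)]
      exact mul_le_of_le_one_left (abs_nonneg _) ((div_le_one hL).mpr hML)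
    · rw [abs_mul, abs_of_pos (one_div_pos.mpr hS)]
      gcongr
  all_goals
    have hI : P.interval j = ∅ := by rw [interval, Ioo_eq_empty h]
    have hd : 0 ≤ 1 / S * intervalDeviation s (P.left j) (P.right j) :=
      mul_nonneg (one_div_pos.mpr hS).le (intervalDeviation_nonneg _ _ _)
    simp only [hI, empty_inter, Measure.restrict_empty, integral_zero_measure, zero_div, sub_zero,
      zero_sub, abs_neg, abs_zero]
    have := abs_nonneg (1 / (n : ℝ))
    linarith

/-- Dirac masses at `0` and `1` are missed by the portion, hence only an inequality. It is in the
direction that the portmanteau criterion for open sets requires. -/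
theorem ofReal_portion_le_measure {U : Set ℝ} (hU : IsOpen U) :
    ENNReal.ofReal (P.portion (U ∩ Ioo 0 1)) ≤ P.measure (Subtype.val ⁻¹' U) := by
  classical
  have hn : (0 : ℝ) < n := by exact_mod_cast Nat.pos_of_ne_zero P.n_ne_zero
  have hG : MeasurableSet ((Subtype.val : unitInterval → ℝ) ⁻¹' U) :=
    measurable_subtype_coe hU.measurableSet
  rw [portion_eq_sum, ENNReal.ofReal_sum_of_nonneg fun j _ => P.portionTerm_nonneg _ j, measure,
    Measure.smul_apply, Measure.finsetSum_apply, smul_eq_mul, Finset.mul_sum]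
  refine Finset.sum_le_sum fun j _ => ?_
  have hinv : ENNReal.ofReal (1 / n) = (n : ℝ≥0∞)⁻¹ := by
    rw [one_div, ENNReal.ofReal_inv_of_pos hn, ENNReal.ofReal_natCast]
  rw [portionTerm]
  by_cases h : P.left j < P.right j
  · rw [if_pos h, if_pos h, Measure.smul_apply, Measure.restrict_apply hG, smul_eq_mul,
      ← preimage_inter]
    have hL : 0 < P.len j := sub_pos.mpr h
    have hsub : U ∩ P.interval j ⊆ unitInterval :=
      inter_subset_right.trans ((P.interval_subset j).trans Ioo_subset_Icc_self)
    have hvol : (volume : Measure unitInterval) (Subtype.val ⁻¹' (U ∩ P.interval j)) =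
        volume (P.interval j ∩ (U ∩ Ioo 0 1)) := by
      rw [Measure.Subtype.volume_def,
        comap_subtype_coe_apply (show MeasurableSet unitInterval from measurableSet_Icc),
        Subtype.image_preimage_coe, inter_eq_right.mpr hsub]
      congr 1
      ext x
      have := fun hx : x ∈ P.interval j => P.interval_subset j hx
      simp only [mem_inter_iff]
      tauto
    rw [hvol]
    have hv : volume (P.interval j) = ENNReal.ofReal (P.len j) := by
      rw [interval, Real.volume_Ioo]; rfl
    have hv2 : volume (P.interval j ∩ (U ∩ Ioo 0 1)) ≠ ⊤ :=
      ne_top_of_le_ne_top (by rw [hv]; exact ENNReal.ofReal_ne_top) (measure_mono inter_subset_left)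
    rw [P.volume_real_interval, hv, ← ENNReal.ofReal_inv_of_pos hL, ← hinv,
      ← ENNReal.ofReal_toReal hv2, ← ENNReal.ofReal_mul (by positivity),
      ← ENNReal.ofReal_mul (by positivity)]
    refine ENNReal.ofReal_le_ofReal (le_of_eq ?_)
    rw [measureReal_def]
    field_simp
  · rw [if_neg h, if_neg h, Measure.dirac_apply' _ hG]
    by_cases h' : P.right j ∈ U ∩ Ioo 0 1
    · rw [if_pos h', hinv, indicator_of_mem (by exact h'.1), Pi.one_apply, mul_one]
    · rw [if_neg h', ENNReal.ofReal_zero]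
      exact zero_le

end IntervalPartition

section Limit

variable {β : ℝ} {p q w : ℝ → ℝ}

/-- Summing the termwise bounds suffices, since `(π / S) (T / n) = 1 / n`. No regularity of `A`
beyond measurability enters. -/
theorem tendsto_portion (h : IsAdmissible β p q w) {T : ℝ}
    (hT : T = 1 / Real.pi * ∫ x in Ioo (0 : ℝ) 1, √(w x / p x))
    {P : (n : ℕ) → IntervalPartition (n + 1)}
    (hP : Tendsto (fun n => ∑ j, |1 / Real.pi * (∫ x in (P n).interval j, √(w x / p x)) -
      T / ((n + 1 : ℕ) : ℝ)|) atTop (𝓝 0))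
    (hdev : Tendsto (fun n => ∑ j, intervalDeviation (fun x => √(w x / p x)) ((P n).left j)
      ((P n).right j)) atTop (𝓝 0)) {A : Set ℝ} (hA : MeasurableSet A) (hA1 : A ⊆ Ioo 0 1) :
    Tendsto (fun n => (P n).portion A) atTop
      (𝓝 (∫ x in A, limitDensity (fun x => √(w x / p x)) x)) := by
  have hS := h.integral_sqrt_pos
  simp only [limitDensity]
  set S := ∫ x in Ioo (0 : ℝ) 1, √(w x / p x) with hSdef
  have hπ := Real.pi_pos
  have hlim := (hP.const_mul (Real.pi / S)).add (hdev.const_mul (1 / S))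
  rw [mul_zero, mul_zero, add_zero] at hlim
  rw [tendsto_iff_dist_tendsto_zero]
  refine squeeze_zero (fun n => dist_nonneg) (fun n => ?_) hlim
  rw [Real.dist_eq, (P n).portion_eq_sum, integral_div,
    ← (P n).sum_setIntegral_inter h.integrableOn_sqrt hA hA1, Finset.sum_div,
    ← Finset.sum_sub_distrib]
  refine (Finset.abs_sum_le_sum_abs _ _).trans ?_
  rw [Finset.mul_sum, Finset.mul_sum, ← Finset.sum_add_distrib]
  refine Finset.sum_le_sum fun j _ => ?_
  refine ((P n).abs_portionTerm_sub_le h.integrableOn_sqrt hS A j).trans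
    (add_le_add (le_of_eq ?_) le_rfl)
  have e : Real.pi / S = |Real.pi / S| := (abs_of_pos (div_pos hπ hS)).symm
  rw [e, ← abs_mul, hT]
  congr 1
  field_simp

theorem withDensity_limitDensity_apply (h : IsAdmissible β p q w) {U : Set ℝ} (hU : IsOpen U) :
    (volume : Measure unitInterval).withDensity
      (fun x => ENNReal.ofReal (limitDensity (fun x => √(w x / p x)) x)) (Subtype.val ⁻¹' U) =
    ENNReal.ofReal (∫ x in U ∩ Ioo 0 1, limitDensity (fun x => √(w x / p x)) x) := by
  set f := limitDensity (fun x => √(w x / p x)) with hf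
  have hG : MeasurableSet ((Subtype.val : unitInterval → ℝ) ⁻¹' U) :=
    measurable_subtype_coe hU.measurableSet
  have hf0 : ∀ x, 0 ≤ f x := fun x => div_nonneg (Real.sqrt_nonneg _) h.integral_sqrt_pos.le
  have hfi : IntegrableOn f (Ioo 0 1) := h.integrableOn_sqrt.div_const _
  rw [withDensity_apply _ hG, ← lintegral_indicator hG]
  have e : ∀ x : unitInterval, (Subtype.val ⁻¹' U).indicator
      (fun x : unitInterval => ENNReal.ofReal (f x)) x =
      U.indicator (fun x => ENNReal.ofReal (f x)) x := fun x => rfl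
  simp_rw [e]
  rw [Measure.Subtype.volume_def, lintegral_subtype_comap measurableSet_Icc
    (U.indicator fun x => ENNReal.ofReal (f x)), ← restrict_Ioo_eq_restrict_Icc,
    setLIntegral_indicator hU.measurableSet, ← ofReal_integral_eq_lintegral_ofReal
    (hfi.mono_set inter_subset_right) (Eventually.of_forall hf0)]

theorem integral_limitDensity (h : IsAdmissible β p q w) :
    ∫ x in Ioo 0 1, limitDensity (fun x => √(w x / p x)) x = 1 := by
  simp only [limitDensity]
  rw [integral_div, div_self h.integral_sqrt_pos.ne']

end Limit

theorem corollary1p2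
    (β : ℝ) (hβ : 1 < β)
    (p q w : ℝ → ℝ)
    (hp : MemLp p ∞ volume) (hp' : ∀ᵐ x, 1 / β ≤ p x ∧ p x ≤ β)
    (hq : MemLp q ∞ volume) (hq' : ∀ᵐ x, 0 ≤ q x ∧ q x ≤ β)
    (hw : MemLp w ∞ volume) (hw' : ∀ᵐ x, 1 / β ≤ w x ∧ w x ≤ β)
    (s : ℝ → ℝ) (hs : ∀ x, s x = √(w x / p x))
    (φ : ℝ≥0 → ℝ≥0∞)
    (hφ_conv : StrictConvexOn ℝ≥0 univ φ)
    (hφ_lsc : LowerSemicontinuous φ)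
    (hφ_growth : Tendsto (fun t : ℝ≥0 => φ t / (t : ℝ≥0∞)) atTop (𝓝 0) ∨
      Tendsto (fun t : ℝ≥0 => φ t / (t : ℝ≥0∞)) atTop (𝓝 ∞))
    -- `P n` is a partition into `n + 1` intervals
    (P : (n : ℕ) → IntervalPartition (n + 1))
    -- the partitions are asymptotically optimal, e.g. optimal
    (ε : ℕ → ℝ≥0∞) (hε : Tendsto ε atTop (𝓝 0))
    (hP : ∀ n, (P n).cost p q w φ ≤
      (⨅ Q : IntervalPartition (n + 1), Q.cost p q w φ) + ε n) :
    (∃ μ : ProbabilityMeasure unitInterval,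
      (μ : Measure unitInterval) =
        (volume : Measure unitInterval).withDensity
          (fun x => ENNReal.ofReal (limitDensity s x)) ∧
      Tendsto (fun n => (P n).probMeasure) atTop (𝓝 μ)) ∧
    (∀ A : Set ℝ, IsOpen A → A ⊆ Ioo 0 1 →
      Tendsto (fun n => (P n).portion A) atTop (𝓝 (∫ x in A, limitDensity s x))) ∧
    Tendsto (fun n => (P n).cost p q w φ) atTop
      (𝓝 (φ (Real.toNNReal (1 / Real.pi * ∫ x in Ioo (0 : ℝ) 1, s x)))) ∧
    Tendsto (fun n => ⨅ Q : IntervalPartition (n + 1), Q.cost p q w φ) atTop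
      (𝓝 (φ (Real.toNNReal (1 / Real.pi * ∫ x in Ioo (0 : ℝ) 1, s x)))) := by
  obtain rfl : s = fun x => √(w x / p x) := funext hs
  have h : IsAdmissible β p q w := ⟨hβ, ⟨hp.1, hp'⟩, hq', hq.1, ⟨hw.1, hw'⟩⟩
  obtain ⟨T, hT⟩ : ∃ T, T = 1 / Real.pi * ∫ x in Ioo (0 : ℝ) 1, √(w x / p x) := ⟨_, rfl⟩
  have hT0 : 0 < T := by rw [hT]; exact mul_pos (one_div_pos.mpr Real.pi_pos) h.integral_sqrt_pos
  have hφT : φ T.toNNReal ≠ ⊤ := hφ_conv.ne_top_of_pos (Real.toNNReal_pos.mpr hT0)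
  have hbound : ∀ r > 0, ∀ᶠ n in atTop, (P n).cost p q w φ ≤
      ENNReal.ofReal ((φ T.toNNReal).toReal + r) := by
    intro r hr
    filter_upwards [eventually_iInf_cost_le h hφ_conv hT (half_pos hr),
      hε.eventually_le_const (ENNReal.ofReal_pos.mpr (half_pos hr))] with n h1 h2
    refine (hP n).trans ((add_le_add h1 h2).trans (le_of_eq ?_))
    rw [← ENNReal.ofReal_add (by positivity) (by positivity)]
    congr 1
    ring
  obtain ⟨hcost, hshort⟩ := tendsto_cost_and_sum_abs h hφ_conv hφ_growth hT hbound
  obtain ⟨hweight, hdev⟩ := tendsto_sum_abs_weight_sub h hT hshort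
  have hcost' : Tendsto (fun n => (P n).cost p q w φ) atTop (𝓝 (φ T.toNNReal)) := by
    have h1 := ENNReal.tendsto_ofReal hcost
    rw [ENNReal.ofReal_toReal hφT] at h1
    refine h1.congr' ?_
    filter_upwards [hbound 1 one_pos] with n hn
    exact ENNReal.ofReal_toReal (ne_top_of_le_ne_top ENNReal.ofReal_ne_top hn)
  rw [← hT]
  refine ⟨?_, fun A hA hA1 => tendsto_portion h hT hweight hdev hA.measurableSet hA1, hcost', ?_⟩
  · have hprob : IsProbabilityMeasure ((volume : Measure unitInterval).withDensity
        fun x => ENNReal.ofReal (limitDensity (fun x => √(w x / p x)) x)) := by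
      constructor
      have := withDensity_limitDensity_apply h isOpen_univ
      rwa [preimage_univ, univ_inter, integral_limitDensity h, ENNReal.ofReal_one] at this
    -- Portmanteau: for probability measures it is enough that the limit measure of each open set is
    -- at most the lower limit of its measures. Intersecting with `(0, 1)` does not change the limit
    -- measure.
    refine ⟨⟨_, hprob⟩, rfl, tendsto_of_forall_isOpen_le_liminf_nat' fun G hG => ?_⟩
    obtain ⟨U, hU, rfl⟩ := isOpen_induced_iff.mp hG
    have h1 := ENNReal.tendsto_ofReal (tendsto_portion h hT hweight hdev
      (hU.inter isOpen_Ioo).measurableSet (inter_subset_right (s := U) (t := Ioo 0 1)))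
    rw [← withDensity_limitDensity_apply h hU] at h1
    exact h1.liminf_eq.symm.le.trans
      (liminf_le_liminf (Eventually.of_forall fun n => (P n).ofReal_portion_le_measure hU))
  -- The infimum is squeezed between `cost - ε n` and `cost`.
  · have hlow : Tendsto (fun n => (P n).cost p q w φ - ε n) atTop (𝓝 (φ T.toNNReal)) := by
      have := ENNReal.Tendsto.sub hcost' hε (Or.inl hφT)
      rwa [tsub_zero] at this
    exact tendsto_of_tendsto_of_tendsto_of_le_of_le hlow hcost'
      (fun n => tsub_le_iff_right.mpr (hP n)) fun n => iInf_le _ (P n)
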